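/- **Two-sided Counting Lemma.** *Notation.* Let $H$ be a graph with vertex set $[m]$, ordered $1,\dots,m$. For $u,v\in[m]$ let $N^+(v)=\{w\in N_H(v): w>v\}$, $N^-(v)=\{w\in N_H(v): w<v\}$ and $N^{<u}(v)=\{w\in N_H(v): w<u\}$. Let $k_{\mathrm{reg}}(H)$ be the smallest number such that, for all $i<j$ with $ij\in E(H)$, $$k_{\mathrm{reg}}(H)\ \ge\ \tfrac12|N^-(i)|+\tfrac12|N^{<i}(j)|+\begin{cases}3&\text{if }\exists k>i:\ jk,ik\in E(H),\ |N^{<i}(k)|\le|N^{<i}(j)|,\\ 2&\text{else if }\exists k>i:\ jk,ik\in E(H),\\ \tfrac32&\text{else if }\exists k>i:\ jk\in E(H),\\ 1&\text{otherwise,}\end{cases}$$ and, for all $i$ and all $j,j'>i$ with $ij,jj'\in E(H)$, $$k_{\mathrm{reg}}(H)\ \ge\ \tfrac12|N^{<i}(j)|+\tfrac12|N^{<i}(j')|+\begin{cases}2.501&\text{if }ij'\in E(H),\\ 2.001&\text{otherwise}\end{cases}$$ (if $H$ has no edges, put $k_{\mathrm{reg}}(H)=0$). For each $v$ let $\tau_v:N^+(v)\to\{1,\dots,|N^+(v)|\}$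 be any ordering of $N^+(v)$ along which $|N^{<v}(w)|$ is non-increasing, and let $$\tilde{\mathrm d}(H)=\max_{v\in[m]}\Big(|N^-(v)|+\max_{w\in N^+(v)}\big(\tau_v(w)+|N^{<v}(w)|\big)\Big),$$ where a maximum over the empty set is $0$ (the value does not depend on the choice of the $\tau_v$). For a graph $G$, $p>0$ and disjoint finite vertex sets $U,W$ let $e_G(U,W)$ be the number of edges of $G$ between $U$ and $W$, and let $d_p(U,W)=e_G(U,W)/(p|U||W|)$ (read as $0$ if $U$ or $W$ is empty). The pair $(U,W)$ is $(\varepsilon,p)$-regular in $G$ if $|d_p(U',W')-d_p(U,W)|\le\varepsilon$ for all $U'\subseteq U$, $W'\subseteq W$ with $|U'|\ge\varepsilon|U|$ and $|W'|\ge\varepsilon|W|$. It is $(p,\delta)$-bijumbled in $\Gamma$ if $\big|e_\Gamma(U',W')-p|U'||W'|\big|\le\delta\sqrt{|U'||W'|}$ for all $U'\subseteq U$, $W'\subseteq W$. Given vertex sets $V_1,\dots,V_m$ of $G$, let $n(H;G)$ be the number of partite copies of $H$ in $G$, that is, of maps $\varphi:[m]\to V(G)$ with $\varphi(i)\in V_i$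 for all $i$ and $\varphi(i)\varphi(j)\in E(G)$ for all $ij\in E(H)$ (such maps are automatically injective if the $V_i$ are pairwise disjoint), and let $d(H;G)=\prod_{ij\in E(H)}d_p(V_i,V_j)$, with densities taken in $G$. *Statement.* For every graph $H$ with vertex set $[m]$ and every $\gamma>0$ there are $\varepsilon,c>0$ such that the following holds for every $0<p\le1$. Put $$\beta=c\,p^{\max\left(k_{\mathrm{reg}}(H),\ \frac12+\frac12\tilde{\mathrm d}(H)\right)}.$$ Let $G\subseteq\Gamma$ be graphs and let $V_1,\dots,V_m$ be finite subsets of $V(G)$. Suppose that for each edge $ij$ of $H$ the sets $V_i$ and $V_j$ are disjoint and the pair $(V_i,V_j)$ is $(\varepsilon,p)$-regular in $G$ and $\big(p,\beta\sqrt{|V_i||V_j|}\big)$-bijumbled in $\Gamma$. Then $$\Big|\,n(H;G)-d(H;G)\,p^{e(H)}\prod_{i=1}^m|V_i|\,\Big|\ \le\ \gamma\,p^{e(H)}\prod_{i=1}^m|V_i|.$$ -/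

import Mathlib

open scoped Classical

/-! ### Sparse regularity and bijumbledness

All notions are for pairs of finite vertex sets; they are only used for disjoint pairs. -/

section Pairs

variable {V : Type*}

/-- `e_G(U, W)`: the number of edges of `G` with one end in `U` and the other in `W`
(for disjoint `U`, `W`). -/
noncomputable def edgesBetween (G : SimpleGraph V) (U W : Finset V) : ℕ :=
  (G.interedges U W).card

/-- The `p`-density `d_p(U, W) = e(U, W) / (p |U| |W|)`. -/
noncomputable def pDensity (G : SimpleGraph V) (p : ℝ) (U W : Finset V) : ℝ :=
  (edgesBetween G U W : ℝ) / (p * U.card * W.card)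

/-- The pair `(U, W)` is `(ε, p)`-regular in `G`. -/
def IsSparseRegular (G : SimpleGraph V) (ε p : ℝ) (U W : Finset V) : Prop :=
  ∀ U' W' : Finset V, U' ⊆ U → W' ⊆ W →
    ε * U.card ≤ U'.card → ε * W.card ≤ W'.card →
      |pDensity G p U' W' - pDensity G p U W| ≤ ε

/-- The pair `(U, W)` is `(p, δ)`-bijumbled in `Γ`. -/
def IsBijumbledPair (Γ : SimpleGraph V) (p δ : ℝ) (U W : Finset V) : Prop :=
  ∀ U' W' : Finset V, U' ⊆ U → W' ⊆ W →
    |(edgesBetween Γ U' W' : ℝ) - p * U'.card * W'.card| ≤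
      δ * Real.sqrt ((U'.card : ℝ) * W'.card)

end Pairs

/-! ### Parameters of a graph on `[m]` with its natural order -/

section Parameters

variable {m : ℕ}

/-- `N⁺(v)`: the neighbours of `v` that come after `v`. -/
noncomputable def nbrAfter (H : SimpleGraph (Fin m)) (v : Fin m) : Finset (Fin m) :=
  Finset.univ.filter fun w => H.Adj v w ∧ v < w

/-- `N^{<u}(v)`: the neighbours of `v` that come before `u`. -/
noncomputable def nbrBefore (H : SimpleGraph (Fin m)) (u v : Fin m) : Finset (Fin m) :=
  Finset.univ.filter fun w => H.Adj v w ∧ w < u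

/-- `N⁻(v)`: the neighbours of `v` that come before `v`. -/
noncomputable def nbrPrev (H : SimpleGraph (Fin m)) (v : Fin m) : Finset (Fin m) :=
  nbrBefore H v v

/-- The case distinction in the condition on the edge `ij`, `i < j`. If several cases apply,
the largest value counts. -/
noncomputable def kRegEdgeTerm (H : SimpleGraph (Fin m)) (i j : Fin m) : ℝ :=
  if ∃ k, i < k ∧ H.Adj j k ∧ H.Adj i k ∧
      (nbrBefore H i k).card ≤ (nbrBefore H i j).card then 3
  else if ∃ k, i < k ∧ H.Adj j k ∧ H.Adj i k then 2
  else if ∃ k, i < k ∧ H.Adj j k then 3 / 2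
  else 1

/-- The case distinction in the condition on a path `i j j'`. -/
noncomputable def kRegPathTerm (H : SimpleGraph (Fin m)) (i j' : Fin m) : ℝ :=
  if H.Adj i j' then 2.501 else 2.001

/-- `k` satisfies all the lower bounds that define `k_reg(H)`. -/
def IsKRegBound (H : SimpleGraph (Fin m)) (k : ℝ) : Prop :=
  (∀ i j : Fin m, i < j → H.Adj i j →
    ((nbrPrev H i).card : ℝ) / 2 + ((nbrBefore H i j).card : ℝ) / 2 + kRegEdgeTerm H i j ≤ k) ∧
  (∀ i j j' : Fin m, i < j → i < j' → H.Adj i j → H.Adj j j' →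
    ((nbrBefore H i j).card : ℝ) / 2 + ((nbrBefore H i j').card : ℝ) / 2 +
      kRegPathTerm H i j' ≤ k)

/-- `k_reg(H)`: the smallest number with `IsKRegBound` (see `isLeast_kReg`). If `H` has no
edges, there is no condition and the value, which then plays no role, is `0`. -/
noncomputable def kReg (H : SimpleGraph (Fin m)) : ℝ :=
  sInf {k : ℝ | IsKRegBound H k}

theorem exists_isKRegBound (H : SimpleGraph (Fin m)) : ∃ k, IsKRegBound H k := by
  obtain ⟨a, ha⟩ := (Set.finite_range (fun x : Fin m × Fin m =>
    ((nbrPrev H x.1).card : ℝ) / 2 + ((nbrBefore H x.1 x.2).card : ℝ) / 2 +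
      kRegEdgeTerm H x.1 x.2)).bddAbove
  obtain ⟨b, hb⟩ := (Set.finite_range (fun x : Fin m × Fin m × Fin m =>
    ((nbrBefore H x.1 x.2.1).card : ℝ) / 2 + ((nbrBefore H x.1 x.2.2).card : ℝ) / 2 +
      kRegPathTerm H x.1 x.2.2)).bddAbove
  refine ⟨max a b, fun i j _ _ => ?_, fun i j j' _ _ _ _ => ?_⟩
  · exact (ha ⟨(i, j), rfl⟩).trans (le_max_left _ _)
  · exact (hb ⟨(i, j, j'), rfl⟩).trans (le_max_right _ _)

/-- As soon as `H` has an edge, `k_reg(H)` is the least number with `IsKRegBound`. -/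
theorem isLeast_kReg (H : SimpleGraph (Fin m)) {a b : Fin m} (hab : H.Adj a b) :
    IsLeast {k : ℝ | IsKRegBound H k} (kReg H) := by
  obtain ⟨i₀, j₀, hlt, hadj⟩ : ∃ i j : Fin m, i < j ∧ H.Adj i j := by
    rcases lt_or_gt_of_ne hab.ne with h | h
    · exact ⟨a, b, h, hab⟩
    · exact ⟨b, a, h, hab.symm⟩
  have hne : {k : ℝ | IsKRegBound H k}.Nonempty := exists_isKRegBound H
  have hbd : BddBelow {k : ℝ | IsKRegBound H k} :=
    ⟨_, fun k hk => hk.1 i₀ j₀ hlt hadj⟩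
  refine ⟨⟨fun i j h1 h2 => ?_, fun i j j' h1 h2 h3 h4 => ?_⟩, fun k hk => csInf_le hbd hk⟩
  · exact le_csInf hne fun k hk => hk.1 i j h1 h2
  · exact le_csInf hne fun k hk => hk.2 i j j' h1 h2 h3 h4

/-- `τ` (with positions `1, 2, …`) is an ordering of `N⁺(v)` along which `|N^{<v}(w)|` is
(weakly) decreasing. -/
def IsDecreasingOrdering (H : SimpleGraph (Fin m)) (v : Fin m) (τ : Fin m → ℕ) : Prop :=
  Set.BijOn τ (nbrAfter H v) (Set.Icc 1 (nbrAfter H v).card) ∧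
    ∀ u ∈ nbrAfter H v, ∀ w ∈ nbrAfter H v, τ u ≤ τ w →
      (nbrBefore H v w).card ≤ (nbrBefore H v u).card

/-- A concrete such ordering `τ_v`: ties are broken by the order of the vertices. -/
noncomputable def tauPos (H : SimpleGraph (Fin m)) (v w : Fin m) : ℕ :=
  ((nbrAfter H v).filter fun u =>
    (nbrBefore H v w).card < (nbrBefore H v u).card ∨
      ((nbrBefore H v w).card = (nbrBefore H v u).card ∧ u ≤ w)).card

/-- `d̃(H) = max_v (|N⁻(v)| + max_{w ∈ N⁺(v)} (τ_v(w) + |N^{<v}(w)|))`, where a maximum over the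
empty set is `0`. The choice of the orderings `τ_v` does not matter: see `dTilde_eq`. -/
noncomputable def dTilde (H : SimpleGraph (Fin m)) : ℕ :=
  Finset.univ.sup fun v : Fin m =>
    (nbrPrev H v).card +
      (nbrAfter H v).sup fun w => tauPos H v w + (nbrBefore H v w).card

theorem isDecreasingOrdering_tauPos (H : SimpleGraph (Fin m)) (v : Fin m) :
    IsDecreasingOrdering H v (tauPos H v) := by
  have key : ∀ u ∈ nbrAfter H v, ∀ w ∈ nbrAfter H v,
      ((nbrBefore H v w).card < (nbrBefore H v u).card ∨
        ((nbrBefore H v w).card = (nbrBefore H v u).card ∧ u < w)) →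
      tauPos H v u < tauPos H v w := by
    intro u hu w hw h
    apply Finset.card_lt_card
    rw [Finset.ssubset_iff_of_subset]
    · refine ⟨w, by simp [hw], ?_⟩
      simp only [Finset.mem_filter, hw, true_and]
      rintro (h' | ⟨h', h''⟩) <;> rcases h with h | ⟨h, h3⟩
      · omega
      · omega
      · omega
      · exact absurd h3 (not_lt.mpr h'')
    · intro x hx
      simp only [Finset.mem_filter] at hx ⊢
      refine ⟨hx.1, ?_⟩
      rcases hx.2 with h' | ⟨h', h''⟩ <;> rcases h with h | ⟨h, h3⟩
      · left; omega
      · left; omega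
      · left; omega
      · right; exact ⟨by omega, h''.trans h3.le⟩
  have hinj : Set.InjOn (tauPos H v) (nbrAfter H v) := by
    intro u hu w hw he
    by_contra hne
    rcases lt_trichotomy (nbrBefore H v w).card (nbrBefore H v u).card with h | h | h
    · exact absurd he (key u hu w hw (Or.inl h)).ne
    · rcases lt_or_gt_of_ne hne with h' | h'
      · exact absurd he (key u hu w hw (Or.inr ⟨h, h'⟩)).ne
      · exact absurd he (key w hw u hu (Or.inr ⟨h.symm, h'⟩)).ne'
    · exact absurd he (key w hw u hu (Or.inl h)).ne'
  have hmaps : ∀ w ∈ nbrAfter H v, tauPos H v w ∈ Finset.Icc 1 (nbrAfter H v).card := by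
    intro w hw
    rw [Finset.mem_Icc]
    refine ⟨Finset.card_pos.mpr ⟨w, by simp [hw]⟩, Finset.card_le_card (Finset.filter_subset _ _)⟩
  refine ⟨⟨fun w hw => by simpa using hmaps w hw, hinj, ?_⟩, ?_⟩
  · have := Finset.surjOn_of_injOn_of_card_le (tauPos H v) (s := nbrAfter H v)
      (t := Finset.Icc 1 (nbrAfter H v).card) (fun w hw => by simpa using hmaps w hw) hinj (by simp)
    simpa using this
  · intro u hu w hw hle
    by_contra hlt
    exact absurd (key w hw u hu (Or.inl (not_le.mp hlt))) (not_lt.mpr hle)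

theorem sup_eq_of_isDecreasingOrdering (H : SimpleGraph (Fin m)) (v : Fin m)
    {τ : Fin m → ℕ} (hτ : IsDecreasingOrdering H v τ) :
    (nbrAfter H v).sup (fun w => τ w + (nbrBefore H v w).card) =
      (nbrAfter H v).sup (fun w => ((nbrAfter H v).filter fun u =>
        (nbrBefore H v w).card ≤ (nbrBefore H v u).card).card + (nbrBefore H v w).card) := by
  obtain ⟨⟨hmaps, hinj, hsurj⟩, hdec⟩ := hτ
  apply le_antisymm
  · refine Finset.sup_mono_fun fun w hw => Nat.add_le_add_right ?_ _
    have h1 : (Finset.Icc 1 (τ w)) ⊆ ((nbrAfter H v).filter fun u =>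
        (nbrBefore H v w).card ≤ (nbrBefore H v u).card).image τ := by
      intro t ht
      rw [Finset.mem_Icc] at ht
      obtain ⟨u, hu, rfl⟩ := hsurj (show t ∈ Set.Icc 1 (nbrAfter H v).card from
        ⟨ht.1, ht.2.trans (hmaps hw).2⟩)
      exact Finset.mem_image_of_mem _ (Finset.mem_filter.mpr ⟨hu, hdec u hu w hw ht.2⟩)
    calc τ w = (Finset.Icc 1 (τ w)).card := by simp
      _ ≤ _ := Finset.card_le_card h1
      _ ≤ _ := Finset.card_image_le
  · refine Finset.sup_le fun w hw => ?_
    obtain ⟨u, hu, hmax⟩ := Finset.exists_max_image ((nbrAfter H v).filter fun u =>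
        (nbrBefore H v w).card ≤ (nbrBefore H v u).card) τ ⟨w, by simp [hw]⟩
    rw [Finset.mem_filter] at hu
    refine le_trans ?_ (Finset.le_sup (f := fun w => τ w + (nbrBefore H v w).card) hu.1)
    refine Nat.add_le_add ?_ hu.2
    have h2 : ((nbrAfter H v).filter fun u =>
        (nbrBefore H v w).card ≤ (nbrBefore H v u).card).card ≤ (Finset.Icc 1 (τ u)).card := by
      refine Finset.card_le_card_of_injOn τ (fun x hx => ?_) (fun x hx y hy => ?_)
      · have hx' := (Finset.mem_filter.mp hx).1
        exact Finset.mem_coe.mpr (Finset.mem_Icc.mpr ⟨(hmaps hx').1, hmax x hx⟩)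
      · exact hinj (Finset.mem_filter.mp hx).1 (Finset.mem_filter.mp hy).1
    simpa using h2

/-- Any choice of decreasing orderings `τ_v` gives the same value `d̃(H)`. -/
theorem dTilde_eq (H : SimpleGraph (Fin m)) {τ : Fin m → Fin m → ℕ}
    (hτ : ∀ v, IsDecreasingOrdering H v (τ v)) :
    dTilde H = Finset.univ.sup fun v : Fin m =>
      (nbrPrev H v).card +
        (nbrAfter H v).sup fun w => τ v w + (nbrBefore H v w).card := by
  unfold dTilde
  refine Finset.sup_congr rfl fun v _ => ?_
  rw [sup_eq_of_isDecreasingOrdering H v (hτ v),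
    sup_eq_of_isDecreasingOrdering H v (isDecreasingOrdering_tauPos H v)]

/-- The edges `ij` of `H`, each listed once, as the pair with `i < j`. -/
noncomputable def edgePairs (H : SimpleGraph (Fin m)) : Finset (Fin m × Fin m) :=
  Finset.univ.filter fun x => x.1 < x.2 ∧ H.Adj x.1 x.2

theorem card_edgePairs (H : SimpleGraph (Fin m)) :
    (edgePairs H).card = H.edgeFinset.card := by
  refine Finset.card_bij (fun x _ => s(x.1, x.2)) ?_ ?_ ?_
  · intro x hx
    simpa using (Finset.mem_filter.mp hx).2.2
  · rintro ⟨a, b⟩ hx ⟨c, d⟩ hy h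
    have h1 : a < b := (Finset.mem_filter.mp hx).2.1
    have h2 : c < d := (Finset.mem_filter.mp hy).2.1
    rcases Sym2.eq_iff.mp h with ⟨rfl, rfl⟩ | ⟨h3, h4⟩
    · rfl
    · simp only at h3 h4
      subst h3 h4
      exact absurd h1 (not_lt.mpr h2.le)
  · intro e he
    induction e using Sym2.ind with
    | _ a b =>
      have hab : H.Adj a b := by simpa using he
      rcases lt_or_gt_of_ne hab.ne with h | h
      · exact ⟨(a, b), by simp [edgePairs, h, hab], rfl⟩
      · exact ⟨(b, a), by simp [edgePairs, h, hab.symm], Sym2.eq_swap⟩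

end Parameters

/-! ### Counting partite copies -/

section Counting

variable {m : ℕ} {V : Type*}

/-- The partite labelled copies of `H` in `G` with respect to `V_1, …, V_m`: the maps `φ` with
`φ i ∈ V_i` for every `i` that send edges of `H` to edges of `G`. They are automatically
injective if the sets are pairwise disjoint (see `injective_of_mem_partiteCopies`). -/
noncomputable def partiteCopies (H : SimpleGraph (Fin m)) (G : SimpleGraph V)
    (P : Fin m → Finset V) : Finset (Fin m → V) :=
  (Fintype.piFinset P).filter fun φ => ∀ i j, H.Adj i j → G.Adj (φ i) (φ j)

/-- `n(H; G)`. -/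
noncomputable def numCopies (H : SimpleGraph (Fin m)) (G : SimpleGraph V)
    (P : Fin m → Finset V) : ℕ :=
  (partiteCopies H G P).card

/-- `d(H; G)`: the product of `d_p(V_i, V_j)` over the edges `ij` of `H`. -/
noncomputable def densityProd (H : SimpleGraph (Fin m)) (G : SimpleGraph V) (p : ℝ)
    (P : Fin m → Finset V) : ℝ :=
  ∏ x ∈ edgePairs H, pDensity G p (P x.1) (P x.2)

theorem injective_of_mem_partiteCopies (H : SimpleGraph (Fin m)) (G : SimpleGraph V)
    (P : Fin m → Finset V) (hP : ∀ i j, i ≠ j → Disjoint (P i) (P j))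
    {φ : Fin m → V} (hφ : φ ∈ partiteCopies H G P) : Function.Injective φ := by
  intro i j hij
  by_contra hne
  have h := Fintype.mem_piFinset.mp (Finset.mem_filter.mp hφ).1
  exact Finset.disjoint_left.mp (hP i j hne) (h i) (hij ▸ h j)

end Counting

/-! The vertices of `H` are embedded one at a time in their order, and for each vertex still to come
a candidate set is kept: the common `G`-neighbourhood, inside its part, of the images of its
embedded neighbours. If the image of the first vertex is typical, the candidate sets have about the
expected sizes and the pairs belonging to edges are still regular with a worse parameter, so
induction on the number of vertices gives the right count. It remains to see that few images are
atypical, and that these carry few copies.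

Few are atypical: regularity is expressed as a small cut norm of the deviation `g` of `G` from its
density. By Cauchy–Schwarz and jumbledness of `Γ`, the codegrees of `g` are small on average
(`RegPair.sum_abs_codegree_le`). Hence trilinear forms of `g` with functions dominated by
neighbourhoods in `Γ` are small (`RegPair.abs_sum_one_sided_le`, `RegPair.abs_sum_two_sided_le`).
Inserting for each bad image functions that witness the failure of the cut norm bound shows that
there are few bad images (`card_not_cutBdd_le`).

They carry few copies: a small proportion of vertices could still lie in too many copies, so an
upper bound of the right order for the count in `Γ` alone is needed (`exists_copyCount_le`); it is
applied with the first part replaced by the set of bad images. In that bound one vertex may have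
large degrees into several candidate sets at once. The orderings behind `dTilde` control this: among
the exceptional neighbours the last one is paid for by its degree tail, the earlier ones by factors
`1/p`.

Exponents: once `h i` and `h j` neighbours are embedded, the scales of the candidate sets have
shrunk by `p ^ h i` and `p ^ h j`, so relative to them the squared jumbledness has exponent `2K - h
i - h j`. A pair that inherits regularity needs exponent 4; the pairs from the embedded vertex need
3, one of them 6 when both sides shrink; the degree tails need 2 plus the number of earlier
neighbours. `Admissible` collects these demands, and `kReg` and `dTilde` meet them. -/

/-! ### Jumbledness and cut norm as bounds on bilinear forms; degrees in jumbled pairs. -/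

section BilinearForms

variable {α β : Type*}

/-- The bilinear form of the kernel `K` on `X × Y` is bounded by the geometric mean of the
`ℓ¹`-norms, up to the factor `√Q`, on functions with values in `[-1, 1]`. -/
def Jumbled (K : α → β → ℝ) (Q : ℝ) (X : Finset α) (Y : Finset β) : Prop :=
  ∀ (a : α → ℝ) (b : β → ℝ), (∀ x, |a x| ≤ 1) → (∀ y, |b y| ≤ 1) →
    (∑ x ∈ X, ∑ y ∈ Y, K x y * a x * b y) ^ 2 ≤ Q * (∑ x ∈ X, |a x|) * ∑ y ∈ Y, |b y|

/-- The cut norm of the kernel `g` on `X × Y` is at most `e`. -/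
def CutBdd (g : α → β → ℝ) (e : ℝ) (X : Finset α) (Y : Finset β) : Prop :=
  ∀ (a : α → ℝ) (b : β → ℝ), (∀ x, |a x| ≤ 1) → (∀ y, |b y| ≤ 1) →
    |∑ x ∈ X, ∑ y ∈ Y, g x y * a x * b y| ≤ e

theorem sum_restrict {X' X : Finset α} (h : X' ⊆ X) (f : α → ℝ) :
    ∑ x ∈ X, (if x ∈ X' then f x else 0) = ∑ x ∈ X', f x := by
  rw [← Finset.sum_filter, Finset.filter_mem_eq_inter, Finset.inter_eq_right.mpr h]

theorem sum_sum_restrict {X' X : Finset α} {Y' Y : Finset β} (hX : X' ⊆ X) (hY : Y' ⊆ Y)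
    (K : α → β → ℝ) (a : α → ℝ) (b : β → ℝ) :
    ∑ x ∈ X, ∑ y ∈ Y, K x y * (if x ∈ X' then a x else 0) * (if y ∈ Y' then b y else 0) =
      ∑ x ∈ X', ∑ y ∈ Y', K x y * a x * b y := by
  rw [← sum_restrict hX]
  refine Finset.sum_congr rfl fun x _ => ?_
  split_ifs with hx
  · rw [← sum_restrict hY]
    refine Finset.sum_congr rfl fun y _ => ?_
    split_ifs <;> simp
  · simp

theorem abs_ite_le_one {P : Prop} [Decidable P] {r : ℝ} (h : |r| ≤ 1) :
    |if P then r else 0| ≤ 1 := by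
  split_ifs <;> simp [h]

theorem Jumbled.mono {K : α → β → ℝ} {Q Q' : ℝ} {X X' : Finset α} {Y Y' : Finset β}
    (h : Jumbled K Q X Y) (hQ : Q ≤ Q') (hX : X' ⊆ X) (hY : Y' ⊆ Y) : Jumbled K Q' X' Y' := by
  intro a b ha hb
  have := h (fun x => if x ∈ X' then a x else 0) (fun y => if y ∈ Y' then b y else 0)
    (fun x => abs_ite_le_one (ha x)) (fun y => abs_ite_le_one (hb y))
  rw [sum_sum_restrict hX hY] at this
  simp only [apply_ite abs, abs_zero] at this
  rw [sum_restrict hX, sum_restrict hY] at this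
  refine this.trans ?_
  gcongr

theorem CutBdd.mono {K : α → β → ℝ} {e e' : ℝ} {X X' : Finset α} {Y Y' : Finset β}
    (h : CutBdd K e X Y) (he : e ≤ e') (hX : X' ⊆ X) (hY : Y' ⊆ Y) : CutBdd K e' X' Y' := by
  intro a b ha hb
  have := h (fun x => if x ∈ X' then a x else 0) (fun y => if y ∈ Y' then b y else 0)
    (fun x => abs_ite_le_one (ha x)) (fun y => abs_ite_le_one (hb y))
  rw [sum_sum_restrict hX hY] at this
  exact this.trans he

theorem CutBdd.swap {K : α → β → ℝ} {e : ℝ} {X : Finset α} {Y : Finset β}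
    (h : CutBdd K e X Y) : CutBdd (fun y x => K x y) e Y X := by
  intro b a hb ha
  have := h a b ha hb
  rw [Finset.sum_comm] at this
  simpa only [mul_right_comm] using this

theorem Jumbled.swap {K : α → β → ℝ} {Q : ℝ} {X : Finset α} {Y : Finset β}
    (h : Jumbled K Q X Y) : Jumbled (fun y x => K x y) Q Y X := by
  intro b a hb ha
  have := h a b ha hb
  rw [Finset.sum_comm] at this
  simpa only [mul_right_comm] using this

/-- Rescaling `a` to values in `[-1, 1]` costs only one factor `M`, since the left side is quadratic
in `a` and the right side linear. -/
theorem Jumbled.scaled {K : α → β → ℝ} {Q M : ℝ} {X : Finset α} {Y : Finset β}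
    (h : Jumbled K Q X Y) (hM : 0 < M) {a : α → ℝ} {b : β → ℝ} (ha : ∀ x, |a x| ≤ M)
    (hb : ∀ y, |b y| ≤ 1) :
    (∑ x ∈ X, ∑ y ∈ Y, K x y * a x * b y) ^ 2 ≤ M * Q * (∑ x ∈ X, |a x|) * ∑ y ∈ Y, |b y| := by
  have := h (fun x => a x / M) b (fun x => by
    rw [abs_div, abs_of_pos hM]; exact (div_le_one hM).mpr (ha x)) hb
  have e1 : ∑ x ∈ X, ∑ y ∈ Y, K x y * (a x / M) * b y
      = (∑ x ∈ X, ∑ y ∈ Y, K x y * a x * b y) / M := by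
    simp only [Finset.sum_div]
    refine Finset.sum_congr rfl fun x _ => Finset.sum_congr rfl fun y _ => by ring
  have e2 : ∑ x ∈ X, |a x / M| = (∑ x ∈ X, |a x|) / M := by
    simp only [Finset.sum_div, abs_div, abs_of_pos hM]
  rw [e1, e2, div_pow, div_le_iff₀ (by positivity)] at this
  refine this.trans (le_of_eq ?_)
  field_simp

/-- In a jumbled pair, the vertices of atypically large degree carry few edges. -/
theorem Jumbled.sum_tail_le {Γ : α → β → ℝ} {p Q t : ℝ} {X : Finset α} {Y : Finset β}
    (hJ : Jumbled (fun x y => Γ x y - p) Q X Y) (hp : 0 < p) (hQ : 0 ≤ Q) {h : β → ℝ}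
    (h0 : ∀ y, 0 ≤ h y) (h1 : ∀ y, h y ≤ 1) (ht : ∑ y ∈ Y, h y ≤ t) :
    ∑ x ∈ X with 2 * p * t < ∑ y ∈ Y, Γ x y * h y, ∑ y ∈ Y, Γ x y * h y ≤ 2 * Q / p := by
  set A := X.filter fun x => 2 * p * t < ∑ y ∈ Y, Γ x y * h y with hA
  set e := ∑ x ∈ A, ∑ y ∈ Y, Γ x y * h y with he
  have hAX : A ⊆ X := Finset.filter_subset _ _
  have key := (hJ.mono le_rfl hAX subset_rfl) (fun _ => 1) h (by simp)
    (fun y => by rw [abs_of_nonneg (h0 y)]; exact h1 y)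
  have hs0 : 0 ≤ ∑ y ∈ Y, h y := Finset.sum_nonneg fun y _ => h0 y
  have e1 : ∑ x ∈ A, ∑ y ∈ Y, (Γ x y - p) * 1 * h y = e - p * A.card * ∑ y ∈ Y, h y := by
    simp only [mul_one, sub_mul, Finset.sum_sub_distrib, he, Finset.sum_const, nsmul_eq_mul,
      ← Finset.mul_sum]
    ring
  have e2 : ∑ y ∈ Y, |h y| = ∑ y ∈ Y, h y :=
    Finset.sum_congr rfl fun y _ => abs_of_nonneg (h0 y)
  rw [e1, e2] at key
  simp only [abs_one, Finset.sum_const, nsmul_eq_mul, mul_one] at key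
  have hcard : 2 * p * t * A.card ≤ e := by
    rw [he, mul_comm, ← nsmul_eq_mul]
    exact Finset.card_nsmul_le_sum _ _ _ fun x hx => (Finset.mem_filter.mp hx).2.le
  have ht0 : 0 ≤ t := hs0.trans ht
  have he0 : 0 ≤ e := le_trans (by positivity) hcard
  rcases he0.eq_or_lt with h' | h'
  · rw [← h']; positivity
  -- On `A` the expected weight is at most half of `e`, so the discrepancy is at least `e / 2`.
  -- Jumbledness bounds its square by `Q |A| t`, and `|A| t ≤ e / (2p)` by the choice of `A`; one
  -- factor `e` cancels.
  have h3 : p * A.card * ∑ y ∈ Y, h y ≤ e / 2 := by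
    calc p * A.card * ∑ y ∈ Y, h y ≤ p * A.card * t := by gcongr
      _ ≤ e / 2 := by linarith
  have h4 : (e / 2) ^ 2 ≤ Q * A.card * t := by
    calc (e / 2) ^ 2 ≤ (e - p * A.card * ∑ y ∈ Y, h y) ^ 2 := by
          gcongr; linarith
      _ ≤ Q * A.card * ∑ y ∈ Y, h y := key
      _ ≤ Q * A.card * t := by gcongr
  have h5 : Q * (A.card * t) * (2 * p) ≤ Q * e := by
    rw [mul_assoc]; gcongr; linarith
  rw [le_div_iff₀ hp]
  have h6 : e * (e * p) ≤ e * (2 * Q) := by nlinarith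
  exact le_of_mul_le_mul_left h6 h'

/-- The first moment of the degrees in a jumbled pair. -/
theorem Jumbled.sum_le {Γ : α → β → ℝ} {p Q s t : ℝ} {X : Finset α} {Y : Finset β}
    (hJ : Jumbled (fun x y => Γ x y - p) Q X Y) (hp : 0 < p)
    (hX : (X.card : ℝ) ≤ s) (hY : (Y.card : ℝ) ≤ t) (hQ : Q ≤ p ^ 2 * s * t) :
    ∑ x ∈ X, ∑ y ∈ Y, Γ x y ≤ 2 * p * s * t := by
  have key := hJ (fun _ => 1) (fun _ => 1) (by simp) (by simp)
  simp only [mul_one, Finset.sum_sub_distrib, Finset.sum_const, nsmul_eq_mul, abs_one] at key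
  have hs : 0 ≤ s := le_trans (by positivity) hX
  have ht : 0 ≤ t := le_trans (by positivity) hY
  have h1 : Q * X.card * Y.card ≤ (p * s * t) ^ 2 := by
    calc Q * X.card * Y.card ≤ (p ^ 2 * s * t) * s * t := by gcongr
      _ = (p * s * t) ^ 2 := by ring
  have h2 := abs_le_of_sq_le_sq' (key.trans h1) (by positivity)
  have h3 : (X.card : ℝ) * (Y.card * p) ≤ s * (t * p) := by gcongr
  linarith [h2.2]

/-- The second moment of the degrees in a jumbled pair. -/
theorem Jumbled.sum_sq_le {Γ : α → β → ℝ} {p Q s t : ℝ} {X : Finset α} {Y : Finset β}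
    (hJ : Jumbled (fun x y => Γ x y - p) Q X Y) (hp : 0 < p) (hQ0 : 0 ≤ Q)
    (h0 : ∀ x y, 0 ≤ Γ x y) (h1 : ∀ x y, Γ x y ≤ 1)
    (hX : (X.card : ℝ) ≤ s) (hY : (Y.card : ℝ) ≤ t) (hQ : Q ≤ p ^ 3 * s * t) :
    ∑ x ∈ X, (∑ y ∈ Y, Γ x y) ^ 2 ≤ 6 * p ^ 2 * s * t ^ 2 := by
  have tail := hJ.sum_tail_le hp hQ0 (h := fun _ => 1) (t := t) (by simp) (by simp) (by simpa)
  simp only [mul_one] at tail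
  have hs : 0 ≤ s := le_trans (by positivity) hX
  have ht : 0 ≤ t := le_trans (by positivity) hY
  have hD0 : ∀ x, 0 ≤ ∑ y ∈ Y, Γ x y := fun x => Finset.sum_nonneg fun y _ => h0 x y
  have hDt : ∀ x, ∑ y ∈ Y, Γ x y ≤ t := fun x => by
    refine le_trans (Finset.sum_le_sum fun y _ => h1 x y) ?_
    simpa using hY
  rw [← Finset.sum_filter_add_sum_filter_not X (fun x => 2 * p * t < ∑ y ∈ Y, Γ x y)]
  -- A large degree is still at most `t`, so `t` times the tail of the first moment suffices; the
  -- loss of `1/p` there explains the exponent 3 in `hQ`.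
  have b1 : ∑ x ∈ X with 2 * p * t < ∑ y ∈ Y, Γ x y, (∑ y ∈ Y, Γ x y) ^ 2 ≤
      2 * p ^ 2 * s * t ^ 2 := by
    calc _ ≤ ∑ x ∈ X with 2 * p * t < ∑ y ∈ Y, Γ x y, t * (∑ y ∈ Y, Γ x y) := by
          refine Finset.sum_le_sum fun x _ => ?_
          rw [sq]; exact mul_le_mul_of_nonneg_right (hDt x) (hD0 x)
      _ ≤ t * (2 * (p ^ 3 * s * t) / p) := by
          rw [← Finset.mul_sum]; gcongr; exact tail.trans (by gcongr)
      _ = 2 * p ^ 2 * s * t ^ 2 := by field_simp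
  have b2 : ∑ x ∈ X with ¬ 2 * p * t < ∑ y ∈ Y, Γ x y, (∑ y ∈ Y, Γ x y) ^ 2 ≤
      4 * p ^ 2 * s * t ^ 2 := by
    calc _ ≤ ∑ x ∈ X with ¬ 2 * p * t < ∑ y ∈ Y, Γ x y, (2 * p * t) ^ 2 := by
          refine Finset.sum_le_sum fun x hx => ?_
          have := not_lt.mp (Finset.mem_filter.mp hx).2
          have := hD0 x
          gcongr
      _ ≤ s * (2 * p * t) ^ 2 := by
          rw [Finset.sum_const, nsmul_eq_mul]
          gcongr
          exact le_trans (by exact_mod_cast Finset.card_le_card (Finset.filter_subset _ _)) hX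
      _ = 4 * p ^ 2 * s * t ^ 2 := by ring
  linarith

end BilinearForms

/-! ### From subsets to functions with values in `[-1, 1]`. -/

section SetsToFunctions

variable {α β : Type*}

/-- The difference of the two sides is convex in `a`, because the square root is concave. On the
cube `[0, 1]^X` it is therefore dominated by its value at some vertex, and vertices are indicators
of subsets. -/
theorem sum_mul_le_of_subsets (X : Finset α) (K : α → ℝ) {C : ℝ} (hC : 0 ≤ C)
    (h : ∀ t ⊆ X, ∑ i ∈ t, K i ≤ C * √(t.card : ℝ)) {a : α → ℝ} (h0 : ∀ i, 0 ≤ a i)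
    (h1 : ∀ i, a i ≤ 1) : ∑ i ∈ X, K i * a i ≤ C * √(∑ i ∈ X, a i) := by
  let f : (X → ℝ) → ℝ := fun u => ∑ i : X, K i * u i - C * √(∑ i : X, u i)
  let S : Set (X → ℝ) := {u | 0 ≤ ∑ i : X, u i}
  have hf : ConvexOn ℝ S f := by
    let l1 : (X → ℝ) →ₗ[ℝ] ℝ := ∑ i : X, K i • LinearMap.proj i
    let l2 : (X → ℝ) →ₗ[ℝ] ℝ := ∑ i : X, LinearMap.proj i
    have c2 : ConcaveOn ℝ S (fun u => C * √(l2 u)) := by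
      have := (Real.strictConcaveOn_sqrt.concaveOn.comp_linearMap l2).smul hC
      have hS : S = l2 ⁻¹' Set.Ici 0 := by
        ext u; simp [S, l2]
      rw [hS]
      exact this
    have c1 := (l1.convexOn c2.1).sub c2
    have : f = (⇑l1 - fun u => C * √(l2 u)) := by
      funext u; simp [f, l1, l2]
    rw [this]; exact c1
  let T : Set (X → ℝ) := Set.univ.pi fun _ => ({0, 1} : Set ℝ)
  have hTS : T ⊆ S := by
    intro u hu
    show 0 ≤ ∑ i : X, u i
    refine Finset.sum_nonneg fun i _ => ?_
    rcases hu i (Set.mem_univ _) with h | h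
    · exact h.ge
    · rw [Set.mem_singleton_iff.mp h]; exact zero_le_one
  have hmem : (fun i : X => a i) ∈ convexHull ℝ T := by
    rw [convexHull_pi]
    intro i _
    rw [convexHull_pair, segment_eq_Icc zero_le_one]
    exact ⟨h0 i, h1 i⟩
  obtain ⟨u, hu, hle⟩ := hf.exists_ge_of_mem_convexHull hTS hmem
  have hfu : f u ≤ 0 := by
    have := h (((Finset.univ : Finset X).filter fun i => u i = 1).map
      (Function.Embedding.subtype _)) (by
        intro x hx
        simp only [Finset.mem_map] at hx
        obtain ⟨y, -, rfl⟩ := hx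
        exact y.2)
    rw [Finset.sum_map, Finset.card_map, Finset.sum_filter] at this
    have e1 : ∑ i : X, K i * u i = ∑ i : X, if u i = 1 then K i else 0 := by
      refine Finset.sum_congr rfl fun i _ => ?_
      rcases hu i (Set.mem_univ _) with h | h
      · simp [h]
      · rw [Set.mem_singleton_iff.mp h]; simp
    have e2 : ∑ i : X, u i = ((Finset.univ.filter fun i : X => u i = 1).card : ℝ) := by
      rw [Finset.card_filter, Nat.cast_sum]
      refine Finset.sum_congr rfl fun i _ => ?_
      rcases hu i (Set.mem_univ _) with h | h
      · simp [h]
      · rw [Set.mem_singleton_iff.mp h]; simp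
    simp only [f, e1, e2]
    simpa using this
  have := hle.trans hfu
  simp only [f] at this
  rw [Finset.sum_coe_sort X (fun i => K i * a i), Finset.sum_coe_sort X a] at this
  linarith

theorem sum_mul_le_of_subsets' (X : Finset α) (K : α → ℝ) {C : ℝ}
    (h : ∀ t ⊆ X, ∑ i ∈ t, K i ≤ C) {a : α → ℝ} (h0 : ∀ i, 0 ≤ a i)
    (h1 : ∀ i, a i ≤ 1) : ∑ i ∈ X, K i * a i ≤ C := by
  refine le_trans ?_ (h (X.filter fun i => 0 ≤ K i) (Finset.filter_subset _ _))
  rw [Finset.sum_filter]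
  refine Finset.sum_le_sum fun i _ => ?_
  split_ifs with hi
  · exact mul_le_of_le_one_right hi (h1 i)
  · exact mul_nonpos_of_nonpos_of_nonneg (not_le.mp hi).le (h0 i)

/-- The one-variable statement is used twice: for a fixed subset of `Y` in the variable `x`, then in
`y` with the function `a` already in place. -/
theorem sum_sum_mul_le_of_subsets (X : Finset α) (Y : Finset β) (K : α → β → ℝ) {B : ℝ}
    (hB : 0 ≤ B)
    (h : ∀ X' ⊆ X, ∀ Y' ⊆ Y, ∑ x ∈ X', ∑ y ∈ Y', K x y ≤ B * √((X'.card : ℝ) * Y'.card))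
    {a : α → ℝ} {b : β → ℝ} (a0 : ∀ i, 0 ≤ a i) (a1 : ∀ i, a i ≤ 1) (b0 : ∀ i, 0 ≤ b i)
    (b1 : ∀ i, b i ≤ 1) :
    ∑ x ∈ X, ∑ y ∈ Y, K x y * a x * b y ≤ B * √((∑ x ∈ X, a x) * ∑ y ∈ Y, b y) := by
  have hA : 0 ≤ ∑ x ∈ X, a x := Finset.sum_nonneg fun i _ => a0 i
  have step : ∀ Y' ⊆ Y, ∑ x ∈ X, (∑ y ∈ Y', K x y) * a x ≤
      (B * √(Y'.card : ℝ)) * √(∑ x ∈ X, a x) := by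
    intro Y' hY'
    refine sum_mul_le_of_subsets X (fun x => ∑ y ∈ Y', K x y) (by positivity) ?_ a0 a1
    intro X' hX'
    refine (h X' hX' Y' hY').trans (le_of_eq ?_)
    rw [Real.sqrt_mul (by positivity)]; ring
  have := sum_mul_le_of_subsets Y (fun y => ∑ x ∈ X, K x y * a x)
    (C := B * √(∑ x ∈ X, a x)) (by positivity) (by
      intro Y' hY'
      have := step Y' hY'
      simp only [Finset.sum_mul] at this
      rw [Finset.sum_comm] at this
      exact this.trans (le_of_eq (by ring))) b0 b1
  rw [Finset.sum_comm, Real.sqrt_mul hA, ← mul_assoc]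
  simpa only [Finset.sum_mul] using this

theorem sum_sum_mul_le_of_subsets' (X : Finset α) (Y : Finset β) (K : α → β → ℝ) {B : ℝ}
    (h : ∀ X' ⊆ X, ∀ Y' ⊆ Y, ∑ x ∈ X', ∑ y ∈ Y', K x y ≤ B)
    {a : α → ℝ} {b : β → ℝ} (a0 : ∀ i, 0 ≤ a i) (a1 : ∀ i, a i ≤ 1) (b0 : ∀ i, 0 ≤ b i)
    (b1 : ∀ i, b i ≤ 1) :
    ∑ x ∈ X, ∑ y ∈ Y, K x y * a x * b y ≤ B := by
  have step : ∀ Y' ⊆ Y, ∑ x ∈ X, (∑ y ∈ Y', K x y) * a x ≤ B := fun Y' hY' =>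
    sum_mul_le_of_subsets' X (fun x => ∑ y ∈ Y', K x y) (fun X' hX' => h X' hX' Y' hY') a0 a1
  have := sum_mul_le_of_subsets' Y (fun y => ∑ x ∈ X, K x y * a x) (C := B) (by
      intro Y' hY'
      have := step Y' hY'
      simp only [Finset.sum_mul] at this
      rwa [Finset.sum_comm] at this) b0 b1
  rw [Finset.sum_comm]
  simpa only [Finset.sum_mul] using this

theorem sum_sum_posPart_negPart (X : Finset α) (Y : Finset β) (K : α → β → ℝ)
    (a : α → ℝ) (b : β → ℝ) :
    ∑ x ∈ X, ∑ y ∈ Y, K x y * a x * b y =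
      ∑ x ∈ X, ∑ y ∈ Y, K x y * (a x)⁺ * (b y)⁺ - ∑ x ∈ X, ∑ y ∈ Y, K x y * (a x)⁺ * (b y)⁻ -
      ∑ x ∈ X, ∑ y ∈ Y, K x y * (a x)⁻ * (b y)⁺ + ∑ x ∈ X, ∑ y ∈ Y, K x y * (a x)⁻ * (b y)⁻ := by
  simp only [← Finset.sum_sub_distrib, ← Finset.sum_add_distrib]
  refine Finset.sum_congr rfl fun x _ => Finset.sum_congr rfl fun y _ => ?_
  conv_lhs => rw [← posPart_sub_negPart (a x), ← posPart_sub_negPart (b y)]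
  ring

theorem posPart_le_one {r : ℝ} (h : |r| ≤ 1) : r⁺ ≤ 1 := by
  rw [posPart_def]; exact sup_le (le_of_abs_le h) zero_le_one

theorem negPart_le_one {r : ℝ} (h : |r| ≤ 1) : r⁻ ≤ 1 := by
  rw [negPart_def]; exact sup_le (neg_le_of_abs_le h |> fun h => by linarith) zero_le_one

theorem posPart_le_abs_real (r : ℝ) : r⁺ ≤ |r| := by
  rw [posPart_def]; exact sup_le (le_abs_self r) (abs_nonneg r)

theorem negPart_le_abs_real (r : ℝ) : r⁻ ≤ |r| := by
  rw [negPart_def]; exact sup_le (neg_le_abs r) (abs_nonneg r)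

/-- Splitting both functions into positive and negative parts gives four forms of the same size,
hence the factor `16 = 4²` after squaring. -/
theorem jumbled_of_subsets (X : Finset α) (Y : Finset β) (K : α → β → ℝ) {B : ℝ}
    (hB : 0 ≤ B)
    (h : ∀ X' ⊆ X, ∀ Y' ⊆ Y, |∑ x ∈ X', ∑ y ∈ Y', K x y| ≤ B * √((X'.card : ℝ) * Y'.card)) :
    Jumbled K (16 * B ^ 2) X Y := by
  intro a b ha hb
  have sq0 : ∀ (a' : α → ℝ) (b' : β → ℝ), (∀ i, 0 ≤ a' i) → (∀ i, a' i ≤ 1) → (∀ i, a' i ≤ |a i|) →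
      (∀ i, 0 ≤ b' i) → (∀ i, b' i ≤ 1) → (∀ i, b' i ≤ |b i|) →
      |∑ x ∈ X, ∑ y ∈ Y, K x y * a' x * b' y| ≤ B * √((∑ x ∈ X, |a x|) * ∑ y ∈ Y, |b y|) := by
    intro a' b' a0 a1 a2 b0 b1 b2
    have hmono : B * √((∑ x ∈ X, a' x) * ∑ y ∈ Y, b' y) ≤
        B * √((∑ x ∈ X, |a x|) * ∑ y ∈ Y, |b y|) := by
      have : 0 ≤ ∑ y ∈ Y, b' y := Finset.sum_nonneg fun i _ => b0 i
      gcongr with i _ i _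
      · exact a2 i
      · exact b2 i
    rw [abs_le]
    constructor
    · have := sum_sum_mul_le_of_subsets X Y (fun x y => - K x y) hB (fun X' hX' Y' hY' => by
        simp only [Finset.sum_neg_distrib]
        exact (neg_le_abs _).trans (h X' hX' Y' hY')) a0 a1 b0 b1
      simp only [neg_mul, Finset.sum_neg_distrib] at this
      linarith
    · exact (sum_sum_mul_le_of_subsets X Y K hB (fun X' hX' Y' hY' =>
        (le_abs_self _).trans (h X' hX' Y' hY')) a0 a1 b0 b1).trans hmono
  have pa := fun x => posPart_nonneg (a x)
  have na := fun x => negPart_nonneg (a x)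
  have pb := fun x => posPart_nonneg (b x)
  have nb := fun x => negPart_nonneg (b x)
  have h1 := sq0 _ _ pa (fun x => posPart_le_one (ha x)) (fun x => posPart_le_abs_real _)
    pb (fun x => posPart_le_one (hb x)) (fun x => posPart_le_abs_real _)
  have h2 := sq0 _ _ pa (fun x => posPart_le_one (ha x)) (fun x => posPart_le_abs_real _)
    nb (fun x => negPart_le_one (hb x)) (fun x => negPart_le_abs_real _)
  have h3 := sq0 _ _ na (fun x => negPart_le_one (ha x)) (fun x => negPart_le_abs_real _)
    pb (fun x => posPart_le_one (hb x)) (fun x => posPart_le_abs_real _)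
  have h4 := sq0 _ _ na (fun x => negPart_le_one (ha x)) (fun x => negPart_le_abs_real _)
    nb (fun x => negPart_le_one (hb x)) (fun x => negPart_le_abs_real _)
  rw [sum_sum_posPart_negPart]
  have hN : 0 ≤ (∑ x ∈ X, |a x|) * ∑ y ∈ Y, |b y| := by positivity
  rw [abs_le] at h1 h2 h3 h4
  refine (sq_le_sq' (b := 4 * (B * √((∑ x ∈ X, |a x|) * ∑ y ∈ Y, |b y|)))
    (by linarith [h1.1, h2.2, h3.2, h4.1]) (by linarith [h1.2, h2.1, h3.1, h4.2])).trans
    (le_of_eq ?_)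
  rw [mul_pow, mul_pow, Real.sq_sqrt hN]; ring

theorem cutBdd_of_subsets (X : Finset α) (Y : Finset β) (K : α → β → ℝ) {B : ℝ}
    (h : ∀ X' ⊆ X, ∀ Y' ⊆ Y, |∑ x ∈ X', ∑ y ∈ Y', K x y| ≤ B) :
    CutBdd K (4 * B) X Y := by
  intro a b ha hb
  have sq0 : ∀ (a' : α → ℝ) (b' : β → ℝ), (∀ i, 0 ≤ a' i) → (∀ i, a' i ≤ 1) →
      (∀ i, 0 ≤ b' i) → (∀ i, b' i ≤ 1) →
      |∑ x ∈ X, ∑ y ∈ Y, K x y * a' x * b' y| ≤ B := by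
    intro a' b' a0 a1 b0 b1
    rw [abs_le]
    constructor
    · have := sum_sum_mul_le_of_subsets' X Y (fun x y => - K x y) (fun X' hX' Y' hY' => by
        simp only [Finset.sum_neg_distrib]
        exact (neg_le_abs _).trans (h X' hX' Y' hY')) a0 a1 b0 b1
      simp only [neg_mul, Finset.sum_neg_distrib] at this
      linarith
    · exact sum_sum_mul_le_of_subsets' X Y K (fun X' hX' Y' hY' =>
        (le_abs_self _).trans (h X' hX' Y' hY')) a0 a1 b0 b1
  have pa := fun x => posPart_nonneg (a x)
  have na := fun x => negPart_nonneg (a x)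
  have pb := fun x => posPart_nonneg (b x)
  have nb := fun x => negPart_nonneg (b x)
  have h1 := sq0 _ _ pa (fun x => posPart_le_one (ha x)) pb (fun x => posPart_le_one (hb x))
  have h2 := sq0 _ _ pa (fun x => posPart_le_one (ha x)) nb (fun x => negPart_le_one (hb x))
  have h3 := sq0 _ _ na (fun x => negPart_le_one (ha x)) pb (fun x => posPart_le_one (hb x))
  have h4 := sq0 _ _ na (fun x => negPart_le_one (ha x)) nb (fun x => negPart_le_one (hb x))
  rw [sum_sum_posPart_negPart]
  rw [abs_le] at *
  constructor <;> linarith [h1.1, h1.2, h2.1, h2.2, h3.1, h3.2, h4.1, h4.2]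

end SetsToFunctions

/-! ### Average codegrees of the deviation in a regular pair. -/

section Triangles

variable {α β δ : Type*}

theorem sum_sum_sq_le (X : Finset α) (Y : Finset β) {r f g : α → β → ℝ}
    (hf : ∀ x y, 0 ≤ f x y) (hg : ∀ x y, 0 ≤ g x y) (h : ∀ x y, r x y ^ 2 ≤ f x y * g x y) :
    (∑ x ∈ X, ∑ y ∈ Y, r x y) ^ 2 ≤ (∑ x ∈ X, ∑ y ∈ Y, f x y) * ∑ x ∈ X, ∑ y ∈ Y, g x y := by
  simp only [← Finset.sum_product']
  exact Finset.sum_sq_le_sum_mul_sum_of_sq_le_mul _ (fun i _ => hf _ _) (fun i _ => hg _ _)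
    fun i _ => h _ _

theorem sum_sq_sum (X : Finset α) (Y : Finset β) (u : α → β → ℝ) :
    ∑ x ∈ X, (∑ y ∈ Y, u x y) ^ 2 = ∑ y ∈ Y, ∑ y' ∈ Y, ∑ x ∈ X, u x y * u x y' := by
  simp only [sq, Finset.sum_mul_sum]
  rw [Finset.sum_comm]
  exact Finset.sum_congr rfl fun y _ => Finset.sum_comm

theorem sum_sum_mul_sq_sum (X : Finset α) (Z : Finset δ) (Y : Finset β) (K : α → δ → ℝ)
    (u : α → β → ℝ) (v : δ → β → ℝ) :
    ∑ x ∈ X, ∑ z ∈ Z, K x z * (∑ y ∈ Y, u x y * v z y) ^ 2 =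
      ∑ y ∈ Y, ∑ y' ∈ Y, ∑ x ∈ X, ∑ z ∈ Z, K x z * (u x y * u x y') * (v z y * v z y') := by
  have : ∀ x z, K x z * (∑ y ∈ Y, u x y * v z y) ^ 2 =
      ∑ y ∈ Y, ∑ y' ∈ Y, K x z * (u x y * u x y') * (v z y * v z y') := by
    intro x z
    rw [sq, Finset.sum_mul_sum, Finset.mul_sum]
    refine Finset.sum_congr rfl fun y _ => ?_
    rw [Finset.mul_sum]
    exact Finset.sum_congr rfl fun y' _ => by ring
  simp only [this]
  calc _ = ∑ x ∈ X, ∑ y ∈ Y, ∑ z ∈ Z, ∑ y' ∈ Y, K x z * (u x y * u x y') * (v z y * v z y') :=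
        Finset.sum_congr rfl fun x _ => Finset.sum_comm
    _ = ∑ y ∈ Y, ∑ x ∈ X, ∑ z ∈ Z, ∑ y' ∈ Y, K x z * (u x y * u x y') * (v z y * v z y') :=
        Finset.sum_comm
    _ = ∑ y ∈ Y, ∑ x ∈ X, ∑ y' ∈ Y, ∑ z ∈ Z, K x z * (u x y * u x y') * (v z y * v z y') :=
        Finset.sum_congr rfl fun y _ => Finset.sum_congr rfl fun x _ => Finset.sum_comm
    _ = _ := Finset.sum_congr rfl fun y _ => Finset.sum_comm

/-- Replacing the weight of a jumbled kernel by its density in a weighted sum of squares of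
bilinear expressions. -/
theorem Jumbled.sum_mul_sq_le {K : α → δ → ℝ} {Q : ℝ} {X : Finset α} {Z : Finset δ}
    (hK : Jumbled K Q X Z) (hQ : 0 ≤ Q) (Y : Finset β) {u : α → β → ℝ} {v : δ → β → ℝ}
    (hu : ∀ x y, |u x y| ≤ 3) (hv : ∀ z y, |v z y| ≤ 1) :
    (∑ x ∈ X, ∑ z ∈ Z, K x z * (∑ y ∈ Y, u x y * v z y) ^ 2) ^ 2 ≤
      9 * Q * (∑ x ∈ X, (∑ y ∈ Y, |u x y|) ^ 2) * ∑ z ∈ Z, (∑ y ∈ Y, |v z y|) ^ 2 := by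
  rw [sum_sum_mul_sq_sum, sum_sq_sum, sum_sq_sum]
  have e : 9 * Q * ∑ y ∈ Y, ∑ y' ∈ Y, ∑ x ∈ X, |u x y| * |u x y'| =
      ∑ y ∈ Y, ∑ y' ∈ Y, 9 * Q * ∑ x ∈ X, |u x y| * |u x y'| := by
    simp only [Finset.mul_sum]
  rw [e]
  -- Expanding the square leaves, for each pair `y`, `y'`, a bilinear form of `K` in products
  -- bounded by `3 · 3 = 9` and by `1`. Jumbledness bounds each form, and Cauchy–Schwarz over the
  -- pairs reassembles the squares.
  refine sum_sum_sq_le Y Y (fun y y' => by positivity) (fun y y' => by positivity) fun y y' => ?_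
  refine (hK.scaled (M := 9) (by norm_num) (fun x => ?_) (fun z => ?_)).trans (le_of_eq ?_)
  · rw [abs_mul]
    calc _ ≤ (3 : ℝ) * 3 := mul_le_mul (hu _ _) (hu _ _) (abs_nonneg _) (by norm_num)
      _ = 9 := by norm_num
  · rw [abs_mul]
    exact mul_le_one₀ (hv _ _) (abs_nonneg _) (hv _ _)
  · simp only [abs_mul]

/-- The pair `(X, Y)` is jumbled for `Γ`, and `g`, the deviation of a subgraph of `Γ` from its
density, has small cut norm; `s`, `t` are the scales of `X`, `Y`. -/
structure RegPair (g Γ : α → β → ℝ) (p η s t : ℝ) (X : Finset α) (Y : Finset β) : Prop where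
  p_pos : 0 < p
  p_le : p ≤ 1
  eta_pos : 0 < η
  eta_le : η ≤ 1
  s_pos : 0 < s
  t_pos : 0 < t
  nonneg : ∀ x y, 0 ≤ Γ x y
  le_one : ∀ x y, Γ x y ≤ 1
  abs_le : ∀ x y, |g x y| ≤ Γ x y + 2 * p
  card_left : (X.card : ℝ) ≤ s
  card_right : (Y.card : ℝ) ≤ t
  jumbled : Jumbled (fun x y => Γ x y - p) (η ^ 2 * p ^ 4 * s * t) X Y
  cut : CutBdd g (η * p * s * t) X Y

namespace RegPair

variable {g Γ : α → β → ℝ} {p η s t : ℝ} {X : Finset α} {Y : Finset β}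

theorem mono_right (h : RegPair g Γ p η s t X Y) {Y' : Finset β} (hY : Y' ⊆ Y) :
    RegPair g Γ p η s t X Y' :=
  { h with
    card_right := le_trans (by exact_mod_cast Finset.card_le_card hY) h.card_right
    jumbled := h.jumbled.mono le_rfl subset_rfl hY
    cut := h.cut.mono le_rfl subset_rfl hY }

theorem abs_le_three (h : RegPair g Γ p η s t X Y) (x : α) (y : β) : |g x y| ≤ 3 := by
  linarith [h.abs_le x y, h.le_one x y, h.p_le]

theorem Q_nonneg (h : RegPair g Γ p η s t X Y) : 0 ≤ η ^ 2 * p ^ 4 * s * t := by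
  have := h.p_pos; have := h.s_pos; have := h.t_pos; positivity

theorem Q_le (h : RegPair g Γ p η s t X Y) : η ^ 2 * p ^ 4 * s * t ≤ p ^ 3 * s * t := by
  have := h.p_pos; have := h.s_pos; have := h.t_pos; have := h.eta_pos
  have h1 : η ^ 2 ≤ 1 := pow_le_one₀ h.eta_pos.le h.eta_le
  have h2 : p ^ 4 ≤ p ^ 3 := pow_le_pow_of_le_one h.p_pos.le h.p_le (by norm_num)
  calc η ^ 2 * p ^ 4 * s * t ≤ 1 * p ^ 3 * s * t := by gcongr
    _ = _ := by ring

theorem sum_abs_le (h : RegPair g Γ p η s t X Y) (x : α) :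
    ∑ y ∈ Y, |g x y| ≤ ∑ y ∈ Y, Γ x y + 2 * p * t := by
  calc ∑ y ∈ Y, |g x y| ≤ ∑ y ∈ Y, (Γ x y + 2 * p) := Finset.sum_le_sum fun y _ => h.abs_le x y
    _ = ∑ y ∈ Y, Γ x y + Y.card * (2 * p) := by
      rw [Finset.sum_add_distrib, Finset.sum_const, nsmul_eq_mul]
    _ ≤ ∑ y ∈ Y, Γ x y + t * (2 * p) := by
      have := h.p_pos; have := h.card_right; gcongr
    _ = _ := by ring

theorem sum_sq_sum_abs_le (h : RegPair g Γ p η s t X Y) :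
    ∑ x ∈ X, (∑ y ∈ Y, |g x y|) ^ 2 ≤ 20 * p ^ 2 * s * t ^ 2 := by
  have hp := h.p_pos; have hs := h.s_pos; have ht := h.t_pos
  have h1 := h.jumbled.sum_sq_le hp h.Q_nonneg h.nonneg h.le_one h.card_left h.card_right h.Q_le
  calc _ ≤ ∑ x ∈ X, (2 * (∑ y ∈ Y, Γ x y) ^ 2 + 8 * p ^ 2 * t ^ 2) := by
        refine Finset.sum_le_sum fun x _ => ?_
        have h3 : 0 ≤ ∑ y ∈ Y, |g x y| := Finset.sum_nonneg fun y _ => abs_nonneg _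
        calc (∑ y ∈ Y, |g x y|) ^ 2 ≤ (∑ y ∈ Y, Γ x y + 2 * p * t) ^ 2 := by
              gcongr; exact h.sum_abs_le x
          _ ≤ _ := by nlinarith [sq_nonneg (∑ y ∈ Y, Γ x y - 2 * p * t)]
    _ = 2 * ∑ x ∈ X, (∑ y ∈ Y, Γ x y) ^ 2 + X.card * (8 * p ^ 2 * t ^ 2) := by
        rw [Finset.sum_add_distrib, Finset.mul_sum, Finset.sum_const, nsmul_eq_mul]
    _ ≤ 2 * (6 * p ^ 2 * s * t ^ 2) + s * (8 * p ^ 2 * t ^ 2) := by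
        have := h.card_left; gcongr
    _ = _ := by ring

theorem tail_left (h : RegPair g Γ p η s t X Y) :
    ∑ x ∈ X with 2 * p * t < ∑ y ∈ Y, Γ x y, ∑ y ∈ Y, Γ x y ≤ 2 * η ^ 2 * p ^ 3 * s * t := by
  have := h.jumbled.sum_tail_le h.p_pos h.Q_nonneg (h := fun _ => 1) (t := t) (by simp)
    (by simp) (by simpa using h.card_right)
  simp only [mul_one] at this
  refine this.trans (le_of_eq ?_)
  have := h.p_pos
  field_simp

/-- The signed degree at `x` is at most `4pt` unless `x` has atypically large degree in `Γ`.
Atypical `x` are covered by the degree tail; for typical `x` the rescaled signed degree can itself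
serve as a test function for the cut norm. -/
theorem sum_sum_sq_signed_le (h : RegPair g Γ p η s t X Y) {σ : β → β → ℝ}
    (hσ : ∀ y y', |σ y y'| ≤ 1) :
    ∑ x ∈ X, ∑ y' ∈ Y, (∑ y ∈ Y, g x y * σ y' y) ^ 2 ≤ 12 * η * p ^ 2 * s * t ^ 3 := by
  have hp := h.p_pos; have hs := h.s_pos; have ht := h.t_pos; have hη := h.eta_pos
  set A := X.filter fun x => 2 * p * t < ∑ y ∈ Y, Γ x y with hA
  have hF : ∀ x y', |∑ y ∈ Y, g x y * σ y' y| ≤ ∑ y ∈ Y, Γ x y + 2 * p * t := by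
    intro x y'
    refine (Finset.abs_sum_le_sum_abs _ _).trans (le_trans ?_ (h.sum_abs_le x))
    refine Finset.sum_le_sum fun y _ => ?_
    rw [abs_mul]
    exact mul_le_of_le_one_right (abs_nonneg _) (hσ _ _)
  have hD0 : ∀ x, 0 ≤ ∑ y ∈ Y, Γ x y := fun x => Finset.sum_nonneg fun y _ => h.nonneg x y
  have hDt : ∀ x, ∑ y ∈ Y, Γ x y ≤ t := fun x => by
    refine le_trans (Finset.sum_le_sum fun y _ => h.le_one x y) ?_
    simpa using h.card_right
  have hη2 : η ^ 2 ≤ η := by nlinarith [h.eta_le]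
  have hp3 : p ^ 3 ≤ p ^ 2 := pow_le_pow_of_le_one hp.le h.p_le (by norm_num)
  rw [← Finset.sum_filter_add_sum_filter_not X (fun x => 2 * p * t < ∑ y ∈ Y, Γ x y)]
  have b1 : ∑ x ∈ A, ∑ y' ∈ Y, (∑ y ∈ Y, g x y * σ y' y) ^ 2 ≤ 8 * η * p ^ 2 * s * t ^ 3 := by
    calc _ ≤ ∑ x ∈ A, ∑ y' ∈ Y, 4 * t * ∑ y ∈ Y, Γ x y := by
          refine Finset.sum_le_sum fun x hx => Finset.sum_le_sum fun y' _ => ?_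
          have h1 : 2 * p * t < ∑ y ∈ Y, Γ x y := (Finset.mem_filter.mp hx).2
          rw [← sq_abs]
          calc _ ≤ (2 * ∑ y ∈ Y, Γ x y) ^ 2 := by
                gcongr; linarith [hF x y']
            _ = 4 * (∑ y ∈ Y, Γ x y) * (∑ y ∈ Y, Γ x y) := by ring
            _ ≤ 4 * t * ∑ y ∈ Y, Γ x y := by
                have := hDt x; have := hD0 x; gcongr
      _ = Y.card * (4 * t) * ∑ x ∈ A, ∑ y ∈ Y, Γ x y := by
          simp only [Finset.sum_const, nsmul_eq_mul, Finset.mul_sum, mul_assoc]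
      _ ≤ t * (4 * t) * (2 * η ^ 2 * p ^ 3 * s * t) := by
          have h5 : (0 : ℝ) ≤ ∑ x ∈ A, ∑ y ∈ Y, Γ x y := Finset.sum_nonneg fun x _ => hD0 x
          have := h.card_right; have := h.tail_left
          gcongr
      _ ≤ t * (4 * t) * (2 * η * p ^ 2 * s * t) := by gcongr
      _ = _ := by ring
  have b2 : ∑ x ∈ X with ¬ 2 * p * t < ∑ y ∈ Y, Γ x y,
      ∑ y' ∈ Y, (∑ y ∈ Y, g x y * σ y' y) ^ 2 ≤ 4 * η * p ^ 2 * s * t ^ 3 := by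
    rw [Finset.sum_comm]
    calc _ ≤ ∑ y' ∈ Y, 4 * p * t * (η * p * s * t) := by
          refine Finset.sum_le_sum fun y' _ => ?_
          -- One of the two factors of the square, divided by `4pt`, becomes the test function on
          -- `X`; the other supplies `g` and the signs.
          have hcut := (h.cut.mono le_rfl (Finset.filter_subset (fun x => ¬ 2 * p * t <
            ∑ y ∈ Y, Γ x y) X) subset_rfl) (fun x => if 2 * p * t < ∑ y ∈ Y, Γ x y then 0 else
              (∑ y ∈ Y, g x y * σ y' y) / (4 * p * t)) (fun y => σ y' y) (fun x => by
                split_ifs with hx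
                · simp
                · rw [abs_div, abs_of_pos (show 0 < 4 * p * t by positivity),
                    div_le_one (by positivity)]
                  linarith [hF x y']) (fun y => hσ y' y)
          have := (le_abs_self _).trans hcut
          have e : ∑ x ∈ X with ¬ 2 * p * t < ∑ y ∈ Y, Γ x y, (∑ y ∈ Y, g x y * σ y' y) ^ 2 =
              4 * p * t * ∑ x ∈ X with ¬ 2 * p * t < ∑ y ∈ Y, Γ x y, ∑ y ∈ Y, g x y *
                (if 2 * p * t < ∑ y ∈ Y, Γ x y then 0 else
                  (∑ y ∈ Y, g x y * σ y' y) / (4 * p * t)) * σ y' y := by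
            rw [Finset.mul_sum]
            refine Finset.sum_congr rfl fun x hx => ?_
            rw [if_neg (Finset.mem_filter.mp hx).2]
            have : ∀ y, g x y * ((∑ y ∈ Y, g x y * σ y' y) / (4 * p * t)) * σ y' y =
              (g x y * σ y' y) * ((∑ y ∈ Y, g x y * σ y' y) / (4 * p * t)) := fun y => by ring
            simp only [this]
            rw [← Finset.sum_mul]
            field_simp
          rw [e]
          gcongr
      _ = Y.card * (4 * p * t * (η * p * s * t)) := by
          rw [Finset.sum_const, nsmul_eq_mul]
      _ ≤ t * (4 * p * t * (η * p * s * t)) := by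
          have := h.card_right; gcongr
      _ = _ := by ring
  linarith

theorem sum_weight_le (h : RegPair g Γ p η s t X Y) :
    ∑ x ∈ X, ∑ y ∈ Y, (Γ x y + 2 * p) ≤ 4 * p * s * t := by
  have hp := h.p_pos; have hs := h.s_pos; have ht := h.t_pos
  have h2 : p ^ 3 ≤ p ^ 2 := pow_le_pow_of_le_one h.p_pos.le h.p_le (by norm_num)
  have h1 := h.jumbled.sum_le hp h.card_left h.card_right (h.Q_le.trans (by gcongr))
  calc _ = ∑ x ∈ X, ∑ y ∈ Y, Γ x y + X.card * (Y.card * (2 * p)) := by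
        simp only [Finset.sum_add_distrib, Finset.sum_const, nsmul_eq_mul]
    _ ≤ 2 * p * s * t + s * (t * (2 * p)) := by
        have := h.card_left; have := h.card_right; gcongr
    _ = _ := by ring

/-- In a regular pair the deviation has small codegrees on average. -/
theorem sum_abs_codegree_le {θ : ℝ} (hθ : 0 < θ) (h : RegPair g Γ p (θ ^ 2) s t X Y) :
    ∑ y ∈ Y, ∑ y' ∈ Y, |∑ x ∈ X, g x y * g x y'| ≤ 15 * θ * p ^ 2 * s * t ^ 2 := by
  have hp := h.p_pos; have hs := h.s_pos; have ht := h.t_pos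
  -- The signs of the codegrees remove the absolute values and make the sum a form that is linear in
  -- `g x y` and in the signed degree `F x y`.
  set σ : β → β → ℝ := fun y' y => SignType.sign (∑ x ∈ X, g x y' * g x y) with hσd
  have hσ : ∀ y y', |σ y y'| ≤ 1 := by
    intro y y'
    simp only [hσd]
    rcases lt_trichotomy (∑ x ∈ X, g x y * g x y') 0 with h' | h' | h'
    · simp [sign_neg h']
    · simp [h']
    · simp [sign_pos h']
  set F : α → β → ℝ := fun x y' => ∑ y ∈ Y, g x y * σ y' y with hF
  have eS : ∑ y ∈ Y, ∑ y' ∈ Y, |∑ x ∈ X, g x y * g x y'| =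
      ∑ x ∈ X, ∑ y ∈ Y, g x y * F x y := by
    rw [Finset.sum_comm (s := X)]
    refine Finset.sum_congr rfl fun y _ => ?_
    simp only [hF, Finset.mul_sum]
    rw [Finset.sum_comm]
    refine Finset.sum_congr rfl fun y' _ => ?_
    have : |∑ x ∈ X, g x y * g x y'| = σ y y' * ∑ x ∈ X, g x y * g x y' :=
      (sign_mul_self _).symm
    rw [this, Finset.mul_sum]
    exact Finset.sum_congr rfl fun x _ => by ring
  -- Cauchy–Schwarz uses the majorant `Γ + 2p` of `|g|` as weight, which keeps the density `p` in
  -- both factors. The weight is then split as `(Γ - p) + 3p`: jumbledness handles the first part,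
  -- the bound on signed degrees the second.
  have cs := sum_sum_sq_le X Y (r := fun x y => g x y * F x y) (f := fun x y => Γ x y + 2 * p)
    (g := fun x y => (Γ x y + 2 * p) * F x y ^ 2)
    (fun x y => by have := h.nonneg x y; positivity)
    (fun x y => by have := h.nonneg x y; positivity)
    (fun x y => by
      have h0 := h.nonneg x y
      have : g x y ^ 2 ≤ (Γ x y + 2 * p) ^ 2 := by
        rw [← sq_abs]; gcongr; exact h.abs_le x y
      calc (g x y * F x y) ^ 2 = g x y ^ 2 * F x y ^ 2 := by ring
        _ ≤ (Γ x y + 2 * p) ^ 2 * F x y ^ 2 := by gcongr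
        _ = _ := by ring)
  rw [← eS] at cs
  have hF2 := h.sum_sum_sq_signed_le hσ
  have hJ := h.jumbled.sum_mul_sq_le h.Q_nonneg Y h.abs_le_three hσ
  have hσ2 : ∑ z ∈ Y, (∑ y ∈ Y, |σ z y|) ^ 2 ≤ t ^ 3 := by
    calc _ ≤ ∑ z ∈ Y, t ^ 2 := by
          refine Finset.sum_le_sum fun z _ => ?_
          have : ∑ y ∈ Y, |σ z y| ≤ t := by
            refine (Finset.sum_le_sum fun y _ => hσ z y).trans ?_
            simpa using h.card_right
          have h0 : 0 ≤ ∑ y ∈ Y, |σ z y| := Finset.sum_nonneg fun y _ => abs_nonneg _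
          gcongr
      _ = Y.card * t ^ 2 := by rw [Finset.sum_const, nsmul_eq_mul]
      _ ≤ t * t ^ 2 := by have := h.card_right; gcongr
      _ = _ := by ring
  have hJ2 : ∑ x ∈ X, ∑ z ∈ Y, (Γ x z - p) * F x z ^ 2 ≤ 14 * θ ^ 2 * p ^ 3 * s * t ^ 3 := by
    refine (abs_le_of_sq_le_sq' (hJ.trans ?_) (by positivity)).2
    calc _ ≤ 9 * ((θ ^ 2) ^ 2 * p ^ 4 * s * t) * (20 * p ^ 2 * s * t ^ 2) * t ^ 3 := by
          have := h.sum_sq_sum_abs_le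
          gcongr
      _ = 180 * (θ ^ 4 * p ^ 6 * s ^ 2 * t ^ 6) := by ring
      _ ≤ 196 * (θ ^ 4 * p ^ 6 * s ^ 2 * t ^ 6) := by gcongr; norm_num
      _ = _ := by ring
  have e3 : ∑ x ∈ X, ∑ y ∈ Y, (Γ x y + 2 * p) * F x y ^ 2 =
      ∑ x ∈ X, ∑ z ∈ Y, (Γ x z - p) * F x z ^ 2 + 3 * p * ∑ x ∈ X, ∑ y ∈ Y, F x y ^ 2 := by
    simp only [Finset.mul_sum, ← Finset.sum_add_distrib]
    exact Finset.sum_congr rfl fun x _ => Finset.sum_congr rfl fun y _ => by ring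
  have h4 : ∑ x ∈ X, ∑ y ∈ Y, (Γ x y + 2 * p) * F x y ^ 2 ≤ 50 * θ ^ 2 * p ^ 3 * s * t ^ 3 := by
    rw [e3]
    have : 3 * p * ∑ x ∈ X, ∑ y ∈ Y, F x y ^ 2 ≤ 3 * p * (12 * θ ^ 2 * p ^ 2 * s * t ^ 3) := by
      gcongr
    linarith
  refine (abs_le_of_sq_le_sq' (cs.trans ?_) (by positivity)).2
  calc _ ≤ (4 * p * s * t) * (50 * θ ^ 2 * p ^ 3 * s * t ^ 3) := by
        have := h.sum_weight_le
        gcongr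
        exact Finset.sum_nonneg fun x _ => Finset.sum_nonneg fun y _ => by
          have := h.nonneg x y; positivity
    _ = 200 * (θ ^ 2 * p ^ 4 * s ^ 2 * t ^ 4) := by ring
    _ ≤ 225 * (θ ^ 2 * p ^ 4 * s ^ 2 * t ^ 4) := by gcongr; norm_num
    _ = _ := by ring

end RegPair

end Triangles

/-! ### One-sided and two-sided inheritance of regularity, in counting form. -/

section Inheritance

variable {α β δ : Type*}

/-- A kernel with values in `[0, 1]` that is jumbled on `Z × Y`; `r`, `t` are the scales. -/
structure KernelPair (Λ : δ → β → ℝ) (p Q r t : ℝ) (Z : Finset δ) (Y : Finset β) : Prop where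
  s_pos : 0 < r
  Q_nonneg : 0 ≤ Q
  nonneg : ∀ z y, 0 ≤ Λ z y
  le_one : ∀ z y, Λ z y ≤ 1
  card_left : (Z.card : ℝ) ≤ r
  card_right : (Y.card : ℝ) ≤ t
  jumbled : Jumbled (fun z y => Λ z y - p) Q Z Y

theorem KernelPair.mono_right {Λ : δ → β → ℝ} {p Q r t : ℝ} {Z : Finset δ} {Y Y' : Finset β}
    (k : KernelPair Λ p Q r t Z Y) (hY : Y' ⊆ Y) : KernelPair Λ p Q r t Z Y' :=
  { k with
    card_right := le_trans (by exact_mod_cast Finset.card_le_card hY) k.card_right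
    jumbled := k.jumbled.mono le_rfl subset_rfl hY }

/-- This is the degree tail weighted by the neighbourhood of `y`, whose total weight is at most
`2ps`; the threshold becomes `2p · 2ps`. -/
theorem Jumbled.sum_codegree_tail_le {Γ : α → β → ℝ} {p Q s : ℝ} {X : Finset α} {Y : Finset β}
    (hJ : Jumbled (fun x y => Γ x y - p) Q X Y) (hp : 0 < p) (hQ : 0 ≤ Q)
    (h0 : ∀ x y, 0 ≤ Γ x y) (h1 : ∀ x y, Γ x y ≤ 1) {y : β}
    (ht : ∑ x ∈ X, Γ x y ≤ 2 * p * s) :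
    ∑ y' ∈ Y, (if 4 * p ^ 2 * s < ∑ x ∈ X, Γ x y * Γ x y' then ∑ x ∈ X, Γ x y * Γ x y' else 0)
      ≤ 2 * Q / p := by
  have := hJ.swap.sum_tail_le hp hQ (h := fun x => Γ x y) (fun x => h0 x y) (fun x => h1 x y) ht
  rw [Finset.sum_filter] at this
  refine le_trans (le_of_eq ?_) this
  refine Finset.sum_congr rfl fun y' _ => ?_
  have e1 : ∑ x ∈ X, Γ x y' * Γ x y = ∑ x ∈ X, Γ x y * Γ x y' :=
    Finset.sum_congr rfl fun x _ => mul_comm _ _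
  have e2 : 2 * p * (2 * p * s) = 4 * p ^ 2 * s := by ring
  simp only [e1, e2]

namespace RegPair

variable {g Γ : α → β → ℝ} {Λ : δ → β → ℝ} {p θ s t r : ℝ} {X : Finset α} {Y : Finset β}
  {Z : Finset δ}

theorem abs_codegree_le {η : ℝ} (h : RegPair g Γ p η s t X Y) {y y' : β}
    (hy : ∑ x ∈ X, Γ x y ≤ 2 * p * s) (hy' : ∑ x ∈ X, Γ x y' ≤ 2 * p * s) :
    |∑ x ∈ X, g x y * g x y'| ≤ ∑ x ∈ X, Γ x y * Γ x y' + 12 * p ^ 2 * s := by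
  have hp := h.p_pos
  calc _ ≤ ∑ x ∈ X, |g x y * g x y'| := Finset.abs_sum_le_sum_abs _ _
    _ ≤ ∑ x ∈ X, (Γ x y + 2 * p) * (Γ x y' + 2 * p) := by
        refine Finset.sum_le_sum fun x _ => ?_
        rw [abs_mul]
        have := h.nonneg x y
        exact mul_le_mul (h.abs_le _ _) (h.abs_le _ _) (abs_nonneg _) (by positivity)
    _ = ∑ x ∈ X, (Γ x y * Γ x y' + 2 * p * Γ x y + 2 * p * Γ x y' + 4 * p ^ 2) :=
        Finset.sum_congr rfl fun x _ => by ring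
    _ = ∑ x ∈ X, Γ x y * Γ x y' + 2 * p * ∑ x ∈ X, Γ x y + 2 * p * ∑ x ∈ X, Γ x y' +
          X.card * (4 * p ^ 2) := by
        simp only [Finset.sum_add_distrib, Finset.mul_sum, Finset.sum_const, nsmul_eq_mul]
    _ ≤ ∑ x ∈ X, Γ x y * Γ x y' + 2 * p * (2 * p * s) + 2 * p * (2 * p * s) +
          s * (4 * p ^ 2) := by
        have := h.card_left
        gcongr
    _ = _ := by ring

/-- Opening the square turns the sum into one over pairs `y`, `y'` of the codegree of `g` times that
of `b`. The latter is typically at most `4p²r`, where the average smallness of the codegrees of `g`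
applies; the exceptional pairs are covered by codegree tails. -/
theorem sum_sq_sum_mul_le (hθ : 0 < θ) (h : RegPair g Γ p (θ ^ 2) s t X Y)
    (k : KernelPair Λ p ((θ ^ 2) ^ 2 * p ^ 3 * r * t) r t Z Y)
    (typX : ∀ y ∈ Y, ∑ x ∈ X, Γ x y ≤ 2 * p * s) (typZ : ∀ y ∈ Y, ∑ z ∈ Z, Λ z y ≤ 2 * p * r)
    {b : δ → β → ℝ} (hb : ∀ z y, |b z y| ≤ Λ z y) :
    ∑ x ∈ X, ∑ z ∈ Z, (∑ y ∈ Y, g x y * b z y) ^ 2 ≤ 108 * θ * p ^ 4 * s * t ^ 2 * r := by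
  have hp := h.p_pos; have hs := h.s_pos; have ht := h.t_pos; have hr := k.s_pos
  have e0 : ∑ x ∈ X, ∑ z ∈ Z, (∑ y ∈ Y, g x y * b z y) ^ 2 =
      ∑ y ∈ Y, ∑ y' ∈ Y, (∑ x ∈ X, g x y * g x y') * ∑ z ∈ Z, b z y * b z y' := by
    have := sum_sum_mul_sq_sum X Z Y (fun _ _ => 1) g b
    simp only [one_mul] at this
    rw [this]
    refine Finset.sum_congr rfl fun y _ => Finset.sum_congr rfl fun y' _ => ?_
    rw [Finset.sum_mul_sum]
  set cΓ : β → β → ℝ := fun y y' => ∑ x ∈ X, Γ x y * Γ x y' with hcΓ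
  set cΛ : β → β → ℝ := fun y y' => ∑ z ∈ Z, Λ z y * Λ z y' with hcΛ
  have cΓ0 : ∀ y y', 0 ≤ cΓ y y' := fun y y' =>
    Finset.sum_nonneg fun x _ => mul_nonneg (h.nonneg _ _) (h.nonneg _ _)
  have cΛ0 : ∀ y y', 0 ≤ cΛ y y' := fun y y' =>
    Finset.sum_nonneg fun x _ => mul_nonneg (k.nonneg _ _) (k.nonneg _ _)
  have hcb : ∀ y y', |∑ z ∈ Z, b z y * b z y'| ≤ cΛ y y' := by
    intro y y'
    refine (Finset.abs_sum_le_sum_abs _ _).trans (Finset.sum_le_sum fun z _ => ?_)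
    rw [abs_mul]
    exact mul_le_mul (hb _ _) (hb _ _) (abs_nonneg _) (k.nonneg _ _)
  have hcΛle : ∀ y ∈ Y, ∀ y', cΛ y y' ≤ 2 * p * r := by
    intro y hy y'
    refine le_trans (Finset.sum_le_sum fun z _ => ?_) (typZ y hy)
    exact mul_le_of_le_one_right (k.nonneg _ _) (k.le_one _ _)
  -- The three terms cover: a typical codegree in `Λ`; a large one in `Λ` but a typical one in `Γ`,
  -- where the codegree of `g` is at most `(4 + 12)p²s`; and both large, where it is at most `4 cΓ`
  -- and `cΛ ≤ 2pr`.
  have point : ∀ y ∈ Y, ∀ y' ∈ Y,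
      (∑ x ∈ X, g x y * g x y') * ∑ z ∈ Z, b z y * b z y' ≤
        4 * p ^ 2 * r * |∑ x ∈ X, g x y * g x y'| +
        16 * p ^ 2 * s * (if 4 * p ^ 2 * r < cΛ y y' then cΛ y y' else 0) +
        8 * p * r * (if 4 * p ^ 2 * s < cΓ y y' then cΓ y y' else 0) := by
    intro y hy y' hy'
    have hcg := h.abs_codegree_le (typX y hy) (typX y' hy')
    have i1 : 0 ≤ (if 4 * p ^ 2 * r < cΛ y y' then cΛ y y' else 0) := by
      split_ifs; exacts [cΛ0 _ _, le_rfl]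
    have i2 : 0 ≤ (if 4 * p ^ 2 * s < cΓ y y' then cΓ y y' else 0) := by
      split_ifs; exacts [cΓ0 _ _, le_rfl]
    have hmul : (∑ x ∈ X, g x y * g x y') * ∑ z ∈ Z, b z y * b z y' ≤
        |∑ x ∈ X, g x y * g x y'| * cΛ y y' := by
      refine (le_abs_self _).trans ?_
      rw [abs_mul]
      exact mul_le_mul_of_nonneg_left (hcb _ _) (abs_nonneg _)
    by_cases c1 : 4 * p ^ 2 * r < cΛ y y'
    · by_cases c2 : 4 * p ^ 2 * s < cΓ y y'
      · have : |∑ x ∈ X, g x y * g x y'| * cΛ y y' ≤ (4 * cΓ y y') * (2 * p * r) := by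
          have := cΛ0 y y'
          have := hcΛle y hy y'
          have := cΓ0 y y'
          gcongr
          simp only [hcΓ] at c2 ⊢
          linarith
        have h3 : 0 ≤ 4 * p ^ 2 * r * |∑ x ∈ X, g x y * g x y'| := by positivity
        have h4 := mul_nonneg (show 0 ≤ 16 * p ^ 2 * s by positivity) i1
        rw [if_pos c2]
        linarith
      · have : |∑ x ∈ X, g x y * g x y'| * cΛ y y' ≤ (16 * p ^ 2 * s) * cΛ y y' := by
          have := cΛ0 y y'
          gcongr
          simp only [hcΓ] at c2
          linarith
        have h3 : 0 ≤ 4 * p ^ 2 * r * |∑ x ∈ X, g x y * g x y'| := by positivity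
        have h4 := mul_nonneg (show 0 ≤ 8 * p * r by positivity) i2
        rw [if_pos c1]
        linarith
    · have : |∑ x ∈ X, g x y * g x y'| * cΛ y y' ≤
          |∑ x ∈ X, g x y * g x y'| * (4 * p ^ 2 * r) := by
        gcongr; linarith
      have h3 := mul_nonneg (show 0 ≤ 16 * p ^ 2 * s by positivity) i1
      have h4 := mul_nonneg (show 0 ≤ 8 * p * r by positivity) i2
      linarith
  have s1 : ∑ y ∈ Y, ∑ y' ∈ Y, (if 4 * p ^ 2 * r < cΛ y y' then cΛ y y' else 0) ≤
      t * (2 * (θ ^ 2) ^ 2 * p ^ 2 * r * t) := by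
    calc _ ≤ ∑ y ∈ Y, 2 * (θ ^ 2) ^ 2 * p ^ 2 * r * t := by
          refine Finset.sum_le_sum fun y hy => ?_
          refine (k.jumbled.sum_codegree_tail_le hp k.Q_nonneg k.nonneg k.le_one
            (typZ y hy)).trans (le_of_eq ?_)
          field_simp
      _ = Y.card * (2 * (θ ^ 2) ^ 2 * p ^ 2 * r * t) := by rw [Finset.sum_const, nsmul_eq_mul]
      _ ≤ _ := by have := h.card_right; gcongr
  have s2 : ∑ y ∈ Y, ∑ y' ∈ Y, (if 4 * p ^ 2 * s < cΓ y y' then cΓ y y' else 0) ≤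
      t * (2 * (θ ^ 2) ^ 2 * p ^ 3 * s * t) := by
    calc _ ≤ ∑ y ∈ Y, 2 * (θ ^ 2) ^ 2 * p ^ 3 * s * t := by
          refine Finset.sum_le_sum fun y hy => ?_
          refine (h.jumbled.sum_codegree_tail_le hp h.Q_nonneg h.nonneg h.le_one
            (typX y hy)).trans (le_of_eq ?_)
          field_simp
      _ = Y.card * (2 * (θ ^ 2) ^ 2 * p ^ 3 * s * t) := by rw [Finset.sum_const, nsmul_eq_mul]
      _ ≤ _ := by have := h.card_right; gcongr
  have hθ1 : θ ≤ 1 := by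
    have := h.eta_le
    exact (sq_le_one_iff₀ hθ.le).mp this
  have hθ4 : (θ ^ 2) ^ 2 ≤ θ := by
    rw [← pow_mul]; exact pow_le_of_le_one hθ.le hθ1 (by norm_num)
  rw [e0]
  calc _ ≤ ∑ y ∈ Y, ∑ y' ∈ Y, (4 * p ^ 2 * r * |∑ x ∈ X, g x y * g x y'| +
        16 * p ^ 2 * s * (if 4 * p ^ 2 * r < cΛ y y' then cΛ y y' else 0) +
        8 * p * r * (if 4 * p ^ 2 * s < cΓ y y' then cΓ y y' else 0)) :=
        Finset.sum_le_sum fun y hy => Finset.sum_le_sum fun y' hy' => point y hy y' hy'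
    _ = 4 * p ^ 2 * r * ∑ y ∈ Y, ∑ y' ∈ Y, |∑ x ∈ X, g x y * g x y'| +
        16 * p ^ 2 * s * ∑ y ∈ Y, ∑ y' ∈ Y, (if 4 * p ^ 2 * r < cΛ y y' then cΛ y y' else 0) +
        8 * p * r * ∑ y ∈ Y, ∑ y' ∈ Y, (if 4 * p ^ 2 * s < cΓ y y' then cΓ y y' else 0) := by
        simp only [Finset.sum_add_distrib, Finset.mul_sum]
    _ ≤ 4 * p ^ 2 * r * (15 * θ * p ^ 2 * s * t ^ 2) +
        16 * p ^ 2 * s * (t * (2 * (θ ^ 2) ^ 2 * p ^ 2 * r * t)) +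
        8 * p * r * (t * (2 * (θ ^ 2) ^ 2 * p ^ 3 * s * t)) := by
        have := h.sum_abs_codegree_le hθ
        gcongr
    _ ≤ 4 * p ^ 2 * r * (15 * θ * p ^ 2 * s * t ^ 2) +
        16 * p ^ 2 * s * (t * (2 * θ * p ^ 2 * r * t)) +
        8 * p * r * (t * (2 * θ * p ^ 3 * s * t)) := by gcongr
    _ = _ := by ring

/-- The vertices of `Y` whose degrees into `X` or `Z` are atypically large contribute little. -/
theorem sum_atypical_le (hθ : 0 < θ) (h : RegPair g Γ p (θ ^ 2) s t X Y)
    (k : KernelPair Λ p ((θ ^ 2) ^ 2 * p ^ 3 * r * t) r t Z Y) :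
    ∑ y ∈ Y with ¬ (∑ x ∈ X, Γ x y ≤ 2 * p * s ∧ ∑ z ∈ Z, Λ z y ≤ 2 * p * r),
      (∑ x ∈ X, |g x y|) * ∑ z ∈ Z, Λ z y ≤ 12 * θ * p ^ 3 * s * t * r := by
  have hp := h.p_pos; have hs := h.s_pos; have ht := h.t_pos; have hr := k.s_pos
  have hθ1 : θ ≤ 1 := by
    have := h.eta_le
    exact (sq_le_one_iff₀ hθ.le).mp this
  have hθ4 : (θ ^ 2) ^ 2 ≤ θ := by
    rw [← pow_mul]; exact pow_le_of_le_one hθ.le hθ1 (by norm_num)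
  have t1 := h.jumbled.swap.sum_tail_le hp h.Q_nonneg (h := fun _ => 1) (t := s) (by simp)
    (by simp) (by simpa using h.card_left)
  have t2 := k.jumbled.swap.sum_tail_le hp k.Q_nonneg (h := fun _ => 1) (t := r) (by simp)
    (by simp) (by simpa using k.card_left)
  simp only [mul_one] at t1 t2
  rw [Finset.sum_filter] at t1 t2 ⊢
  have hgΓ : ∀ y, ∑ x ∈ X, |g x y| ≤ ∑ x ∈ X, Γ x y + 2 * p * s := by
    intro y
    calc ∑ x ∈ X, |g x y| ≤ ∑ x ∈ X, (Γ x y + 2 * p) := Finset.sum_le_sum fun x _ => h.abs_le x y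
      _ = ∑ x ∈ X, Γ x y + X.card * (2 * p) := by
        rw [Finset.sum_add_distrib, Finset.sum_const, nsmul_eq_mul]
      _ ≤ ∑ x ∈ X, Γ x y + s * (2 * p) := by
        have := h.card_left; gcongr
      _ = _ := by ring
  have dΓ0 : ∀ y, 0 ≤ ∑ x ∈ X, Γ x y := fun y => Finset.sum_nonneg fun x _ => h.nonneg x y
  have dΛ0 : ∀ y, 0 ≤ ∑ z ∈ Z, Λ z y := fun y => Finset.sum_nonneg fun x _ => k.nonneg x y
  have dΛr : ∀ y, ∑ z ∈ Z, Λ z y ≤ r := fun y => by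
    refine le_trans (Finset.sum_le_sum fun z _ => k.le_one z y) ?_
    simpa using k.card_left
  -- If the degree in `Γ` is large it dominates `2ps`, and the trivial bound `r` is used for `Λ`;
  -- otherwise the degree into `X` contributes at most `4ps` and the tail of `Λ` is used.
  have point : ∀ y ∈ Y, (if ¬ (∑ x ∈ X, Γ x y ≤ 2 * p * s ∧ ∑ z ∈ Z, Λ z y ≤ 2 * p * r) then
      (∑ x ∈ X, |g x y|) * ∑ z ∈ Z, Λ z y else 0) ≤
      2 * r * (if 2 * p * s < ∑ x ∈ X, Γ x y then ∑ x ∈ X, Γ x y else 0) +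
      4 * p * s * (if 2 * p * r < ∑ z ∈ Z, Λ z y then ∑ z ∈ Z, Λ z y else 0) := by
    intro y _
    have i1 : 0 ≤ 2 * r * (if 2 * p * s < ∑ x ∈ X, Γ x y then ∑ x ∈ X, Γ x y else 0) := by
      split_ifs
      · have := dΓ0 y; positivity
      · simp
    have i2 : 0 ≤ 4 * p * s * (if 2 * p * r < ∑ z ∈ Z, Λ z y then ∑ z ∈ Z, Λ z y else 0) := by
      split_ifs
      · have := dΛ0 y; positivity
      · simp
    have hm : (∑ x ∈ X, |g x y|) * ∑ z ∈ Z, Λ z y ≤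
        (∑ x ∈ X, Γ x y + 2 * p * s) * ∑ z ∈ Z, Λ z y :=
      mul_le_mul_of_nonneg_right (hgΓ y) (dΛ0 y)
    by_cases c1 : 2 * p * s < ∑ x ∈ X, Γ x y
    · have : (∑ x ∈ X, Γ x y + 2 * p * s) * ∑ z ∈ Z, Λ z y ≤ (2 * ∑ x ∈ X, Γ x y) * r := by
        have := dΛ0 y; have := dΓ0 y; have := dΛr y
        gcongr; linarith
      rw [if_pos c1] at i1 ⊢
      split_ifs at i2 ⊢ <;> linarith
    · by_cases c2 : 2 * p * r < ∑ z ∈ Z, Λ z y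
      · have : (∑ x ∈ X, Γ x y + 2 * p * s) * ∑ z ∈ Z, Λ z y ≤ (4 * p * s) * ∑ z ∈ Z, Λ z y := by
          have := dΛ0 y
          gcongr; linarith
        rw [if_neg c1, if_pos c2, if_pos (by simp only [not_and_or, not_le]; right; exact c2)]
        linarith
      · rw [if_neg (by simp only [not_not]; exact ⟨not_lt.mp c1, not_lt.mp c2⟩)]
        linarith
  refine (Finset.sum_le_sum point).trans ?_
  rw [Finset.sum_add_distrib, ← Finset.mul_sum, ← Finset.mul_sum]
  calc _ ≤ 2 * r * (2 * ((θ ^ 2) ^ 2 * p ^ 4 * s * t) / p) +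
        4 * p * s * (2 * ((θ ^ 2) ^ 2 * p ^ 3 * r * t) / p) := by gcongr
    _ = 12 * (θ ^ 2) ^ 2 * p ^ 3 * s * t * r := by field_simp; ring
    _ ≤ _ := by gcongr

/-- Cancellation in `g` is kept only over the `y` with `P y`; the rest is estimated by absolute
values. -/
theorem abs_sum_le_typical_add {a : δ → α → ℝ} {b : δ → β → ℝ} (P : β → Prop)
    (ha : ∀ z x, |a z x| ≤ 1) (hb : ∀ z y, |b z y| ≤ Λ z y) :
    |∑ z ∈ Z, ∑ x ∈ X, ∑ y ∈ Y, g x y * a z x * b z y| ≤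
      |∑ x ∈ X, ∑ z ∈ Z, a z x * ∑ y ∈ Y with P y, g x y * b z y| +
      ∑ y ∈ Y with ¬ P y, (∑ x ∈ X, |g x y|) * ∑ z ∈ Z, Λ z y := by
  have e : ∑ z ∈ Z, ∑ x ∈ X, ∑ y ∈ Y, g x y * a z x * b z y =
      ∑ x ∈ X, ∑ z ∈ Z, a z x * ∑ y ∈ Y with P y, g x y * b z y +
      ∑ y ∈ Y with ¬ P y, ∑ x ∈ X, ∑ z ∈ Z, g x y * a z x * b z y := by
    have : ∑ y ∈ Y with ¬ P y, ∑ x ∈ X, ∑ z ∈ Z, g x y * a z x * b z y =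
        ∑ x ∈ X, ∑ z ∈ Z, ∑ y ∈ Y with ¬ P y, g x y * a z x * b z y := by
      rw [Finset.sum_comm]
      exact Finset.sum_congr rfl fun x _ => Finset.sum_comm
    rw [this, Finset.sum_comm]
    simp only [← Finset.sum_add_distrib]
    refine Finset.sum_congr rfl fun x _ => Finset.sum_congr rfl fun z _ => ?_
    rw [← Finset.sum_filter_add_sum_filter_not Y P, Finset.mul_sum]
    congr 1
    exact Finset.sum_congr rfl fun y _ => by ring
  rw [e]
  refine (abs_add_le _ _).trans (add_le_add le_rfl ?_)
  refine (Finset.abs_sum_le_sum_abs _ _).trans (Finset.sum_le_sum fun y _ => ?_)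
  rw [Finset.sum_mul_sum]
  refine (Finset.abs_sum_le_sum_abs _ _).trans (Finset.sum_le_sum fun x _ => ?_)
  refine (Finset.abs_sum_le_sum_abs _ _).trans (Finset.sum_le_sum fun z _ => ?_)
  rw [abs_mul, abs_mul]
  have := mul_le_of_le_one_right (abs_nonneg (g x y)) (ha z x)
  exact mul_le_mul this (hb z y) (abs_nonneg _) (abs_nonneg _)

/-- Counting form of one-sided regularity inheritance. -/
theorem abs_sum_one_sided_le (hθ : 0 < θ) (h : RegPair g Γ p (θ ^ 2) s t X Y)
    (k : KernelPair Λ p ((θ ^ 2) ^ 2 * p ^ 3 * r * t) r t Z Y)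
    {a : δ → α → ℝ} {b : δ → β → ℝ} (ha : ∀ z x, |a z x| ≤ 1) (hb : ∀ z y, |b z y| ≤ Λ z y) :
    |∑ z ∈ Z, ∑ x ∈ X, ∑ y ∈ Y, g x y * a z x * b z y| ≤
      (11 * √θ + 12 * θ) * p ^ 2 * s * t * r := by
  have hp := h.p_pos; have hs := h.s_pos; have ht := h.t_pos; have hr := k.s_pos
  obtain ⟨P, hP⟩ : ∃ P : β → Prop, ∀ y, P y ↔
      ∑ x ∈ X, Γ x y ≤ 2 * p * s ∧ ∑ z ∈ Z, Λ z y ≤ 2 * p * r := ⟨_, fun _ => Iff.rfl⟩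
  refine (abs_sum_le_typical_add P ha hb).trans ?_
  have h1 : ∑ y ∈ Y with ¬ P y, (∑ x ∈ X, |g x y|) * ∑ z ∈ Z, Λ z y ≤ 12 * θ * p ^ 3 * s * t * r := by
    convert h.sum_atypical_le hθ k using 3
    exact not_congr (hP _)
  have hsub : (Y.filter P) ⊆ Y := Finset.filter_subset _ _
  have h2 := (h.mono_right hsub).sum_sq_sum_mul_le hθ (k.mono_right hsub)
    (fun y hy => ((hP y).mp (Finset.mem_filter.mp hy).2).1)
    (fun y hy => ((hP y).mp (Finset.mem_filter.mp hy).2).2) hb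
  -- Only `|a| ≤ 1` is available, so Cauchy–Schwarz is taken with constant weight.
  have cs := sum_sum_sq_le X Z (r := fun x z => a z x * ∑ y ∈ Y with P y, g x y * b z y)
    (f := fun _ _ => 1) (g := fun x z => (∑ y ∈ Y with P y, g x y * b z y) ^ 2) (by simp)
    (fun x z => by positivity) (fun x z => by
      rw [mul_pow, one_mul]
      refine mul_le_of_le_one_left (by positivity) ?_
      rw [← sq_abs]; exact pow_le_one₀ (abs_nonneg _) (ha z x))
  simp only [Finset.sum_const, nsmul_eq_mul, mul_one] at cs
  have h3 : |∑ x ∈ X, ∑ z ∈ Z, a z x * ∑ y ∈ Y with P y, g x y * b z y| ≤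
      11 * √θ * p ^ 2 * s * t * r := by
    refine abs_le_of_sq_le_sq (cs.trans ?_) (by positivity)
    calc _ ≤ (s * r) * (108 * θ * p ^ 4 * s * t ^ 2 * r) := by
          have := h.card_left; have := k.card_left
          gcongr
      _ = 108 * (θ * p ^ 4 * s ^ 2 * t ^ 2 * r ^ 2) := by ring
      _ ≤ 121 * (θ * p ^ 4 * s ^ 2 * t ^ 2 * r ^ 2) := by gcongr; norm_num
      _ = 121 * ((√θ) ^ 2 * p ^ 4 * s ^ 2 * t ^ 2 * r ^ 2) := by rw [Real.sq_sqrt hθ.le]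
      _ = _ := by ring
  have h4 : 12 * θ * p ^ 3 * s * t * r ≤ 12 * θ * p ^ 2 * s * t * r := by
    have : p ^ 3 ≤ p ^ 2 := pow_le_pow_of_le_one hp.le h.p_le (by norm_num)
    gcongr
  have h5 := add_le_add h3 (h1.trans h4)
  have e5 : 11 * √θ * p ^ 2 * s * t * r + 12 * θ * p ^ 2 * s * t * r =
      (11 * √θ + 12 * θ) * p ^ 2 * s * t * r := by ring
  rw [e5] at h5
  exact h5

/-- Counting form of two-sided regularity inheritance. -/
theorem abs_sum_two_sided_le (hθ : 0 < θ) (h : RegPair g Γ p (θ ^ 2) s t X Y)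
    (k : KernelPair Λ p ((θ ^ 2) ^ 2 * p ^ 3 * r * t) r t Z Y) {Ξ : δ → α → ℝ}
    (l : KernelPair Ξ p ((θ ^ 2) ^ 2 * p ^ 6 * r * s) r s Z X)
    {a : δ → α → ℝ} {b : δ → β → ℝ} (ha : ∀ z x, |a z x| ≤ Ξ z x)
    (hb : ∀ z y, |b z y| ≤ Λ z y) :
    |∑ z ∈ Z, ∑ x ∈ X, ∑ y ∈ Y, g x y * a z x * b z y| ≤
      (17 * √θ + 12 * θ) * p ^ 3 * s * t * r := by
  have hp := h.p_pos; have hs := h.s_pos; have ht := h.t_pos; have hr := k.s_pos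
  have hθ1 : θ ≤ 1 := by
    have := h.eta_le
    exact (sq_le_one_iff₀ hθ.le).mp this
  have hθ2 : θ ^ 2 ≤ θ := pow_le_of_le_one hθ.le hθ1 (by norm_num)
  have hθ4 : (θ ^ 2) ^ 2 ≤ 1 := pow_le_one₀ (by positivity) h.eta_le
  obtain ⟨P, hP⟩ : ∃ P : β → Prop, ∀ y, P y ↔
      ∑ x ∈ X, Γ x y ≤ 2 * p * s ∧ ∑ z ∈ Z, Λ z y ≤ 2 * p * r := ⟨_, fun _ => Iff.rfl⟩
  refine (abs_sum_le_typical_add P (fun z x => (ha z x).trans (l.le_one z x)) hb).trans ?_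
  have h1 : ∑ y ∈ Y with ¬ P y, (∑ x ∈ X, |g x y|) * ∑ z ∈ Z, Λ z y ≤ 12 * θ * p ^ 3 * s * t * r := by
    convert h.sum_atypical_le hθ k using 3
    exact not_congr (hP _)
  have hsub : (Y.filter P) ⊆ Y := Finset.filter_subset _ _
  have h' := h.mono_right hsub
  have k' := k.mono_right hsub
  set F : α → δ → ℝ := fun x z => ∑ y ∈ Y with P y, g x y * b z y with hF
  have h2 : ∑ x ∈ X, ∑ z ∈ Z, F x z ^ 2 ≤ _ := h'.sum_sq_sum_mul_le hθ k'
    (fun y hy => ((hP y).mp (Finset.mem_filter.mp hy).2).1)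
    (fun y hy => ((hP y).mp (Finset.mem_filter.mp hy).2).2) hb
  -- The weight is now the kernel `Ξ` that dominates `a`; this gains the third factor `p`.
  -- Jumbledness then replaces `Ξ` by `p` in the second factor, which is where the exponent 6 is
  -- needed.
  have cs := sum_sum_sq_le X Z (r := fun x z => a z x * F x z)
    (f := fun x z => Ξ z x) (g := fun x z => Ξ z x * F x z ^ 2) (fun x z => l.nonneg z x)
    (fun x z => by have := l.nonneg z x; positivity) (fun x z => by
      have : a z x ^ 2 ≤ Ξ z x ^ 2 := by
        rw [← sq_abs]; gcongr; exact ha z x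
      calc (a z x * F x z) ^ 2 = a z x ^ 2 * F x z ^ 2 := by ring
        _ ≤ Ξ z x ^ 2 * F x z ^ 2 := by gcongr
        _ = _ := by ring)
  have hΞ : ∑ x ∈ X, ∑ z ∈ Z, Ξ z x ≤ 2 * p * s * r := by
    refine l.jumbled.swap.sum_le hp h.card_left l.card_left ?_
    have : p ^ 6 ≤ p ^ 2 := pow_le_pow_of_le_one hp.le h.p_le (by norm_num)
    calc (θ ^ 2) ^ 2 * p ^ 6 * r * s ≤ 1 * p ^ 2 * r * s := by gcongr
      _ = _ := by ring
  have hb2 : ∑ z ∈ Z, (∑ y ∈ Y with P y, |b z y|) ^ 2 ≤ 6 * p ^ 2 * r * t ^ 2 := by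
    refine le_trans (Finset.sum_le_sum fun z _ => ?_)
      (k'.jumbled.sum_sq_le hp k'.Q_nonneg k.nonneg k.le_one k'.card_left k'.card_right ?_)
    · exact pow_le_pow_left₀ (Finset.sum_nonneg fun y _ => abs_nonneg _)
        (Finset.sum_le_sum fun y _ => hb z y) 2
    · calc (θ ^ 2) ^ 2 * p ^ 3 * r * t ≤ 1 * p ^ 3 * r * t := by gcongr
        _ = _ := by ring
  have hJ := l.jumbled.swap.sum_mul_sq_le l.Q_nonneg (Y.filter P) h.abs_le_three
    (fun z y => (hb z y).trans (k.le_one z y))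
  have hJ2 : ∑ x ∈ X, ∑ z ∈ Z, (Ξ z x - p) * F x z ^ 2 ≤ 33 * θ * p ^ 5 * s * t ^ 2 * r := by
    refine (abs_le_of_sq_le_sq' (hJ.trans ?_) (by positivity)).2
    calc _ ≤ 9 * ((θ ^ 2) ^ 2 * p ^ 6 * r * s) * (20 * p ^ 2 * s * t ^ 2) *
          (6 * p ^ 2 * r * t ^ 2) := by
          have := h'.sum_sq_sum_abs_le
          have := l.Q_nonneg
          gcongr
      _ = 1080 * ((θ ^ 2) ^ 2 * p ^ 10 * s ^ 2 * t ^ 4 * r ^ 2) := by ring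
      _ ≤ 1089 * (θ ^ 2 * p ^ 10 * s ^ 2 * t ^ 4 * r ^ 2) := by gcongr; norm_num
      _ = _ := by ring
  have e3 : ∑ x ∈ X, ∑ z ∈ Z, Ξ z x * F x z ^ 2 =
      ∑ x ∈ X, ∑ z ∈ Z, (Ξ z x - p) * F x z ^ 2 + p * ∑ x ∈ X, ∑ z ∈ Z, F x z ^ 2 := by
    simp only [Finset.mul_sum, ← Finset.sum_add_distrib]
    exact Finset.sum_congr rfl fun x _ => Finset.sum_congr rfl fun y _ => by ring
  have h4 : ∑ x ∈ X, ∑ z ∈ Z, Ξ z x * F x z ^ 2 ≤ 141 * θ * p ^ 5 * s * t ^ 2 * r := by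
    rw [e3]
    have : p * ∑ x ∈ X, ∑ z ∈ Z, F x z ^ 2 ≤ p * (108 * θ * p ^ 4 * s * t ^ 2 * r) := by
      gcongr
    linarith
  have h3 : |∑ x ∈ X, ∑ z ∈ Z, a z x * F x z| ≤ 17 * √θ * p ^ 3 * s * t * r := by
    refine abs_le_of_sq_le_sq (cs.trans ?_) (by positivity)
    calc _ ≤ (2 * p * s * r) * (141 * θ * p ^ 5 * s * t ^ 2 * r) := by
          gcongr
          exact Finset.sum_nonneg fun x _ => Finset.sum_nonneg fun z _ => by
            have := l.nonneg z x; positivity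
      _ = 282 * (θ * p ^ 6 * s ^ 2 * t ^ 2 * r ^ 2) := by ring
      _ ≤ 289 * (θ * p ^ 6 * s ^ 2 * t ^ 2 * r ^ 2) := by gcongr; norm_num
      _ = 289 * ((√θ) ^ 2 * p ^ 6 * s ^ 2 * t ^ 2 * r ^ 2) := by rw [Real.sq_sqrt hθ.le]
      _ = _ := by ring
  have h5 := add_le_add h3 h1
  have e5 : 17 * √θ * p ^ 3 * s * t * r + 12 * θ * p ^ 3 * s * t * r =
      (17 * √θ + 12 * θ) * p ^ 3 * s * t * r := by ring
  rw [e5] at h5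
  exact h5

end RegPair

/-- If the trilinear form given by `g` and any functions dominated by the indicators of the sets
`X' z`, `Y' z` is small, then `g` has small cut norm on most of the pairs `(X' z, Y' z)`. -/
theorem card_not_cutBdd_le {g : α → β → ℝ} {X : Finset α} {Y : Finset β} {Z : Finset δ}
    (X' : δ → Finset α) (Y' : δ → Finset β) (hX : ∀ z, X' z ⊆ X) (hY : ∀ z, Y' z ⊆ Y) {M e : ℝ}
    (hM : ∀ (a : δ → α → ℝ) (b : δ → β → ℝ), (∀ z x, |a z x| ≤ if x ∈ X' z then 1 else 0) →
      (∀ z y, |b z y| ≤ if y ∈ Y' z then 1 else 0) →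
      |∑ z ∈ Z, ∑ x ∈ X, ∑ y ∈ Y, g x y * a z x * b z y| ≤ M) :
    ((Z.filter fun z => ¬ CutBdd g e (X' z) (Y' z)).card : ℝ) * e ≤ M := by
  -- Each bad `z` receives witnesses with the sign chosen so that its form is positive, each good
  -- `z` the zero function. The forms of the bad `z` then add up without cancellation.
  have hex : ∀ z, ∃ (a : α → ℝ) (b : β → ℝ), (∀ x, |a x| ≤ 1) ∧ (∀ y, |b y| ≤ 1) ∧
      (¬ CutBdd g e (X' z) (Y' z) → e ≤ ∑ x ∈ X' z, ∑ y ∈ Y' z, g x y * a x * b y) ∧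
      (CutBdd g e (X' z) (Y' z) → ∀ x, a x = 0) := by
    intro z
    by_cases hc : CutBdd g e (X' z) (Y' z)
    · exact ⟨fun _ => 0, fun _ => 0, by simp, by simp, fun h => absurd hc h, fun _ _ => rfl⟩
    · have hc' := hc
      simp only [CutBdd, not_forall, not_le] at hc'
      obtain ⟨a, b, ha, hb, hab⟩ := hc'
      rcases le_total 0 (∑ x ∈ X' z, ∑ y ∈ Y' z, g x y * a x * b y) with h | h
      · rw [abs_of_nonneg h] at hab
        exact ⟨a, b, ha, hb, fun _ => hab.le, fun h => absurd h hc⟩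
      · rw [abs_of_nonpos h] at hab
        refine ⟨fun x => - a x, b, by simpa using ha, hb, fun _ => ?_, fun h => absurd h hc⟩
        simpa only [mul_neg, neg_mul, Finset.sum_neg_distrib] using hab.le
  choose a b ha hb h1 h2 using hex
  have key := hM (fun z x => if x ∈ X' z then a z x else 0)
    (fun z y => if y ∈ Y' z then b z y else 0)
    (fun z x => by split_ifs <;> simp [ha]) (fun z x => by split_ifs <;> simp [hb])
  simp only [sum_sum_restrict (hX _) (hY _)] at key
  refine le_trans ?_ ((le_abs_self _).trans key)
  rw [← Finset.sum_filter_add_sum_filter_not Z (fun z => ¬ CutBdd g e (X' z) (Y' z))]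
  have z2 : ∑ z ∈ Z with ¬ ¬ CutBdd g e (X' z) (Y' z),
      ∑ x ∈ X' z, ∑ y ∈ Y' z, g x y * a z x * b z y = 0 := by
    refine Finset.sum_eq_zero fun z hz => ?_
    have := h2 z (not_not.mp (Finset.mem_filter.mp hz).2)
    simp [this]
  rw [z2, add_zero, ← nsmul_eq_mul]
  exact Finset.card_nsmul_le_sum _ _ _ fun z hz => h1 z (Finset.mem_filter.mp hz).2

end Inheritance

universe u

/-! ### Products over the edges of `H`. -/

section EdgeProducts

/-- The product of `f i j` over the edges `ij`, `i < j`, of `H`. -/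
noncomputable def edgeProd {n : ℕ} (H : SimpleGraph (Fin n)) (f : Fin n → Fin n → ℝ) : ℝ :=
  ∏ i, ∏ j, if i < j ∧ H.Adj i j then f i j else 1

theorem edgeProd_succ {n : ℕ} (H : SimpleGraph (Fin (n + 1))) (f : Fin (n + 1) → Fin (n + 1) → ℝ) :
    edgeProd H f = (∏ j : Fin n, if H.Adj 0 j.succ then f 0 j.succ else 1) *
      edgeProd (H.comap Fin.succ) (fun i j => f i.succ j.succ) := by
  simp [edgeProd, Fin.prod_univ_succ]

theorem edgeProd_nonneg {n : ℕ} (H : SimpleGraph (Fin n)) {f : Fin n → Fin n → ℝ}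
    (hf : ∀ i j, 0 ≤ f i j) : 0 ≤ edgeProd H f := by
  refine Finset.prod_nonneg fun i _ => Finset.prod_nonneg fun j _ => ?_
  split_ifs
  exacts [hf _ _, zero_le_one]

theorem edgeProd_mul {n : ℕ} (H : SimpleGraph (Fin n)) (f g : Fin n → Fin n → ℝ) :
    edgeProd H (fun i j => f i j * g i j) = edgeProd H f * edgeProd H g := by
  simp only [edgeProd, ← Finset.prod_mul_distrib]
  refine Finset.prod_congr rfl fun i _ => Finset.prod_congr rfl fun j _ => ?_
  split_ifs <;> simp

theorem edgeProd_le {n : ℕ} (H : SimpleGraph (Fin n)) {f : Fin n → Fin n → ℝ} {M : ℝ}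
    (hM : 1 ≤ M) (hf0 : ∀ i j, 0 ≤ f i j) (hf : ∀ i j, f i j ≤ M) :
    edgeProd H f ≤ M ^ (n * n) := by
  have h1 : ∀ i j, 0 ≤ (if i < j ∧ H.Adj i j then f i j else 1) := fun i j => by
    split_ifs; exacts [hf0 _ _, zero_le_one]
  calc edgeProd H f ≤ ∏ _i : Fin n, ∏ _j : Fin n, M := by
        refine Finset.prod_le_prod (fun i _ => Finset.prod_nonneg fun j _ => h1 i j) fun i _ =>
          Finset.prod_le_prod (fun j _ => h1 i j) fun j _ => ?_
        split_ifs; exacts [hf _ _, hM]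
    _ = M ^ (n * n) := by simp [pow_mul]

theorem edgeProd_eq_prod_edgePairs {n : ℕ} (H : SimpleGraph (Fin n)) (f : Fin n → Fin n → ℝ) :
    edgeProd H f = ∏ x ∈ edgePairs H, f x.1 x.2 := by
  rw [edgeProd, edgePairs, Finset.prod_filter, Fintype.prod_prod_type]

end EdgeProducts

/-! ### Counting copies by embedding the first vertex. -/

section WeightedCounts

variable {V : Type u}

/-- The indicator of adjacency. -/
noncomputable def adjInd (G : SimpleGraph V) (x y : V) : ℝ := if G.Adj x y then 1 else 0

theorem adjInd_nonneg (G : SimpleGraph V) (x y : V) : 0 ≤ adjInd G x y := by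
  unfold adjInd; split_ifs <;> norm_num

theorem adjInd_le_one (G : SimpleGraph V) (x y : V) : adjInd G x y ≤ 1 := by
  unfold adjInd; split_ifs <;> norm_num

theorem adjInd_mono {G Γ : SimpleGraph V} (h : G ≤ Γ) (x y : V) :
    adjInd G x y ≤ adjInd Γ x y := by
  unfold adjInd
  by_cases hG : G.Adj x y
  · rw [if_pos hG, if_pos (h hG)]
  · rw [if_neg hG]; split_ifs <;> norm_num

theorem sum_adjInd (G : SimpleGraph V) (x : V) (Y : Finset V) :
    ∑ y ∈ Y, adjInd G x y = ((Y.filter (G.Adj x)).card : ℝ) := by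
  simp [adjInd]

/-- The number of partite copies of `H`, as a sum of products of indicators. -/
noncomputable def copyCount {n : ℕ} (H : SimpleGraph (Fin n)) (G : SimpleGraph V)
    (U : Fin n → Finset V) : ℝ :=
  ∑ φ ∈ Fintype.piFinset U, edgeProd H fun i j => adjInd G (φ i) (φ j)

theorem copyCount_nonneg {n : ℕ} (H : SimpleGraph (Fin n)) (G : SimpleGraph V)
    (U : Fin n → Finset V) : 0 ≤ copyCount H G U :=
  Finset.sum_nonneg fun _ _ => edgeProd_nonneg H fun _ _ => adjInd_nonneg _ _ _

theorem copyCount_mono {n : ℕ} (H : SimpleGraph (Fin n)) {G Γ : SimpleGraph V} (h : G ≤ Γ)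
    {U U' : Fin n → Finset V} (hU : ∀ i, U i ⊆ U' i) : copyCount H G U ≤ copyCount H Γ U' := by
  refine (Finset.sum_le_sum fun φ _ => ?_).trans (Finset.sum_le_sum_of_subset_of_nonneg
    (Fintype.piFinset_subset _ _ hU) fun φ _ _ =>
      edgeProd_nonneg H fun _ _ => adjInd_nonneg _ _ _)
  have h1 : ∀ i j, 0 ≤ (if i < j ∧ H.Adj i j then adjInd G (φ i) (φ j) else 1) := fun i j => by
    split_ifs; exacts [adjInd_nonneg _ _ _, zero_le_one]
  refine Finset.prod_le_prod (fun i _ => Finset.prod_nonneg fun j _ => h1 i j) fun i _ =>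
    Finset.prod_le_prod (fun j _ => h1 i j) fun j _ => ?_
  split_ifs
  exacts [adjInd_mono h _ _, le_rfl]

/-- The candidate sets for the vertices `1, …, n` of `H` once `0` is embedded to `x`. -/
noncomputable def candidates {n : ℕ} (H : SimpleGraph (Fin (n + 1))) (G : SimpleGraph V)
    (U : Fin (n + 1) → Finset V) (x : V) (j : Fin n) : Finset V :=
  if H.Adj 0 j.succ then (U j.succ).filter (G.Adj x) else U j.succ

theorem candidates_subset {n : ℕ} (H : SimpleGraph (Fin (n + 1))) (G : SimpleGraph V)
    (U : Fin (n + 1) → Finset V) (x : V) (j : Fin n) : candidates H G U x j ⊆ U j.succ := by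
  unfold candidates; split_ifs
  exacts [Finset.filter_subset _ _, subset_rfl]

theorem candidates_mono {n : ℕ} (H : SimpleGraph (Fin (n + 1))) {G Γ : SimpleGraph V}
    (h : G ≤ Γ) (U : Fin (n + 1) → Finset V) (x : V) (j : Fin n) :
    candidates H G U x j ⊆ candidates H Γ U x j := by
  unfold candidates; split_ifs
  · exact Finset.monotone_filter_right _ fun y _ hy => h hy
  · exact subset_rfl

/-- The edges at the vertex `0` are absorbed into the candidate sets, so what remains is a count of
the same kind for one vertex less. -/
theorem copyCount_succ {n : ℕ} (H : SimpleGraph (Fin (n + 1))) (G : SimpleGraph V)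
    (U : Fin (n + 1) → Finset V) :
    copyCount H G U = ∑ x ∈ U 0, copyCount (H.comap Fin.succ) G (candidates H G U x) := by
  have h1 : ∀ x, copyCount (H.comap Fin.succ) G (candidates H G U x) =
      ∑ ψ ∈ Fintype.piFinset fun j : Fin n => U j.succ,
        (∏ j : Fin n, if H.Adj 0 j.succ then adjInd G x (ψ j) else 1) *
          edgeProd (H.comap Fin.succ) fun i j => adjInd G (ψ i) (ψ j) := by
    intro x
    have hs : Fintype.piFinset (candidates H G U x) =
        (Fintype.piFinset fun j : Fin n => U j.succ).filter
          fun ψ => ∀ j : Fin n, H.Adj 0 j.succ → G.Adj x (ψ j) := by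
      ext ψ
      simp only [Fintype.mem_piFinset, Finset.mem_filter, ← forall_and]
      refine forall_congr' fun j => ?_
      unfold candidates
      split_ifs with h
      · simp [h]
      · simp [h]
    rw [copyCount, hs, Finset.sum_filter]
    refine Finset.sum_congr rfl fun ψ _ => ?_
    split_ifs with h
    · rw [Finset.prod_eq_one, one_mul]
      intro j _
      split_ifs with hj
      · simp [adjInd, h j hj]
      · rfl
    · simp only [not_forall] at h
      obtain ⟨j, hj, hj'⟩ := h
      rw [Finset.prod_eq_zero (Finset.mem_univ j), zero_mul]
      simp [hj, adjInd, hj']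
  simp only [h1]
  rw [copyCount, Finset.sum_sigma']
  refine Finset.sum_bij' (fun φ _ => ⟨φ 0, fun j => φ j.succ⟩)
    (fun q _ => Fin.cons (α := fun _ => V) q.1 q.2) ?_ ?_ ?_ ?_ ?_
  · intro φ hφ
    rw [Fintype.mem_piFinset] at hφ
    simp [hφ]
  · rintro ⟨x, ψ⟩ hq
    simp only [Finset.mem_sigma, Fintype.mem_piFinset] at hq
    rw [Fintype.mem_piFinset]
    intro i
    refine Fin.cases ?_ (fun j => ?_) i
    · simpa using hq.1
    · simpa using hq.2 j
  · intro φ _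
    funext i
    refine Fin.cases ?_ (fun j => ?_) i <;> simp
  · rintro ⟨x, ψ⟩ _
    simp
  · intro φ _
    rw [edgeProd_succ]

theorem numCopies_eq_copyCount {n : ℕ} (H : SimpleGraph (Fin n)) (G : SimpleGraph V)
    (U : Fin n → Finset V) : (numCopies H G U : ℝ) = copyCount H G U := by
  rw [numCopies, partiteCopies, Finset.card_filter, copyCount, Nat.cast_sum]
  refine Finset.sum_congr rfl fun φ _ => ?_
  rw [edgeProd_eq_prod_edgePairs]
  split_ifs with h
  · rw [Finset.prod_eq_one, Nat.cast_one]
    intro e he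
    rw [adjInd, if_pos (h _ _ (Finset.mem_filter.mp he).2.2)]
  · simp only [not_forall] at h
    obtain ⟨i, j, hij, hG⟩ := h
    rcases lt_or_gt_of_ne hij.ne with hlt | hlt
    · rw [Finset.prod_eq_zero (i := (i, j)), Nat.cast_zero]
      · exact Finset.mem_filter.mpr ⟨Finset.mem_univ _, hlt, hij⟩
      · simp [adjInd, hG]
    · rw [Finset.prod_eq_zero (i := (j, i)), Nat.cast_zero]
      · exact Finset.mem_filter.mpr ⟨Finset.mem_univ _, hlt, hij.symm⟩
      · simp only [adjInd]; rw [if_neg fun h => hG h.symm]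

end WeightedCounts

/-! ### Conditions on the exponent, in a form stable under embedding a vertex. -/

section Admissible

/-- The number of neighbours of `w` that are embedded before `i`, where `h w` of them come before
all vertices of `H`. -/
noncomputable def embDegree {n : ℕ} (H : SimpleGraph (Fin n)) (h : Fin n → ℕ) (i w : Fin n) : ℕ :=
  h w + (nbrBefore H i w).card

/-- The conditions on the exponent `K` of the bijumbledness that the embedding of the vertices of
`H` in their order uses. -/
structure Admissible {n : ℕ} (H : SimpleGraph (Fin n)) (h : Fin n → ℕ) (K : ℝ) : Prop where
  path : ∀ i j j', i < j → i < j' → H.Adj i j → H.Adj j j' →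
    4 ≤ 2 * K - embDegree H h i j - embDegree H h i j'
  edge : ∀ i j j', i < j → i < j' → H.Adj i j → H.Adj j j' →
    3 ≤ 2 * K - embDegree H h i i - embDegree H h i j
  triangle : ∀ i j j', i < j → i < j' → H.Adj i j → H.Adj j j' → H.Adj i j' →
    6 ≤ 2 * K - embDegree H h i i - embDegree H h i j
  order : ∀ i, ∃ τ : Fin n → ℕ, Set.InjOn τ {w | i < w ∧ H.Adj i w} ∧
    ∀ w, i < w → H.Adj i w →
      (2 + (Finset.univ.filter fun u => i < u ∧ H.Adj i u ∧ τ u < τ w).card : ℝ) ≤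
        2 * K - embDegree H h i i - embDegree H h i w

/-- The numbers of embedded neighbours after the embedding of the vertex `0`. -/
noncomputable def embDegreeTail {n : ℕ} (H : SimpleGraph (Fin (n + 1))) (h : Fin (n + 1) → ℕ)
    (w : Fin n) : ℕ :=
  h w.succ + if H.Adj 0 w.succ then 1 else 0

theorem embDegree_zero {n : ℕ} (H : SimpleGraph (Fin (n + 1))) (h : Fin (n + 1) → ℕ)
    (w : Fin (n + 1)) : embDegree H h 0 w = h w := by
  simp [embDegree, nbrBefore]

/-- The removed vertex `0` moves from the counted neighbours into the offset `h`. The total is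
unchanged, so all admissibility conditions pass to the tail with the same `K`. -/
theorem embDegree_succ {n : ℕ} (H : SimpleGraph (Fin (n + 1))) (h : Fin (n + 1) → ℕ)
    (i w : Fin n) : embDegree H h i.succ w.succ =
      embDegree (H.comap Fin.succ) (embDegreeTail H h) i w := by
  simp only [embDegree, nbrBefore, embDegreeTail, Finset.card_filter, Fin.sum_univ_succ]
  simp only [Fin.succ_pos, and_true, Fin.succ_lt_succ_iff, SimpleGraph.comap_adj,
    H.adj_comm w.succ 0]
  ring

theorem Admissible.tail {n : ℕ} {H : SimpleGraph (Fin (n + 1))} {h : Fin (n + 1) → ℕ} {K : ℝ}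
    (A : Admissible H h K) : Admissible (H.comap Fin.succ) (embDegreeTail H h) K where
  path i j j' h1 h2 h3 h4 := by
    simpa only [embDegree_succ] using A.path i.succ j.succ j'.succ (by simpa) (by simpa) h3 h4
  edge i j j' h1 h2 h3 h4 := by
    simpa only [embDegree_succ] using A.edge i.succ j.succ j'.succ (by simpa) (by simpa) h3 h4
  triangle i j j' h1 h2 h3 h4 h5 := by
    simpa only [embDegree_succ] using
      A.triangle i.succ j.succ j'.succ (by simpa) (by simpa) h3 h4 h5
  order i := by
    obtain ⟨τ, hτ, hK⟩ := A.order i.succ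
    refine ⟨fun w => τ w.succ, fun a ha b hb hab => ?_, fun w h1 h2 => ?_⟩
    · refine Fin.succ_injective _ (hτ ?_ ?_ hab)
      · exact ⟨Fin.succ_lt_succ_iff.mpr ha.1, ha.2⟩
      · exact ⟨Fin.succ_lt_succ_iff.mpr hb.1, hb.2⟩
    · have := hK w.succ (by simpa) h2
      rw [embDegree_succ, embDegree_succ] at this
      refine le_trans (add_le_add le_rfl ?_) this
      simp only [Finset.card_filter, Fin.sum_univ_succ]
      simp

end Admissible

/-! ### Upper bound of the right order for the count in the host graph. -/

section Host

variable {V : Type u}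

/-- The host graph `Γ` on the candidate sets `U i` with scales `s i`, where the bijumbledness is
measured on the scale before the embedding of the `h i` neighbours of `i`. -/
structure Host {n : ℕ} (H : SimpleGraph (Fin n)) (h : Fin n → ℕ) (K p η : ℝ)
    (Γ : SimpleGraph V) (U : Fin n → Finset V) (s : Fin n → ℝ) : Prop where
  p_pos : 0 < p
  p_le : p ≤ 1
  s_pos : ∀ i, 0 < s i
  card_le : ∀ i, ((U i).card : ℝ) ≤ s i
  jumbled : ∀ i j, H.Adj i j → Jumbled (fun x y => adjInd Γ x y - p)
    (η ^ 2 * p ^ (2 * K - h i - h j) * s i * s j) (U i) (U j)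

/-- Jumbledness is simply restricted to subsets. A scale that shrinks by `p` is compensated by `h`
growing by one, so the absolute bound stays the same; larger scales `s'` only weaken it. -/
theorem Host.tail {n : ℕ} {H : SimpleGraph (Fin (n + 1))} {h : Fin (n + 1) → ℕ} {K p η : ℝ}
    {Γ : SimpleGraph V} {U : Fin (n + 1) → Finset V} {s : Fin (n + 1) → ℝ}
    (D : Host H h K p η Γ U s) {U' : Fin n → Finset V} {s' : Fin n → ℝ}
    (hU : ∀ j, U' j ⊆ U j.succ) (hcard : ∀ j, ((U' j).card : ℝ) ≤ s' j)
    (hs : ∀ j, (if H.Adj 0 j.succ then p else 1) * s j.succ ≤ s' j) :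
    Host (H.comap Fin.succ) (embDegreeTail H h) K p η Γ U' s' where
  p_pos := D.p_pos
  p_le := D.p_le
  s_pos j := by
    refine lt_of_lt_of_le ?_ (hs j)
    have := D.s_pos j.succ; have := D.p_pos
    split_ifs <;> positivity
  card_le := hcard
  jumbled i j hij := by
    refine (D.jumbled i.succ j.succ hij).mono ?_ (hU i) (hU j)
    have hp := D.p_pos
    have key : ∀ w : Fin n, p ^ ((if H.Adj 0 w.succ then 1 else 0 : ℕ) : ℝ) =
        if H.Adj 0 w.succ then p else 1 := fun w => by split_ifs <;> simp
    have e : p ^ (2 * K - h i.succ - h j.succ) =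
        p ^ (2 * K - embDegreeTail H h i - embDegreeTail H h j) *
          ((if H.Adj 0 i.succ then p else 1) * (if H.Adj 0 j.succ then p else 1)) := by
      rw [← key i, ← key j, ← Real.rpow_add hp, ← Real.rpow_add hp]
      congr 1
      simp only [embDegreeTail, Nat.cast_add]
      ring
    have hq : 0 ≤ p ^ (2 * K - embDegreeTail H h i - embDegreeTail H h j) := by positivity
    have h0 : ∀ w : Fin n, 0 ≤ (if H.Adj 0 w.succ then p else 1) * s w.succ := fun w => by
      have := D.s_pos w.succ
      split_ifs <;> positivity
    have hm := mul_le_mul (hs i) (hs j) (h0 j) ((h0 i).trans (hs i))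
    calc _ = η ^ 2 * p ^ (2 * K - embDegreeTail H h i - embDegreeTail H h j) *
          (((if H.Adj 0 i.succ then p else 1) * s i.succ) *
            ((if H.Adj 0 j.succ then p else 1) * s j.succ)) := by rw [e]; ring
      _ ≤ η ^ 2 * p ^ (2 * K - embDegreeTail H h i - embDegreeTail H h j) * (s' i * s' j) := by
          gcongr
      _ = _ := by ring

/-- Let `j₀` be the last index in the order `τ` with `D j₀ > 2`, if there is one. Later factors are
at most `2`, earlier ones at most `2/p`, and `D j₀` is kept; summing over the possible `j₀` gives
the bound. -/
theorem prod_max_one_le {ι : Type*} (N : Finset ι) (τ : ι → ℕ) (hτ : Set.InjOn τ N) {p : ℝ}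
    (hp : 0 < p) (hp1 : p ≤ 1) (D : ι → ℝ) (hD : ∀ j ∈ N, D j ≤ p⁻¹) :
    ∏ j ∈ N, max 1 (D j) ≤ 2 ^ N.card *
      (1 + ∑ j ∈ N, if 2 < D j then D j * p⁻¹ ^ (N.filter fun u => τ u < τ j).card else 0) := by
  have hterm : ∀ j ∈ N, 0 ≤
      if 2 < D j then D j * p⁻¹ ^ (N.filter fun u => τ u < τ j).card else 0 := by
    intro j _
    split_ifs with h
    · have : 0 < D j := by linarith
      positivity
    · exact le_rfl
  have hp1' : 1 ≤ p⁻¹ := (one_le_inv₀ hp).mpr hp1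
  rcases (N.filter fun j => 2 < D j).eq_empty_or_nonempty with h | h
  · have : ∏ j ∈ N, max 1 (D j) ≤ 2 ^ N.card := by
      rw [← Finset.prod_const]
      refine Finset.prod_le_prod (fun j _ => le_trans zero_le_one (le_max_left _ _)) fun j hj => ?_
      have : ¬ 2 < D j := fun h2 => by
        have : j ∈ N.filter fun j => 2 < D j := Finset.mem_filter.mpr ⟨hj, h2⟩
        rw [h] at this
        simp at this
      exact max_le one_le_two (not_lt.mp this)
    refine this.trans (le_mul_of_one_le_right (by positivity) ?_)
    linarith [Finset.sum_nonneg hterm]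
  · obtain ⟨j₀, hj₀, hmax⟩ := Finset.exists_max_image _ τ h
    rw [Finset.mem_filter] at hj₀
    have hD0 : 0 < D j₀ := by linarith [hj₀.2]
    have h1 : ∏ j ∈ N, max 1 (D j) ≤ ∏ j ∈ N, (2 * (if τ j < τ j₀ then p⁻¹ else 1) *
        (if j = j₀ then D j₀ else 1)) := by
      refine Finset.prod_le_prod (fun j _ => le_trans zero_le_one (le_max_left _ _)) fun j hj => ?_
      by_cases hjj : j = j₀
      · subst hjj
        simp only [lt_irrefl, if_false, if_true, mul_one]
        exact max_le (by linarith) (by linarith)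
      · rw [if_neg hjj, mul_one]
        split_ifs with hlt
        · exact max_le (by linarith) (by linarith [hD j hj])
        · rw [mul_one]
          refine max_le one_le_two (not_lt.mp fun h2 => hjj ?_)
          exact hτ hj hj₀.1 (le_antisymm (hmax j (Finset.mem_filter.mpr ⟨hj, h2⟩))
            (not_lt.mp hlt))
    refine h1.trans ?_
    rw [Finset.prod_mul_distrib, Finset.prod_mul_distrib, Finset.prod_const,
      Finset.prod_ite_eq' N j₀, if_pos hj₀.1, ← Finset.prod_filter, Finset.prod_const, mul_assoc]
    gcongr
    have := Finset.single_le_sum hterm hj₀.1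
    rw [if_pos hj₀.2] at this
    linarith

theorem sum_prod_max_one_le {ι : Type*} (N : Finset ι) (τ : ι → ℕ) (hτ : Set.InjOn τ N)
    {p s : ℝ} (hp : 0 < p) (hp1 : p ≤ 1) {X : Finset V} (hX : (X.card : ℝ) ≤ s)
    (D : ι → V → ℝ) (hD : ∀ j ∈ N, ∀ x, D j x ≤ p⁻¹)
    (hsum : ∀ j ∈ N, ∑ x ∈ X, (if 2 < D j x then D j x else 0) ≤
      2 * p ^ (N.filter fun u => τ u < τ j).card * s) :
    ∑ x ∈ X, ∏ j ∈ N, max 1 (D j x) ≤ 2 ^ N.card * (1 + 2 * N.card) * s := by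
  calc _ ≤ ∑ x ∈ X, 2 ^ N.card * (1 + ∑ j ∈ N, if 2 < D j x then
        D j x * p⁻¹ ^ (N.filter fun u => τ u < τ j).card else 0) :=
        Finset.sum_le_sum fun x _ =>
          prod_max_one_le N τ hτ hp hp1 (fun j => D j x) fun j hj => hD j hj x
    _ = 2 ^ N.card * (X.card + ∑ j ∈ N, p⁻¹ ^ (N.filter fun u => τ u < τ j).card *
          ∑ x ∈ X, if 2 < D j x then D j x else 0) := by
        rw [← Finset.mul_sum, Finset.sum_add_distrib, Finset.sum_comm]
        simp only [Finset.sum_const, nsmul_eq_mul, mul_one, Finset.mul_sum]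
        congr 2
        refine Finset.sum_congr rfl fun j _ => Finset.sum_congr rfl fun x _ => ?_
        split_ifs <;> simp [mul_comm]
    _ ≤ 2 ^ N.card * (s + ∑ j ∈ N, 2 * s) := by
        refine mul_le_mul_of_nonneg_left (add_le_add hX (Finset.sum_le_sum fun j hj => ?_))
          (by positivity)
        calc _ ≤ p⁻¹ ^ (N.filter fun u => τ u < τ j).card *
              (2 * p ^ (N.filter fun u => τ u < τ j).card * s) := by
              gcongr; exact hsum j hj
          _ = 2 * s := by
              rw [inv_pow]; field_simp
    _ = _ := by
        rw [Finset.sum_const, nsmul_eq_mul]; ring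

/-- The tail bound loses one factor `p` and the normalisation of the degree another, so exponent `2
+ t` leaves `p ^ t`. This pays for the `t` factors `1/p` of the earlier neighbours. -/
theorem Host.sum_degree_tail_le {n : ℕ} {H : SimpleGraph (Fin (n + 1))} {h : Fin (n + 1) → ℕ}
    {K p : ℝ} {Γ : SimpleGraph V} {U : Fin (n + 1) → Finset V} {s : Fin (n + 1) → ℝ}
    (D : Host H h K p 1 Γ U s) {j : Fin n} (hj : H.Adj 0 j.succ) {t : ℕ}
    (ht : (2 + t : ℝ) ≤ 2 * K - h 0 - h j.succ) :
    ∑ x ∈ U 0, (if 2 < (((U j.succ).filter (Γ.Adj x)).card : ℝ) / (p * s j.succ) then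
      (((U j.succ).filter (Γ.Adj x)).card : ℝ) / (p * s j.succ) else 0) ≤ 2 * p ^ t * s 0 := by
  have hp := D.p_pos; have hs := D.s_pos j.succ; have hs0 := D.s_pos 0
  have := (D.jumbled 0 j.succ hj).sum_tail_le hp (by positivity) (h := fun _ => 1)
    (t := s j.succ) (by simp) (by simp) (by simpa using D.card_le j.succ)
  simp only [mul_one, sum_adjInd] at this
  rw [Finset.sum_filter] at this
  calc _ = (∑ x ∈ U 0, if 2 * p * s j.succ < (((U j.succ).filter (Γ.Adj x)).card : ℝ) then
        (((U j.succ).filter (Γ.Adj x)).card : ℝ) else 0) / (p * s j.succ) := by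
        rw [Finset.sum_div]
        refine Finset.sum_congr rfl fun x _ => ?_
        simp only [lt_div_iff₀ (show 0 < p * s j.succ by positivity), ← mul_assoc]
        split_ifs <;> simp
    _ ≤ (2 * (1 ^ 2 * p ^ (2 * K - h 0 - h j.succ) * s 0 * s j.succ) / p) / (p * s j.succ) := by
        gcongr
    _ ≤ (2 * (1 ^ 2 * p ^ (2 + t : ℝ) * s 0 * s j.succ) / p) / (p * s j.succ) := by
        gcongr ?_ / _
        gcongr ?_ / _
        gcongr 2 * (1 ^ 2 * ?_ * _ * _)
        exact Real.rpow_le_rpow_of_exponent_ge hp D.p_le ht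
    _ = 2 * p ^ t * s 0 := by
        rw [Real.rpow_add hp, Real.rpow_natCast, Real.rpow_ofNat]
        field_simp

/-- The upper bound of the right order of magnitude for the number of copies of `H` in a
bijumbled graph. -/
theorem exists_copyCount_le (n : ℕ) : ∃ C : ℝ, 0 < C ∧
    ∀ (H : SimpleGraph (Fin n)) (h : Fin n → ℕ) (K : ℝ), Admissible H h K →
    ∀ (V : Type u) (p : ℝ) (Γ : SimpleGraph V) (U : Fin n → Finset V) (s : Fin n → ℝ),
      Host H h K p 1 Γ U s → copyCount H Γ U ≤ C * edgeProd H (fun _ _ => p) * ∏ i, s i := by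
  induction n with
  | zero =>
    refine ⟨1, one_pos, fun H h K _ V p Γ U s _ => ?_⟩
    simp [copyCount, edgeProd]
  | succ n ih =>
    obtain ⟨C, hC, ih⟩ := ih
    refine ⟨C * (2 ^ n * (1 + 2 * n)), by positivity, fun H h K A V p Γ U s D => ?_⟩
    have hp := D.p_pos
    set N : Finset (Fin n) := Finset.univ.filter fun j => H.Adj 0 j.succ with hN
    set d : Fin n → V → ℝ := fun j x =>
      (((U j.succ).filter (Γ.Adj x)).card : ℝ) / (p * s j.succ) with hd
    have hs' : ∀ j : Fin n, 0 < s j.succ := fun j => D.s_pos _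
    set E := edgeProd (H.comap Fin.succ) (fun _ _ => p) with hE
    have hE0 : 0 ≤ E := edgeProd_nonneg _ fun _ _ => hp.le
    have step : ∀ x ∈ U 0, copyCount (H.comap Fin.succ) Γ (candidates H Γ U x) ≤
        C * E * ((∏ j : Fin n, s j.succ) * p ^ N.card * ∏ j ∈ N, max 1 (d j x)) := by
      intro x _
      -- The scales follow the actual degrees of `x` but never drop below the expected ones, as
      -- `Host.tail` requires. The excess is the product of the `max 1 (d j x)`, bounded on average
      -- over `x`.
      set s' : Fin n → ℝ := fun j => s j.succ * (if H.Adj 0 j.succ then p else 1) *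
        (if H.Adj 0 j.succ then max 1 (d j x) else 1) with hs'd
      have hT := D.tail (U' := candidates H Γ U x) (s' := s')
        (fun j => candidates_subset H Γ U x j) (fun j => by
          simp only [candidates, hs'd]
          split_ifs with hj
          · refine le_trans (le_of_eq ?_) (mul_le_mul_of_nonneg_left (le_max_right _ _)
              (by have := hs' j; positivity))
            simp only [hd]
            have := hs' j
            field_simp
          · simpa using D.card_le j.succ) (fun j => by
          simp only [hs'd]
          have h1 : 1 ≤ (if H.Adj 0 j.succ then max 1 (d j x) else 1) := by
            split_ifs; exacts [le_max_left _ _, le_rfl]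
          rw [mul_comm (ite _ _ _) (s j.succ)]
          refine le_mul_of_one_le_right ?_ h1
          have := hs' j
          split_ifs <;> positivity)
      refine (ih _ _ _ A.tail V p Γ _ _ hT).trans (le_of_eq ?_)
      congr 1
      simp only [hs'd, Finset.prod_mul_distrib]
      rw [← Finset.prod_filter, ← Finset.prod_filter, Finset.prod_const]
    rw [copyCount_succ]
    refine (Finset.sum_le_sum step).trans ?_
    rw [← Finset.mul_sum, ← Finset.mul_sum]
    obtain ⟨τ, hτ, hK⟩ := A.order 0
    have hsum := sum_prod_max_one_le N (fun j => τ j.succ) (s := s 0) (fun a ha b hb hab => by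
        have ha' := (Finset.mem_filter.mp ha).2
        have hb' := (Finset.mem_filter.mp hb).2
        exact Fin.succ_injective _ (hτ ⟨Fin.succ_pos _, ha'⟩ ⟨Fin.succ_pos _, hb'⟩ hab))
      hp D.p_le (D.card_le 0) d (fun j _ x => by
        have := hs' j
        simp only [hd]
        rw [div_le_iff₀ (by positivity), inv_mul_cancel_left₀ hp.ne']
        exact le_trans (by exact_mod_cast Finset.card_le_card (Finset.filter_subset _ _))
          (D.card_le j.succ)) (fun j hj => by
        have hj' := (Finset.mem_filter.mp hj).2
        refine D.sum_degree_tail_le hj' ?_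
        have := hK j.succ (Fin.succ_pos _) hj'
        rw [embDegree_zero, embDegree_zero] at this
        refine le_trans (add_le_add le_rfl ?_) this
        simp only [hN, Finset.filter_filter, Finset.card_filter, Fin.sum_univ_succ]
        simp)
    have hNn : (N.card : ℝ) ≤ n := by
      have := N.card_le_univ
      rw [Fintype.card_fin] at this
      exact_mod_cast this
    have hNn' : N.card ≤ n := by exact_mod_cast hNn
    have hprod : 0 < ∏ j : Fin n, s j.succ := Finset.prod_pos fun j _ => hs' j
    have hs0 := D.s_pos 0
    calc _ ≤ C * E * ((∏ j : Fin n, s j.succ) * p ^ N.card *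
          (2 ^ N.card * (1 + 2 * N.card) * s 0)) := by
          gcongr
      _ ≤ C * E * ((∏ j : Fin n, s j.succ) * p ^ N.card *
          (2 ^ n * (1 + 2 * n) * s 0)) := by
          gcongr; norm_num
      _ = _ := by
          rw [edgeProd_succ, Fin.prod_univ_succ, ← Finset.prod_filter, Finset.prod_const]
          ring

end Host

/-! ### Most images of the first vertex preserve sizes and regularity. -/

section Inheritance

variable {α β : Type*} {V : Type u}

theorem RegPair.swap {g Γ : α → β → ℝ} {p η s t : ℝ} {X : Finset α} {Y : Finset β}
    (h : RegPair g Γ p η s t X Y) :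
    RegPair (fun y x => g x y) (fun y x => Γ x y) p η t s Y X where
  p_pos := h.p_pos
  p_le := h.p_le
  eta_pos := h.eta_pos
  eta_le := h.eta_le
  s_pos := h.t_pos
  t_pos := h.s_pos
  nonneg y x := h.nonneg x y
  le_one y x := h.le_one x y
  abs_le y x := h.abs_le x y
  card_left := h.card_right
  card_right := h.card_left
  jumbled := h.jumbled.swap.mono (le_of_eq (by ring)) subset_rfl subset_rfl
  cut := h.cut.swap.mono (le_of_eq (by ring)) subset_rfl subset_rfl

/-- The signs of the row sums on the exceptional rows form a test function. -/
theorem CutBdd.card_mul_le {g : α → β → ℝ} {e κ : ℝ} {X : Finset α} {Y : Finset β}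
    (h : CutBdd g e X Y) :
    ((X.filter fun x => ¬ |∑ y ∈ Y, g x y| ≤ κ).card : ℝ) * κ ≤ e := by
  have key := (h.mono le_rfl (Finset.filter_subset (fun x => ¬ |∑ y ∈ Y, g x y| ≤ κ) X) subset_rfl)
    (fun x => SignType.sign (∑ y ∈ Y, g x y)) (fun _ => 1) (fun x => by
      rcases lt_trichotomy (∑ y ∈ Y, g x y) 0 with h' | h' | h'
      · simp [sign_neg h']
      · simp [h']
      · simp [sign_pos h']) (by simp)
  refine le_trans ?_ ((le_abs_self _).trans key)
  rw [← nsmul_eq_mul]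
  refine Finset.card_nsmul_le_sum _ _ _ fun x hx => ?_
  simp only [mul_one, ← Finset.sum_mul]
  rw [self_mul_sign]
  exact (not_le.mp (Finset.mem_filter.mp hx).2).le

/-- The graph `G` on the candidate sets `U i` has density `d i j * p` up to an error of cut norm at
most `η p s i s j`. -/
structure CutRegular {n : ℕ} (H : SimpleGraph (Fin n)) (p η : ℝ) (G : SimpleGraph V)
    (U : Fin n → Finset V) (s : Fin n → ℝ) (d : Fin n → Fin n → ℝ) : Prop where
  nonneg : ∀ i j, 0 ≤ d i j
  le_two : ∀ i j, d i j ≤ 2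
  cut : ∀ i j, H.Adj i j → CutBdd (fun x y => adjInd G x y - d i j * p)
    (η * p * s i * s j) (U i) (U j)

variable {n : ℕ} {H : SimpleGraph (Fin (n + 1))} {h : Fin (n + 1) → ℕ} {K p θ : ℝ}
  {G Γ : SimpleGraph V} {U : Fin (n + 1) → Finset V} {s : Fin (n + 1) → ℝ}
  {d : Fin (n + 1) → Fin (n + 1) → ℝ}

theorem Host.jumbled_pow {n : ℕ} {H : SimpleGraph (Fin n)} {h : Fin n → ℕ}
    {U : Fin n → Finset V} {s : Fin n → ℝ} (D : Host H h K p (θ ^ 2) Γ U s) {i j : Fin n}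
    (hij : H.Adj i j) {k : ℕ} (hk : (k : ℝ) ≤ 2 * K - h i - h j) :
    Jumbled (fun x y => adjInd Γ x y - p) ((θ ^ 2) ^ 2 * p ^ k * s i * s j) (U i) (U j) := by
  refine (D.jumbled i j hij).mono ?_ subset_rfl subset_rfl
  have := D.s_pos i; have := D.s_pos j
  gcongr
  rw [← Real.rpow_natCast]
  exact Real.rpow_le_rpow_of_exponent_ge D.p_pos D.p_le hk

theorem Host.kernelPair (D : Host H h K p (θ ^ 2) Γ U s) {j : Fin n} (hj : H.Adj 0 j.succ)
    {k : ℕ} (hk : (k : ℝ) ≤ 2 * K - h 0 - h j.succ) :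
    KernelPair (adjInd Γ) p ((θ ^ 2) ^ 2 * p ^ k * s 0 * s j.succ) (s 0) (s j.succ) (U 0)
      (U j.succ) where
  s_pos := D.s_pos 0
  Q_nonneg := by
    have := D.s_pos 0; have := D.s_pos j.succ; have := D.p_pos; positivity
  nonneg := adjInd_nonneg Γ
  le_one := adjInd_le_one Γ
  card_left := D.card_le 0
  card_right := D.card_le _
  jumbled := D.jumbled_pow hj hk

theorem Host.regPair (hθ : 0 < θ) (hθ1 : θ ≤ 1) (D : Host H h K p (θ ^ 2) Γ U s) (hG : G ≤ Γ)
    (R : CutRegular H p (θ ^ 2) G U s d) {i j : Fin (n + 1)} (hij : H.Adj i j)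
    (hk : 4 ≤ 2 * K - h i - h j) :
    RegPair (fun x y => adjInd G x y - d i j * p) (adjInd Γ) p (θ ^ 2) (s i) (s j) (U i)
      (U j) where
  p_pos := D.p_pos
  p_le := D.p_le
  eta_pos := by positivity
  eta_le := pow_le_one₀ hθ.le hθ1
  s_pos := D.s_pos i
  t_pos := D.s_pos j
  nonneg := adjInd_nonneg Γ
  le_one := adjInd_le_one Γ
  abs_le x y := by
    refine (abs_sub _ _).trans (add_le_add ?_ ?_)
    · rw [abs_of_nonneg (adjInd_nonneg _ _ _)]; exact adjInd_mono hG x y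
    · rw [abs_of_nonneg (mul_nonneg (R.nonneg _ _) D.p_pos.le)]
      exact mul_le_mul_of_nonneg_right (R.le_two _ _) D.p_pos.le
  card_left := D.card_le i
  card_right := D.card_le j
  jumbled := D.jumbled_pow hij (by exact_mod_cast hk)
  cut := R.cut i j hij

/-- This lets `Γ`, between the part of `0` and that of `j`, act as the jumbled kernel dominating the
test functions on the candidate sets. -/
theorem le_adjInd_of_le_candidates (hG : G ≤ Γ) {x y : V} {j : Fin n} (hj : H.Adj 0 j.succ)
    {r : ℝ} (hr : r ≤ if y ∈ candidates H G U x j then 1 else 0) : r ≤ adjInd Γ x y := by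
  refine hr.trans ?_
  split_ifs with h'
  · rw [candidates, if_pos hj, Finset.mem_filter] at h'
    rw [adjInd, if_pos (hG h'.2)]
  · exact adjInd_nonneg _ _ _

theorem le_one_of_le_ite {P : Prop} [Decidable P] {r : ℝ} (hr : r ≤ if P then 1 else 0) :
    r ≤ 1 := by
  refine hr.trans ?_
  split_ifs <;> norm_num

/-- For most choices `x` of the image of the vertex `0`, the candidate sets of `i` and `j` inherit
regularity. -/
theorem card_not_inherit_le (A : Admissible H h K) (hθ : 0 < θ) (hθ1 : θ ≤ 1)
    (D : Host H h K p (θ ^ 2) Γ U s) (hG : G ≤ Γ) (R : CutRegular H p (θ ^ 2) G U s d)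
    {i j : Fin n} (hij : H.Adj i.succ j.succ) {κ : ℝ} (hκ : θ ^ 2 ≤ κ) :
    (((U 0).filter fun x => ¬ CutBdd (fun x y => adjInd G x y - d i.succ j.succ * p)
      (κ * p * ((if H.Adj 0 i.succ then p else 1) * s i.succ) *
        ((if H.Adj 0 j.succ then p else 1) * s j.succ))
      (candidates H G U x i) (candidates H G U x j)).card : ℝ) * κ ≤ 29 * √θ * s 0 := by
  have hp := D.p_pos
  have hsi := D.s_pos i.succ; have hsj := D.s_pos j.succ; have hs0 := D.s_pos 0
  have hκ0 : 0 < κ := lt_of_lt_of_le (by positivity) hκ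
  have hsq : θ ≤ √θ := Real.le_sqrt_of_sq_le (pow_le_of_le_one hθ.le hθ1 (by norm_num))
  have hpath := A.path 0
  have hedge := A.edge 0
  have htri := A.triangle 0
  simp only [embDegree_zero] at hpath hedge htri
  -- The normalisation `P` cancels, and `θ ≤ √θ` gives `17 + 12 = 29`.
  have finish : ∀ {c P : ℝ}, 0 < P → c * (κ * P) ≤ (17 * √θ + 12 * θ) * P * s 0 →
      c * κ ≤ 29 * √θ * s 0 := by
    intro c P hP hc
    have : c * κ * P ≤ (17 * √θ + 12 * θ) * s 0 * P := by linarith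
    refine (le_of_mul_le_mul_right this hP).trans ?_
    gcongr
    linarith
  by_cases hi : H.Adj 0 i.succ <;> by_cases hj : H.Adj 0 j.succ
  · have e4 := hpath i.succ j.succ (Fin.succ_pos _) (Fin.succ_pos _) hi hij
    have e6 := htri i.succ j.succ (Fin.succ_pos _) (Fin.succ_pos _) hi hij hj
    have e3 := hedge j.succ i.succ (Fin.succ_pos _) (Fin.succ_pos _) hj hij.symm
    have M := card_not_cutBdd_le (g := fun x y => adjInd G x y - d i.succ j.succ * p)
      (X := U i.succ) (Y := U j.succ) (Z := U 0)
      (fun x => candidates H G U x i) (fun x => candidates H G U x j)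
      (fun x => candidates_subset _ _ _ _ _) (fun x => candidates_subset _ _ _ _ _)
      (e := κ * (p * (p * s i.succ) * (p * s j.succ)))
      (fun a b ha hb => (D.regPair hθ hθ1 hG R hij e4).abs_sum_two_sided_le hθ
        (D.kernelPair hj (k := 3) (by exact_mod_cast e3))
        (D.kernelPair hi (k := 6) (by exact_mod_cast e6))
        (fun z x => le_adjInd_of_le_candidates hG hi (ha z x))
        (fun z x => le_adjInd_of_le_candidates hG hj (hb z x)))
    simp only [if_pos hi, if_pos hj]
    refine finish (P := p * (p * s i.succ) * (p * s j.succ)) (by positivity) ?_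
    simp only [← mul_assoc] at M ⊢
    refine M.trans (le_of_eq ?_)
    ring
  · have e4 := hpath i.succ j.succ (Fin.succ_pos _) (Fin.succ_pos _) hi hij
    have e3 := hedge i.succ j.succ (Fin.succ_pos _) (Fin.succ_pos _) hi hij
    -- The one-sided estimate shrinks the second side, so the pair is swapped when only `i` is
    -- adjacent to `0`.
    have M := card_not_cutBdd_le (g := fun y x => adjInd G x y - d i.succ j.succ * p)
      (X := U j.succ) (Y := U i.succ) (Z := U 0)
      (fun x => candidates H G U x j) (fun x => candidates H G U x i)
      (fun x => candidates_subset _ _ _ _ _) (fun x => candidates_subset _ _ _ _ _)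
      (e := κ * (p * (p * s i.succ) * s j.succ))
      (fun a b ha hb => (D.regPair hθ hθ1 hG R hij e4).swap.abs_sum_one_sided_le hθ
        (D.kernelPair hi (k := 3) (by exact_mod_cast e3))
        (fun z x => le_one_of_le_ite (ha z x))
        (fun z x => le_adjInd_of_le_candidates hG hi (hb z x)))
    simp only [if_pos hi, if_neg hj, one_mul]
    refine finish (P := p * (p * s i.succ) * s j.succ) (by positivity) ?_
    simp only [← mul_assoc] at M ⊢
    refine le_trans ?_ (M.trans ?_)
    · gcongr
      intro hc
      exact hc.swap
    · have : 11 * √θ ≤ 17 * √θ := by gcongr; norm_num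
      calc _ = (11 * √θ + 12 * θ) * (p * (p * s i.succ) * s j.succ * s 0) := by ring
        _ ≤ (17 * √θ + 12 * θ) * (p * (p * s i.succ) * s j.succ * s 0) := by gcongr
        _ = _ := by ring
  · have e4 := hpath j.succ i.succ (Fin.succ_pos _) (Fin.succ_pos _) hj hij.symm
    have e3 := hedge j.succ i.succ (Fin.succ_pos _) (Fin.succ_pos _) hj hij.symm
    have M := card_not_cutBdd_le (g := fun x y => adjInd G x y - d i.succ j.succ * p)
      (X := U i.succ) (Y := U j.succ) (Z := U 0)
      (fun x => candidates H G U x i) (fun x => candidates H G U x j)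
      (fun x => candidates_subset _ _ _ _ _) (fun x => candidates_subset _ _ _ _ _)
      (e := κ * (p * s i.succ * (p * s j.succ)))
      (fun a b ha hb => (D.regPair hθ hθ1 hG R hij (by linarith)).abs_sum_one_sided_le hθ
        (D.kernelPair hj (k := 3) (by exact_mod_cast e3))
        (fun z x => le_one_of_le_ite (ha z x))
        (fun z x => le_adjInd_of_le_candidates hG hj (hb z x)))
    simp only [if_neg hi, if_pos hj, one_mul]
    refine finish (P := p * s i.succ * (p * s j.succ)) (by positivity) ?_
    simp only [← mul_assoc] at M ⊢
    refine M.trans ?_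
    have : 11 * √θ ≤ 17 * √θ := by gcongr; norm_num
    calc _ = (11 * √θ + 12 * θ) * (p * s i.succ * (p * s j.succ) * s 0) := by ring
      _ ≤ (17 * √θ + 12 * θ) * (p * s i.succ * (p * s j.succ) * s 0) := by gcongr
      _ = _ := by ring
  · rw [Finset.filter_false_of_mem]
    · simp only [Finset.card_empty, Nat.cast_zero, zero_mul]; positivity
    · intro x _
      simp only [not_not, if_neg hi, if_neg hj, one_mul]
      exact (R.cut _ _ hij).mono (by gcongr) (candidates_subset _ _ _ _ _)
        (candidates_subset _ _ _ _ _)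

/-- For most choices `x` of the image of the vertex `0`, the candidate set of `j` has about the
expected size. -/
theorem card_not_degree_le (D : Host H h K p (θ ^ 2) Γ U s)
    (R : CutRegular H p (θ ^ 2) G U s d) {j : Fin n} (hj : H.Adj 0 j.succ) {κ : ℝ} :
    (((U 0).filter fun x => ¬ |((candidates H G U x j).card : ℝ) -
      d 0 j.succ * p * (U j.succ).card| ≤ κ * p * s j.succ).card : ℝ) * κ ≤ θ ^ 2 * s 0 := by
  have hp := D.p_pos; have hsj := D.s_pos j.succ
  have := (R.cut 0 j.succ hj).card_mul_le (κ := κ * p * s j.succ)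
  simp only [Finset.sum_sub_distrib, sum_adjInd, Finset.sum_const, nsmul_eq_mul] at this
  simp only [candidates, if_pos hj]
  have e : ∀ x, (((U j.succ).filter (G.Adj x)).card : ℝ) - (U j.succ).card * (d 0 j.succ * p) =
      (((U j.succ).filter (G.Adj x)).card : ℝ) - d 0 j.succ * p * (U j.succ).card :=
    fun x => by ring
  simp only [e] at this
  refine le_of_mul_le_mul_right ?_ (show 0 < p * s j.succ by positivity)
  refine le_trans (le_of_eq ?_) (this.trans (le_of_eq ?_)) <;> ring

end Inheritance

/-! ### The counting lemma by induction on the number of vertices. -/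

section MainInduction

variable {V : Type u}

theorem abs_prod_sub_prod_le {ι : Type*} (N : Finset ι) {a b : ι → ℝ} {T κ : ℝ} (hT : 1 ≤ T)
    (hκ : 0 ≤ κ) (ha0 : ∀ j, 0 ≤ a j) (ha : ∀ j, a j ≤ T) (hb0 : ∀ j, 0 ≤ b j) (hb : ∀ j, b j ≤ T)
    (hab : ∀ j, |a j - b j| ≤ κ) :
    |∏ j ∈ N, a j - ∏ j ∈ N, b j| ≤ N.card * κ * T ^ N.card := by
  induction N using Finset.induction_on with
  | empty => simp
  | insert i N hi ih =>
    rw [Finset.prod_insert hi, Finset.prod_insert hi, Finset.card_insert_of_notMem hi]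
    have e : a i * ∏ j ∈ N, a j - b i * ∏ j ∈ N, b j =
        (a i - b i) * ∏ j ∈ N, a j + b i * (∏ j ∈ N, a j - ∏ j ∈ N, b j) := by ring
    have hA : ∏ j ∈ N, a j ≤ T ^ N.card := by
      rw [← Finset.prod_const]
      exact Finset.prod_le_prod (fun j _ => ha0 j) fun j _ => ha j
    have hA0 : 0 ≤ ∏ j ∈ N, a j := Finset.prod_nonneg fun j _ => ha0 j
    rw [e]
    refine (abs_add_le _ _).trans ?_
    rw [abs_mul, abs_mul, abs_of_nonneg hA0, abs_of_nonneg (hb0 i)]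
    have hTn : T ^ N.card ≤ T ^ (N.card + 1) := pow_le_pow_right₀ hT (Nat.le_succ _)
    calc _ ≤ κ * T ^ N.card + T * (N.card * κ * T ^ N.card) := by
          have := hab i
          have := hb i
          gcongr
      _ ≤ κ * T ^ (N.card + 1) + T * (N.card * κ * T ^ N.card) := by gcongr
      _ = _ := by push_cast; ring

/-- The vertices whose choice as the image of `0` gives candidate sets of the expected sizes that
inherit regularity. -/
def IsTypicalImage {n : ℕ} (H : SimpleGraph (Fin (n + 1))) (p κ η : ℝ) (G : SimpleGraph V)
    (U : Fin (n + 1) → Finset V) (s : Fin (n + 1) → ℝ) (d : Fin (n + 1) → Fin (n + 1) → ℝ)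
    (x : V) : Prop :=
  (∀ j : Fin n, H.Adj 0 j.succ → |((candidates H G U x j).card : ℝ) -
      d 0 j.succ * p * (U j.succ).card| ≤ κ * p * s j.succ) ∧
  ∀ i j : Fin n, H.Adj i.succ j.succ → CutBdd (fun x y => adjInd G x y - d i.succ j.succ * p)
      (η * p * ((if H.Adj 0 i.succ then p else 1) * s i.succ) *
        ((if H.Adj 0 j.succ then p else 1) * s j.succ))
      (candidates H G U x i) (candidates H G U x j)

variable {n : ℕ} {H : SimpleGraph (Fin (n + 1))} {h : Fin (n + 1) → ℕ} {K p θ κ η : ℝ}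
  {G Γ : SimpleGraph V} {U : Fin (n + 1) → Finset V} {s : Fin (n + 1) → ℝ}
  {d : Fin (n + 1) → Fin (n + 1) → ℝ}

theorem card_not_typical_le (A : Admissible H h K) (hθ : 0 < θ) (hθ1 : θ ≤ 1)
    (D : Host H h K p (θ ^ 2) Γ U s) (hG : G ≤ Γ) (R : CutRegular H p (θ ^ 2) G U s d)
    (hη : θ ^ 2 ≤ η) (hκ : 0 < κ) :
    (((U 0).filter fun x => ¬ IsTypicalImage H p κ η G U s d x).card : ℝ) ≤
      (n / κ + 29 * n ^ 2 / η) * √θ * s 0 := by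
  have hη0 : 0 < η := lt_of_lt_of_le (by positivity) hη
  have hs0 := D.s_pos 0
  have hsq : θ ^ 2 ≤ √θ := (pow_le_of_le_one hθ.le hθ1 (by norm_num)).trans
    (Real.le_sqrt_of_sq_le (pow_le_of_le_one hθ.le hθ1 (by norm_num)))
  set B1 : Fin n → Finset V := fun j => if H.Adj 0 j.succ then (U 0).filter fun x =>
    ¬ |((candidates H G U x j).card : ℝ) - d 0 j.succ * p * (U j.succ).card| ≤
      κ * p * s j.succ else ∅ with hB1
  set B2 : Fin n × Fin n → Finset V := fun q => if H.Adj q.1.succ q.2.succ then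
    (U 0).filter fun x => ¬ CutBdd (fun x y => adjInd G x y - d q.1.succ q.2.succ * p)
      (η * p * ((if H.Adj 0 q.1.succ then p else 1) * s q.1.succ) *
        ((if H.Adj 0 q.2.succ then p else 1) * s q.2.succ))
      (candidates H G U x q.1) (candidates H G U x q.2) else ∅ with hB2
  have hsub : ((U 0).filter fun x => ¬ IsTypicalImage H p κ η G U s d x) ⊆
      Finset.univ.biUnion B1 ∪ Finset.univ.biUnion B2 := by
    intro x hx
    rw [Finset.mem_filter, IsTypicalImage, not_and_or] at hx
    rw [Finset.mem_union]
    refine hx.2.imp (fun h' => ?_) fun h' => ?_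
    · simp only [not_forall] at h'
      obtain ⟨j, hj, h'⟩ := h'
      refine Finset.mem_biUnion.mpr ⟨j, Finset.mem_univ _, ?_⟩
      simp only [hB1, if_pos hj]
      exact Finset.mem_filter.mpr ⟨hx.1, h'⟩
    · simp only [not_forall] at h'
      obtain ⟨i, j, hj, h'⟩ := h'
      refine Finset.mem_biUnion.mpr ⟨(i, j), Finset.mem_univ _, ?_⟩
      simp only [hB2, if_pos hj]
      exact Finset.mem_filter.mpr ⟨hx.1, h'⟩
  have c1 : ∀ j, ((B1 j).card : ℝ) ≤ √θ * s 0 / κ := by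
    intro j
    simp only [hB1]
    split_ifs with hj
    · rw [le_div_iff₀ hκ]
      exact (card_not_degree_le D R hj).trans (by gcongr)
    · simp only [Finset.card_empty, Nat.cast_zero]; positivity
  have c2 : ∀ q, ((B2 q).card : ℝ) ≤ 29 * √θ * s 0 / η := by
    rintro ⟨i, j⟩
    by_cases hj : H.Adj i.succ j.succ
    · have := card_not_inherit_le A hθ hθ1 D hG R hj hη
      rw [← le_div_iff₀ hη0] at this
      refine le_trans (le_of_eq ?_) this
      simp only [hB2]
      rw [if_pos hj]
    · simp only [hB2]
      rw [if_neg hj, Finset.card_empty, Nat.cast_zero]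
      positivity
  clear_value B1 B2
  have hN := (Finset.card_le_card hsub).trans ((Finset.card_union_le _ _).trans
    (add_le_add Finset.card_biUnion_le Finset.card_biUnion_le))
  calc _ ≤ ((∑ j, (B1 j).card + ∑ q, (B2 q).card : ℕ) : ℝ) := Nat.cast_le.mpr hN
    _ ≤ ∑ _j : Fin n, √θ * s 0 / κ + ∑ _q : Fin n × Fin n, 29 * √θ * s 0 / η := by
        push_cast
        exact add_le_add (Finset.sum_le_sum fun j _ => c1 j) (Finset.sum_le_sum fun q _ => c2 q)
    _ = _ := by
        simp only [Finset.sum_const, Finset.card_univ, Fintype.card_prod, Fintype.card_fin,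
          nsmul_eq_mul, Nat.cast_mul]
        ring

/-- The expected size of the candidate set of `j` after the embedding of the vertex `0`. -/
noncomputable def expectedCard {n : ℕ} (H : SimpleGraph (Fin (n + 1))) (p : ℝ)
    (U : Fin (n + 1) → Finset V) (d : Fin (n + 1) → Fin (n + 1) → ℝ) (j : Fin n) : ℝ :=
  if H.Adj 0 j.succ then d 0 j.succ * p * (U j.succ).card else (U j.succ).card

theorem edgeProd_mul_prod_card (H : SimpleGraph (Fin (n + 1))) (p : ℝ)
    (U : Fin (n + 1) → Finset V) (d : Fin (n + 1) → Fin (n + 1) → ℝ) :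
    edgeProd H (fun i j => d i j * p) * ∏ i, ((U i).card : ℝ) =
      (U 0).card * (edgeProd (H.comap Fin.succ) (fun i j => d i.succ j.succ * p) *
        ∏ j, expectedCard H p U d j) := by
  have : ∏ j, expectedCard H p U d j =
      (∏ j : Fin n, if H.Adj 0 j.succ then d 0 j.succ * p else 1) *
        ∏ j : Fin n, ((U j.succ).card : ℝ) := by
    rw [← Finset.prod_mul_distrib]
    refine Finset.prod_congr rfl fun j _ => ?_
    unfold expectedCard
    split_ifs <;> simp
  rw [edgeProd_succ, Fin.prod_univ_succ, this]
  ring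

theorem edgeProd_const_mul_prod (H : SimpleGraph (Fin (n + 1))) (p : ℝ)
    (s : Fin (n + 1) → ℝ) :
    edgeProd H (fun _ _ => p) * ∏ i, s i =
      s 0 * (edgeProd (H.comap Fin.succ) (fun _ _ => p) *
        ∏ j : Fin n, ((if H.Adj 0 j.succ then p else 1) * s j.succ)) := by
  rw [edgeProd_succ, Fin.prod_univ_succ, Finset.prod_mul_distrib]
  ring

theorem expectedCard_nonneg (D : Host H h K p η Γ U s) (R : CutRegular H p θ G U s d) (j : Fin n) :
    0 ≤ expectedCard H p U d j := by
  have := D.p_pos; have := R.nonneg 0 j.succ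
  unfold expectedCard; split_ifs <;> positivity

/-- With a further error of at most one scale, actual sizes are at most four scales; this is the
source of the powers of 4 below. -/
theorem expectedCard_le (D : Host H h K p η Γ U s) (R : CutRegular H p θ G U s d) (j : Fin n) :
    expectedCard H p U d j ≤ 3 * ((if H.Adj 0 j.succ then p else 1) * s j.succ) := by
  have := D.p_pos; have h1 := R.nonneg 0 j.succ; have h2 := R.le_two 0 j.succ
  have h3 := D.card_le j.succ; have := D.s_pos j.succ
  unfold expectedCard
  split_ifs
  · calc _ ≤ 2 * p * s j.succ := by gcongr
      _ ≤ 3 * (p * s j.succ) := by nlinarith [mul_pos D.p_pos (D.s_pos j.succ)]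
  · linarith

theorem IsTypicalImage.abs_card_sub_le (D : Host H h K p θ Γ U s) {x : V}
    (T : IsTypicalImage H p κ η G U s d x) (hκ : 0 ≤ κ) (j : Fin n) :
    |((candidates H G U x j).card : ℝ) - expectedCard H p U d j| ≤
      κ * ((if H.Adj 0 j.succ then p else 1) * s j.succ) := by
  have := D.s_pos j.succ
  unfold expectedCard
  split_ifs with hj
  · rw [← mul_assoc]; exact T.1 j hj
  · simp only [candidates, if_neg hj, sub_self, abs_zero]; positivity

theorem abs_prod_card_sub_le (D : Host H h K p η Γ U s) (R : CutRegular H p θ G U s d)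
    {c : Fin n → ℝ} (hc0 : ∀ j, 0 ≤ c j) (hκ : 0 ≤ κ) (hκ1 : κ ≤ 1)
    (hc : ∀ j, |c j - expectedCard H p U d j| ≤
      κ * ((if H.Adj 0 j.succ then p else 1) * s j.succ)) :
    |∏ j, c j - ∏ j, expectedCard H p U d j| ≤
      n * κ * 4 ^ n * ∏ j : Fin n, ((if H.Adj 0 j.succ then p else 1) * s j.succ) := by
  set S : Fin n → ℝ := fun j => (if H.Adj 0 j.succ then p else 1) * s j.succ with hS
  have hSpos : ∀ j, 0 < S j := fun j => by
    have := D.p_pos; have := D.s_pos j.succ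
    simp only [hS]; split_ifs <;> positivity
  have key := abs_prod_sub_prod_le Finset.univ (a := fun j => c j / S j)
    (b := fun j => expectedCard H p U d j / S j) (T := 4) (κ := κ) (by norm_num) hκ
    (fun j => div_nonneg (hc0 j) (hSpos j).le) (fun j => by
      rw [div_le_iff₀ (hSpos j)]
      have h1 := (abs_le.mp (hc j)).2
      have h2 := expectedCard_le D R j
      have h3 : κ * S j ≤ 1 * S j := mul_le_mul_of_nonneg_right hκ1 (hSpos j).le
      simp only [hS] at h3 ⊢
      linarith)
    (fun j => div_nonneg (expectedCard_nonneg D R j) (hSpos j).le) (fun j => by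
      rw [div_le_iff₀ (hSpos j)]
      have h2 := expectedCard_le D R j
      have h3 := (hSpos j).le
      simp only [hS] at h3 ⊢
      linarith) (fun j => by
      rw [← sub_div, abs_div, abs_of_pos (hSpos j), div_le_iff₀ (hSpos j)]
      exact hc j)
  have hP : 0 < ∏ j, S j := Finset.prod_pos fun j _ => hSpos j
  rw [Finset.prod_div_distrib, Finset.prod_div_distrib, ← sub_div, abs_div, abs_of_pos hP,
    div_le_iff₀ hP, Finset.card_univ, Fintype.card_fin] at key
  exact key

theorem Host.mono_eta {n : ℕ} {H : SimpleGraph (Fin n)} {h : Fin n → ℕ} {U : Fin n → Finset V}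
    {s : Fin n → ℝ} {η' : ℝ} (D : Host H h K p η Γ U s) (h0 : 0 ≤ η) (hη : η ≤ η') :
    Host H h K p η' Γ U s :=
  { D with
    jumbled := fun i j hij => (D.jumbled i j hij).mono (by
      have := D.p_pos; have := D.s_pos i; have := D.s_pos j
      gcongr) subset_rfl subset_rfl }

/-- The copies in which the image of `0` lies in a small set are few. -/
theorem Host.sum_copyCount_candidates_le (D : Host H h K p (θ ^ 2) Γ U s) {C ρ : ℝ} (hρ : 0 < ρ)
    (hρ1 : ρ ≤ 1)
    (hθρ : (θ ^ 2) ^ 2 ≤ ρ)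
    (hC : ∀ (U : Fin (n + 1) → Finset V) (s : Fin (n + 1) → ℝ), Host H h K p 1 Γ U s →
      copyCount H Γ U ≤ C * edgeProd H (fun _ _ => p) * ∏ i, s i)
    {B : Finset V} (hB : B ⊆ U 0) (hcard : (B.card : ℝ) ≤ ρ * s 0) (hG : G ≤ Γ) :
    ∑ x ∈ B, copyCount (H.comap Fin.succ) G (candidates H G U x) ≤
      C * ρ * (edgeProd H (fun _ _ => p) * ∏ i, s i) := by
  have hp := D.p_pos
  set U' : Fin (n + 1) → Finset V := Fin.cons B fun j => U j.succ with hU'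
  set s' : Fin (n + 1) → ℝ := Fin.cons (ρ * s 0) fun j => s j.succ with hs'
  have hs'pos : ∀ i, 0 < s' i := by
    intro i
    refine Fin.cases ?_ (fun j => ?_) i
    · simp only [hs', Fin.cons_zero]; have := D.s_pos 0; positivity
    · simpa only [hs', Fin.cons_succ] using D.s_pos j.succ
  have hUU : ∀ i, U' i ⊆ U i := by
    intro i
    refine Fin.cases ?_ (fun j => ?_) i
    · simpa [hU'] using hB
    · simp [hU']
  -- At most one of two distinct indices is `0`, so shrinking the first scale costs one factor `ρ`.
  -- The small jumbledness parameter absorbs it through `(θ ^ 2) ^ 2 ≤ ρ`, leaving a host with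
  -- parameter `1`.
  have hss : ∀ i j, i ≠ j → ρ * (s i * s j) ≤ s' i * s' j := by
    have hone : ∀ j : Fin (n + 1), s' j = if j = 0 then ρ * s 0 else s j := by
      intro j
      refine Fin.cases ?_ (fun j => ?_) j <;> simp [hs']
    intro i j hij
    have := D.s_pos i; have := D.s_pos j
    rw [hone, hone]
    by_cases hi : i = 0
    · have hj : j ≠ 0 := fun hj => hij (hi.trans hj.symm)
      rw [if_pos hi, if_neg hj, hi, mul_assoc]
    · rw [if_neg hi]
      split_ifs with hj
      · rw [hj]; exact le_of_eq (by ring)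
      · exact mul_le_of_le_one_left (by positivity) hρ1
  have hHost : Host H h K p 1 Γ U' s' := by
    refine ⟨hp, D.p_le, hs'pos, fun i => ?_, fun i j hij => ?_⟩
    · refine Fin.cases ?_ (fun j => ?_) i
      · simpa [hU', hs'] using hcard
      · simpa [hU', hs'] using D.card_le j.succ
    · refine (D.jumbled i j hij).mono ?_ (hUU i) (hUU j)
      have := D.s_pos i; have := D.s_pos j
      calc _ = p ^ (2 * K - h i - h j) * ((θ ^ 2) ^ 2 * (s i * s j)) := by ring
        _ ≤ p ^ (2 * K - h i - h j) * (ρ * (s i * s j)) := by gcongr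
        _ ≤ p ^ (2 * K - h i - h j) * (s' i * s' j) := by
            gcongr ?_ * ?_
            exact hss i j hij.ne
        _ = _ := by ring
  have e : copyCount H Γ U' = ∑ x ∈ B, copyCount (H.comap Fin.succ) Γ (candidates H Γ U x) := by
    rw [copyCount_succ]
    simp only [hU', Fin.cons_zero]
    refine Finset.sum_congr rfl fun x _ => ?_
    congr 1
  have := hC U' s' hHost
  rw [e] at this
  refine (Finset.sum_le_sum fun x _ => copyCount_mono _ hG
    fun j => candidates_mono H hG U x j).trans (this.trans (le_of_eq ?_))
  simp only [hs', Fin.prod_univ_succ, Fin.cons_zero, Fin.cons_succ]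
  ring

/-- The counting lemma in terms of scales and cut norms. -/
theorem exists_abs_copyCount_sub_le (n : ℕ) : ∀ γ : ℝ, 0 < γ → ∃ η : ℝ, 0 < η ∧
    ∀ (H : SimpleGraph (Fin n)) (h : Fin n → ℕ) (K : ℝ), Admissible H h K →
    ∀ (V : Type u) (p : ℝ) (G Γ : SimpleGraph V) (U : Fin n → Finset V) (s : Fin n → ℝ)
      (d : Fin n → Fin n → ℝ), G ≤ Γ → Host H h K p η Γ U s → CutRegular H p η G U s d →
      |copyCount H G U - edgeProd H (fun i j => d i j * p) * ∏ i, ((U i).card : ℝ)| ≤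
        γ * (edgeProd H (fun _ _ => p) * ∏ i, s i) := by
  induction n with
  | zero =>
    intro γ hγ
    refine ⟨1, one_pos, fun H h K _ V p G Γ U s d _ _ _ => ?_⟩
    simp [copyCount, edgeProd, hγ.le]
  | succ n ih =>
    intro γ hγ
    obtain ⟨C, hC, hUB⟩ := exists_copyCount_le.{u} (n + 1)
    -- The induction hypothesis will be used with scales `4 S j`, whose product is `4 ^ n` times too
    -- large. The final error budget is `γ/4` from it, `γ/4` from the sizes (via `κ`) and `γ/4` from
    -- bad images (via `ρ`).
    obtain ⟨η, hη, ih⟩ := ih (γ / (4 * 4 ^ n)) (by positivity)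
    set κ : ℝ := min 1 (γ / (4 * (2 ^ (n * n) * (n * 4 ^ n) + 1))) with hκd
    have hκ : 0 < κ := by positivity
    have hκ1 : κ ≤ 1 := min_le_left _ _
    have hκγ : 2 ^ (n * n) * (n * κ * 4 ^ n) ≤ γ / 4 := by
      have h1 : κ ≤ γ / (4 * (2 ^ (n * n) * (n * 4 ^ n) + 1)) := min_le_right _ _
      rw [le_div_iff₀ (by positivity)] at h1
      have h2 : (0 : ℝ) ≤ 2 ^ (n * n) * (n * 4 ^ n) := by positivity
      nlinarith
    set ρ : ℝ := min 1 (γ / (4 * (C + 2 ^ (n * n) * 4 ^ n))) with hρd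
    have hρ : 0 < ρ := by positivity
    have hρ1 : ρ ≤ 1 := min_le_left _ _
    have hργ : C * ρ + ρ * (2 ^ (n * n) * 4 ^ n) ≤ γ / 4 := by
      have h1 : ρ ≤ γ / (4 * (C + 2 ^ (n * n) * 4 ^ n)) := min_le_right _ _
      rw [le_div_iff₀ (by positivity)] at h1
      linarith
    set L : ℝ := n / κ + 29 * n ^ 2 / η with hL
    have hL0 : 0 ≤ L := by positivity
    -- `L √θ` bounds the proportion of bad images; with `θ = μ ^ 2` this is `L μ ≤ ρ`.
    set μ : ℝ := min (min 1 η) (min ρ (ρ / (L + 1))) with hμd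
    have hμ : 0 < μ := by positivity
    have hμ1 : μ ≤ 1 := (min_le_left _ _).trans (min_le_left _ _)
    have hμη : μ ≤ η := (min_le_left _ _).trans (min_le_right _ _)
    have hμρ : μ ≤ ρ := (min_le_right _ _).trans (min_le_left _ _)
    have hμL : L * μ ≤ ρ := by
      have h1 : μ ≤ ρ / (L + 1) := (min_le_right _ _).trans (min_le_right _ _)
      rw [le_div_iff₀ (by positivity)] at h1
      nlinarith
    set θ : ℝ := μ ^ 2 with hθd
    have hθ : 0 < θ := by positivity
    have hθ1 : θ ≤ 1 := pow_le_one₀ hμ.le hμ1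
    have hsq : √θ = μ := Real.sqrt_sq hμ.le
    have hθη : θ ^ 2 ≤ η := by
      rw [hθd, ← pow_mul]; exact (pow_le_of_le_one hμ.le hμ1 (by norm_num)).trans hμη
    have hθρ : (θ ^ 2) ^ 2 ≤ ρ := by
      rw [hθd, ← pow_mul, ← pow_mul]
      exact (pow_le_of_le_one hμ.le hμ1 (by norm_num)).trans hμρ
    refine ⟨θ ^ 2, by positivity, fun H h K A V p G Γ U s d hG D R => ?_⟩
    have hp := D.p_pos
    set S : Fin n → ℝ := fun j => (if H.Adj 0 j.succ then p else 1) * s j.succ with hS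
    have hSpos : ∀ j, 0 < S j := fun j => by
      have := D.p_pos; have := D.s_pos j.succ
      simp only [hS]; split_ifs <;> positivity
    have hP : 0 < ∏ j, S j := Finset.prod_pos fun j _ => hSpos j
    have hs0 := D.s_pos 0
    set E := edgeProd (H.comap Fin.succ) (fun _ _ => p) with hE
    have hE0 : 0 ≤ E := edgeProd_nonneg _ fun _ _ => hp.le
    set Ed := edgeProd (H.comap Fin.succ) (fun i j => d i.succ j.succ * p) with hEd
    have hEd0 : 0 ≤ Ed := edgeProd_nonneg _ fun _ _ => mul_nonneg (R.nonneg _ _) hp.le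
    have hEdE : Ed ≤ 2 ^ (n * n) * E := by
      rw [hEd, edgeProd_mul]
      exact mul_le_mul_of_nonneg_right
        (edgeProd_le _ one_le_two (fun _ _ => R.nonneg _ _) fun _ _ => R.le_two _ _) hE0
    set M := ∏ j, expectedCard H p U d j with hM
    have hM0 : 0 ≤ M := Finset.prod_nonneg fun j _ => expectedCard_nonneg D R j
    have hMle : M ≤ 4 ^ n * ∏ j, S j := by
      calc M ≤ ∏ j, (4 * S j) := Finset.prod_le_prod (fun j _ => expectedCard_nonneg D R j)
            fun j _ => (expectedCard_le D R j).trans (by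
              have := (hSpos j).le
              simp only [hS] at this ⊢
              linarith)
        _ = _ := by rw [Finset.prod_mul_distrib]; simp
    have hEM : Ed * M ≤ 2 ^ (n * n) * 4 ^ n * (E * ∏ j, S j) := by
      calc Ed * M ≤ (2 ^ (n * n) * E) * (4 ^ n * ∏ j, S j) := by gcongr
        _ = _ := by ring
    set B := (U 0).filter fun x => ¬ IsTypicalImage H p κ η G U s d x with hB
    have hBcard : (B.card : ℝ) ≤ ρ * s 0 := by
      refine (card_not_typical_le A hθ hθ1 D hG R hθη hκ).trans ?_
      rw [hsq]
      gcongr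
    set cnt : V → ℝ := fun x => copyCount (H.comap Fin.succ) G (candidates H G U x) with hcnt
    have hbad : ∑ x ∈ B, cnt x ≤ C * ρ * (edgeProd H (fun _ _ => p) * ∏ i, s i) :=
      D.sum_copyCount_candidates_le hρ hρ1 hθρ (fun U s => hUB H h K A V p Γ U s)
        (Finset.filter_subset _ _) hBcard hG
    have hgood : ∀ x ∈ (U 0).filter fun x => IsTypicalImage H p κ η G U s d x,
        |cnt x - Ed * M| ≤ γ / 2 * (E * ∏ j, S j) := by
      intro x hx
      have T := (Finset.mem_filter.mp hx).2
      have hc := T.abs_card_sub_le D hκ.le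
      have hcard : ∀ j, ((candidates H G U x j).card : ℝ) ≤ 4 * S j := by
        intro j
        have h1 := (abs_le.mp (hc j)).2
        have h2 := expectedCard_le D R j
        have h3 : κ * S j ≤ 1 * S j := mul_le_mul_of_nonneg_right hκ1 (hSpos j).le
        simp only [hS] at h3 ⊢
        linarith
      have hS4 : ∀ j, S j ≤ 4 * S j := fun j => by linarith [hSpos j]
      have D' := (D.tail (U' := candidates H G U x) (s' := fun j => 4 * S j)
        (fun j => candidates_subset _ _ _ _ _) hcard hS4).mono_eta (by positivity) hθη
      have R' : CutRegular (H.comap Fin.succ) p η G (candidates H G U x) (fun j => 4 * S j)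
          (fun i j => d i.succ j.succ) :=
        ⟨fun _ _ => R.nonneg _ _, fun _ _ => R.le_two _ _, fun i j hij =>
          (T.2 i j hij).mono (by
            have := hSpos i; have := hSpos j
            have h4 := mul_le_mul (hS4 i) (hS4 j) (hSpos j).le (by positivity)
            have h5 := mul_le_mul_of_nonneg_left h4 (show 0 ≤ η * p by positivity)
            simp only [hS] at h5 ⊢
            linarith) subset_rfl subset_rfl⟩
      have i1 := ih _ _ K A.tail V p G Γ _ _ _ hG D' R'
      have i2 := abs_prod_card_sub_le D R (c := fun j => ((candidates H G U x j).card : ℝ))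
        (fun j => by positivity) hκ.le hκ1 hc
      have e1 : ∏ j, (4 * S j) = 4 ^ n * ∏ j, S j := by
        rw [Finset.prod_mul_distrib]; simp
      rw [e1] at i1
      have i1' : |cnt x - Ed * ∏ j, ((candidates H G U x j).card : ℝ)| ≤
          γ / 4 * (E * ∏ j, S j) := by
        refine i1.trans (le_of_eq ?_)
        change γ / (4 * 4 ^ n) * (E * (4 ^ n * ∏ j, S j)) = _
        field_simp
      have i3 : |Ed * ∏ j, ((candidates H G U x j).card : ℝ) - Ed * M| ≤
          γ / 4 * (E * ∏ j, S j) := by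
        rw [← mul_sub, abs_mul, abs_of_nonneg hEd0]
        calc _ ≤ (2 ^ (n * n) * E) * (n * κ * 4 ^ n * ∏ j, S j) := by gcongr
          _ = 2 ^ (n * n) * (n * κ * 4 ^ n) * (E * ∏ j, S j) := by ring
          _ ≤ _ := by gcongr
      refine (abs_sub_le _ (Ed * ∏ j, ((candidates H G U x j).card : ℝ)) _).trans ?_
      linarith
    rw [edgeProd_mul_prod_card, copyCount_succ]
    have hW : edgeProd H (fun _ _ => p) * ∏ i, s i = s 0 * (E * ∏ j, S j) :=
      edgeProd_const_mul_prod H p s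
    have hEP : 0 ≤ E * ∏ j, S j := by positivity
    have e2 : ∑ x ∈ U 0, cnt x - (U 0).card * (Ed * M) = ∑ x ∈ U 0, (cnt x - Ed * M) := by
      rw [Finset.sum_sub_distrib, Finset.sum_const, nsmul_eq_mul]
    change |∑ x ∈ U 0, cnt x - (U 0).card * (Ed * M)| ≤ _
    rw [e2]
    refine (Finset.abs_sum_le_sum_abs _ _).trans ?_
    rw [← Finset.sum_filter_add_sum_filter_not (U 0) (IsTypicalImage H p κ η G U s d)]
    have g1 : ∑ x ∈ U 0 with IsTypicalImage H p κ η G U s d x, |cnt x - Ed * M| ≤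
        s 0 * (γ / 2 * (E * ∏ j, S j)) := by
      refine (Finset.sum_le_sum hgood).trans ?_
      rw [Finset.sum_const, nsmul_eq_mul]
      gcongr
      exact le_trans (by exact_mod_cast Finset.card_le_card (Finset.filter_subset _ _))
        (D.card_le 0)
    -- For bad images nothing cancels: the actual count, bounded through `Γ`, and the expected count
    -- are both negligible in total.
    have g2 : ∑ x ∈ B, |cnt x - Ed * M| ≤ γ / 4 * (s 0 * (E * ∏ j, S j)) := by
      calc _ ≤ ∑ x ∈ B, (cnt x + Ed * M) := by
            refine Finset.sum_le_sum fun x _ => ?_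
            have h1 : 0 ≤ cnt x := copyCount_nonneg _ _ _
            have h2 : 0 ≤ Ed * M := mul_nonneg hEd0 hM0
            rw [abs_le]; constructor <;> linarith
        _ = ∑ x ∈ B, cnt x + B.card * (Ed * M) := by
            rw [Finset.sum_add_distrib, Finset.sum_const, nsmul_eq_mul]
        _ ≤ C * ρ * (s 0 * (E * ∏ j, S j)) +
            (ρ * s 0) * (2 ^ (n * n) * 4 ^ n * (E * ∏ j, S j)) := by
            rw [hW] at hbad
            gcongr
        _ = (C * ρ + ρ * (2 ^ (n * n) * 4 ^ n)) * (s 0 * (E * ∏ j, S j)) := by ring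
        _ ≤ _ := by gcongr
    rw [hW]
    have h0 : 0 ≤ γ * (s 0 * (E * ∏ j, S j)) := by positivity
    linarith

end MainInduction

/-! ### The two graph parameters imply admissibility. -/

section Parameters

variable {m : ℕ}

theorem one_le_kRegEdgeTerm (H : SimpleGraph (Fin m)) (i j : Fin m) : 1 ≤ kRegEdgeTerm H i j := by
  unfold kRegEdgeTerm; split_ifs <;> norm_num

theorem three_halves_le_kRegEdgeTerm {H : SimpleGraph (Fin m)} {i j k : Fin m} (hik : i < k)
    (hjk : H.Adj j k) : 3 / 2 ≤ kRegEdgeTerm H i j := by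
  have : ∃ k, i < k ∧ H.Adj j k := ⟨k, hik, hjk⟩
  unfold kRegEdgeTerm
  rw [if_pos this]
  split_ifs <;> norm_num

theorem kRegEdgeTerm_eq_three {H : SimpleGraph (Fin m)} {i j k : Fin m} (hik : i < k)
    (hjk : H.Adj j k) (hik' : H.Adj i k)
    (hle : (nbrBefore H i k).card ≤ (nbrBefore H i j).card) : kRegEdgeTerm H i j = 3 := by
  unfold kRegEdgeTerm
  rw [if_pos ⟨k, hik, hjk, hik', hle⟩]

theorem two_le_kRegPathTerm (H : SimpleGraph (Fin m)) (i j' : Fin m) :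
    2 ≤ kRegPathTerm H i j' := by
  unfold kRegPathTerm; split_ifs <;> norm_num

theorem isKRegBound_kReg {H : SimpleGraph (Fin m)} {a b : Fin m} (hab : H.Adj a b) :
    IsKRegBound H (kReg H) :=
  (isLeast_kReg H hab).1

theorem one_le_kReg {H : SimpleGraph (Fin m)} {a b : Fin m} (hab : H.Adj a b) : 1 ≤ kReg H := by
  obtain ⟨i, j, hlt, hadj⟩ : ∃ i j : Fin m, i < j ∧ H.Adj i j := by
    rcases lt_or_gt_of_ne hab.ne with h | h
    · exact ⟨a, b, h, hab⟩
    · exact ⟨b, a, h, hab.symm⟩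
  have h1 := (isKRegBound_kReg hab).1 i j hlt hadj
  have h2 := one_le_kRegEdgeTerm H i j
  have h3 : (0 : ℝ) ≤ ((nbrPrev H i).card : ℝ) / 2 + ((nbrBefore H i j).card : ℝ) / 2 := by
    positivity
  linarith

/-- Positions start at 1, so there is one less predecessor than the position. With the summand `1/2`
next to `dTilde / 2`, this makes the required `2` in the condition `order`. -/
theorem card_tauPos_lt_add_one_le (H : SimpleGraph (Fin m)) {i w : Fin m}
    (hw : w ∈ nbrAfter H i) :
    (Finset.univ.filter fun u => i < u ∧ H.Adj i u ∧ tauPos H i u < tauPos H i w).card + 1 ≤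
      tauPos H i w := by
  obtain ⟨⟨hmaps, hinj, -⟩, -⟩ := isDecreasingOrdering_tauPos H i
  have hmem : ∀ u ∈ Finset.univ.filter fun u => i < u ∧ H.Adj i u ∧
      tauPos H i u < tauPos H i w, u ∈ nbrAfter H i := by
    intro u hu
    have := (Finset.mem_filter.mp hu).2
    exact Finset.mem_filter.mpr ⟨Finset.mem_univ _, this.2.1, this.1⟩
  have h1 : 1 ≤ tauPos H i w := (hmaps hw).1
  have : (Finset.univ.filter fun u => i < u ∧ H.Adj i u ∧ tauPos H i u < tauPos H i w).card ≤
      (Finset.Ico 1 (tauPos H i w)).card := by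
    refine Finset.card_le_card_of_injOn (tauPos H i) (fun u hu => ?_) fun u hu v hv huv =>
      hinj (hmem u hu) (hmem v hv) huv
    exact Finset.mem_coe.mpr (Finset.mem_Ico.mpr
      ⟨(hmaps (hmem u hu)).1, (Finset.mem_filter.mp hu).2.2.2⟩)
  rw [Nat.card_Ico] at this
  omega

/-- After doubling, the terms at least `2`, at least `3/2` and equal to `3` in the definition of
`kReg` become the exponents 4, 3 and 6; `dTilde` provides the ordering condition. -/
theorem admissible_of_kReg_of_dTilde (H : SimpleGraph (Fin m)) :
    Admissible H (fun _ => 0) (max (kReg H) (1 / 2 + (dTilde H : ℝ) / 2)) where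
  path i j j' h1 h2 h3 h4 := by
    have hb := (isKRegBound_kReg h3).2 i j j' h1 h2 h3 h4
    have ht := two_le_kRegPathTerm H i j'
    have hK := le_max_left (kReg H) (1 / 2 + (dTilde H : ℝ) / 2)
    simp only [embDegree, zero_add]
    linarith
  edge i j j' h1 h2 h3 h4 := by
    have hb := (isKRegBound_kReg h3).1 i j h1 h3
    have ht := three_halves_le_kRegEdgeTerm h2 h4
    have hK := le_max_left (kReg H) (1 / 2 + (dTilde H : ℝ) / 2)
    simp only [embDegree, zero_add]
    rw [nbrPrev] at hb
    linarith
  triangle i j j' h1 h2 h3 h4 h5 := by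
    have hK := le_max_left (kReg H) (1 / 2 + (dTilde H : ℝ) / 2)
    simp only [embDegree, zero_add]
    -- The value `3` is guaranteed only at the endpoint with more embedded neighbours. The bound
    -- there implies the bound at the other endpoint.
    rcases le_total (nbrBefore H i j').card (nbrBefore H i j).card with h | h
    · have hb := (isKRegBound_kReg h3).1 i j h1 h3
      rw [nbrPrev, kRegEdgeTerm_eq_three h2 h4 h5 h] at hb
      linarith
    · have hb := (isKRegBound_kReg h3).1 i j' h2 h5
      rw [nbrPrev, kRegEdgeTerm_eq_three h1 h4.symm h3 h] at hb
      have : ((nbrBefore H i j).card : ℝ) ≤ (nbrBefore H i j').card := by exact_mod_cast h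
      linarith
  order i := by
    obtain ⟨⟨-, hinj, -⟩, -⟩ := isDecreasingOrdering_tauPos H i
    refine ⟨tauPos H i, fun a ha b hb hab => hinj ?_ ?_ hab, fun w h1 h2 => ?_⟩
    · exact Finset.mem_filter.mpr ⟨Finset.mem_univ _, ha.2, ha.1⟩
    · exact Finset.mem_filter.mpr ⟨Finset.mem_univ _, hb.2, hb.1⟩
    · have hw : w ∈ nbrAfter H i := Finset.mem_filter.mpr ⟨Finset.mem_univ _, h2, h1⟩
      have hc := card_tauPos_lt_add_one_le H hw
      have hd : (nbrPrev H i).card + (tauPos H i w + (nbrBefore H i w).card) ≤ dTilde H := by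
        refine le_trans (Nat.add_le_add_left ?_ _) (Finset.le_sup (f := fun v : Fin m =>
          (nbrPrev H v).card + (nbrAfter H v).sup fun w => tauPos H v w + (nbrBefore H v w).card)
          (Finset.mem_univ i))
        exact Finset.le_sup (f := fun w => tauPos H i w + (nbrBefore H i w).card) hw
      have hK := le_max_right (kReg H) (1 / 2 + (dTilde H : ℝ) / 2)
      have hc' : ((Finset.univ.filter fun u => i < u ∧ H.Adj i u ∧
        tauPos H i u < tauPos H i w).card : ℝ) + 1 ≤ tauPos H i w := by exact_mod_cast hc
      have hd' : ((nbrPrev H i).card : ℝ) + (tauPos H i w + (nbrBefore H i w).card) ≤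
        dTilde H := by exact_mod_cast hd
      rw [nbrPrev] at hd'
      simp only [embDegree, zero_add]
      linarith

end Parameters

/-! ### From sparse regularity and bijumbledness to cut norms and bilinear forms. -/

section Pairs

variable {V : Type*}

theorem sum_sum_adjInd (G : SimpleGraph V) (X Y : Finset V) :
    ∑ x ∈ X, ∑ y ∈ Y, adjInd G x y = edgesBetween G X Y := by
  rw [edgesBetween, SimpleGraph.interedges_def, Finset.card_filter, Finset.sum_product]
  push_cast
  rfl

theorem sum_sum_adjInd_sub (G : SimpleGraph V) (X Y : Finset V) (q : ℝ) :
    ∑ x ∈ X, ∑ y ∈ Y, (adjInd G x y - q) = edgesBetween G X Y - q * X.card * Y.card := by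
  simp only [Finset.sum_sub_distrib, sum_sum_adjInd, Finset.sum_const, nsmul_eq_mul]
  ring

theorem edgesBetween_mono {G Γ : SimpleGraph V} (h : G ≤ Γ) (X Y : Finset V) :
    (edgesBetween G X Y : ℝ) ≤ edgesBetween Γ X Y := by
  rw [← sum_sum_adjInd, ← sum_sum_adjInd]
  exact Finset.sum_le_sum fun x _ => Finset.sum_le_sum fun y _ => adjInd_mono h x y

theorem IsBijumbledPair.jumbled {Γ : SimpleGraph V} {p B : ℝ} {X Y : Finset V} (hB : 0 ≤ B)
    (h : IsBijumbledPair Γ p B X Y) :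
    Jumbled (fun x y => adjInd Γ x y - p) (16 * B ^ 2) X Y := by
  refine jumbled_of_subsets X Y _ hB fun X' hX' Y' hY' => ?_
  rw [sum_sum_adjInd_sub]
  exact h X' Y' hX' hY'

/-- The number of edges between subsets of a bijumbled pair. -/
theorem IsBijumbledPair.edgesBetween_le {Γ : SimpleGraph V} {p β : ℝ} {X Y X' Y' : Finset V}
    (hβ : 0 ≤ β) (h : IsBijumbledPair Γ p (β * √((X.card : ℝ) * Y.card)) X Y) (hX : X' ⊆ X)
    (hY : Y' ⊆ Y) :
    (edgesBetween Γ X' Y' : ℝ) ≤ p * X'.card * Y'.card + β * X.card * Y.card := by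
  have h1 := (abs_le.mp (h X' Y' hX hY)).2
  have hX' : (X'.card : ℝ) ≤ X.card := by exact_mod_cast Finset.card_le_card hX
  have hY' : (Y'.card : ℝ) ≤ Y.card := by exact_mod_cast Finset.card_le_card hY
  have h2 : β * √((X.card : ℝ) * Y.card) * √((X'.card : ℝ) * Y'.card) ≤
      β * √((X.card : ℝ) * Y.card) * √((X.card : ℝ) * Y.card) := by gcongr
  rw [mul_assoc β _ √((X.card : ℝ) * Y.card), Real.mul_self_sqrt (by positivity)] at h2
  linarith

theorem pDensity_nonneg (G : SimpleGraph V) {p : ℝ} (hp : 0 < p) (X Y : Finset V) :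
    0 ≤ pDensity G p X Y := by
  unfold pDensity; positivity

theorem pDensity_mul {G : SimpleGraph V} {p : ℝ} (hp : 0 < p) (X Y : Finset V) :
    pDensity G p X Y * p * X.card * Y.card = edgesBetween G X Y := by
  rcases X.eq_empty_or_nonempty with rfl | hX
  · simp [edgesBetween, SimpleGraph.interedges_def]
  rcases Y.eq_empty_or_nonempty with rfl | hY
  · simp [edgesBetween, SimpleGraph.interedges_def]
  have : (0 : ℝ) < X.card := by exact_mod_cast hX.card_pos
  have : (0 : ℝ) < Y.card := by exact_mod_cast hY.card_pos
  unfold pDensity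
  field_simp

theorem pDensity_le_two {G Γ : SimpleGraph V} (hG : G ≤ Γ) {p β : ℝ} (hp : 0 < p) (hβ : 0 ≤ β)
    (hβp : β ≤ p) {X Y : Finset V}
    (h : IsBijumbledPair Γ p (β * √((X.card : ℝ) * Y.card)) X Y) : pDensity G p X Y ≤ 2 := by
  have h1 := (edgesBetween_mono hG X Y).trans (h.edgesBetween_le hβ subset_rfl subset_rfl)
  unfold pDensity
  refine div_le_of_le_mul₀ (by positivity) (by norm_num) (h1.trans ?_)
  have : β * X.card * Y.card ≤ p * X.card * Y.card := by gcongr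
  linarith

/-- A sparse regular pair in a subgraph of a bijumbled graph has small cut norm. -/
theorem IsSparseRegular.cutBdd {G Γ : SimpleGraph V} (hG : G ≤ Γ) {ε c p β : ℝ} (hp : 0 < p)
    (hε : 0 < ε) (hc1 : c ≤ 1) (hβ : 0 ≤ β) (hβp : β ≤ c * p) {X Y : Finset V}
    (hreg : IsSparseRegular G ε p X Y)
    (h : IsBijumbledPair Γ p (β * √((X.card : ℝ) * Y.card)) X Y) :
    CutBdd (fun x y => adjInd G x y - pDensity G p X Y * p)
      (4 * ((3 * ε + c) * p * X.card * Y.card)) X Y := by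
  refine cutBdd_of_subsets X Y _ fun X' hX Y' hY => ?_
  have hc0 : 0 ≤ c := by
    by_contra hc
    have : c * p < 0 := mul_neg_of_neg_of_pos (not_le.mp hc) hp
    linarith
  rw [sum_sum_adjInd_sub]
  have hX' : (X'.card : ℝ) ≤ X.card := by exact_mod_cast Finset.card_le_card hX
  have hY' : (Y'.card : ℝ) ≤ Y.card := by exact_mod_cast Finset.card_le_card hY
  -- Large subsets are handled by regularity. For small ones the actual edges, counted in `Γ`,
  -- contribute at most `ε + c` and the expected ones at most `2ε`, in units of `p |X| |Y|`; hence
  -- `3ε + c`.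
  by_cases hbig : ε * X.card ≤ X'.card ∧ ε * Y.card ≤ Y'.card
  · have hr := hreg X' Y' hX hY hbig.1 hbig.2
    rw [← pDensity_mul hp X' Y']
    have e : pDensity G p X' Y' * p * X'.card * Y'.card -
        pDensity G p X Y * p * X'.card * Y'.card =
        (pDensity G p X' Y' - pDensity G p X Y) * (p * X'.card * Y'.card) := by ring
    rw [e, abs_mul, abs_of_nonneg (a := p * _ * _) (by positivity)]
    calc _ ≤ ε * (p * X.card * Y.card) := by gcongr
      _ ≤ (3 * ε + c) * (p * X.card * Y.card) := by gcongr; linarith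
      _ = _ := by ring
  · have hsmall : (X'.card : ℝ) * Y'.card ≤ ε * (X.card * Y.card) := by
      rw [not_and_or, not_le, not_le] at hbig
      rcases hbig with hb | hb
      · calc (X'.card : ℝ) * Y'.card ≤ (ε * X.card) * Y.card := by gcongr
          _ = _ := by ring
      · calc (X'.card : ℝ) * Y'.card ≤ X.card * (ε * Y.card) := by gcongr
          _ = _ := by ring
    have h0 : (0 : ℝ) ≤ edgesBetween G X' Y' := by positivity
    have h1 := (edgesBetween_mono hG X' Y').trans (h.edgesBetween_le hβ hX hY)
    have hd0 := pDensity_nonneg G hp X Y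
    have hd2 := pDensity_le_two hG hp hβ (hβp.trans (mul_le_of_le_one_left hp.le hc1)) h
    have h2 : pDensity G p X Y * p * X'.card * Y'.card ≤ 2 * p * (ε * (X.card * Y.card)) := by
      rw [mul_assoc _ (X'.card : ℝ)]; gcongr
    have h3 : p * X'.card * Y'.card ≤ p * (ε * (X.card * Y.card)) := by
      rw [mul_assoc]; gcongr
    have h4 : β * X.card * Y.card ≤ c * p * X.card * Y.card := by gcongr
    have h5 : 0 ≤ pDensity G p X Y * p * X'.card * Y'.card := by positivity
    have h6 : 0 ≤ p * (ε * (X.card * Y.card)) := by positivity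
    have h7 : 0 ≤ c * p * X.card * Y.card := by positivity
    rw [abs_le]
    constructor <;> linarith

end Pairs

/-! ### Translation to the original counts and densities. -/

/-- Densities of non-edges are set to `0`, because `CutRegular` asks for values in `[0, 2]` at all
pairs of indices while densities are controlled only on edges. -/
theorem densityProd_mul_pow {m : ℕ} {V : Type*} (H : SimpleGraph (Fin m)) (G : SimpleGraph V)
    (p : ℝ) (P : Fin m → Finset V) :
    densityProd H G p P * p ^ H.edgeFinset.card =
      edgeProd H fun i j => (if H.Adj i j then pDensity G p (P i) (P j) else 0) * p := by
  rw [edgeProd_eq_prod_edgePairs, Finset.prod_mul_distrib, Finset.prod_const, card_edgePairs,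
    densityProd]
  congr 1
  refine Finset.prod_congr rfl fun x hx => ?_
  rw [if_pos (Finset.mem_filter.mp hx).2.2]

theorem numCopies_eq_zero {m : ℕ} {V : Type*} (H : SimpleGraph (Fin m)) (G : SimpleGraph V)
    {P : Fin m → Finset V} {i : Fin m} (hi : P i = ∅) : numCopies H G P = 0 := by
  rw [numCopies, Finset.card_eq_zero, Finset.eq_empty_iff_forall_notMem]
  intro φ hφ
  have := Fintype.mem_piFinset.mp (Finset.mem_filter.mp hφ).1 i
  rw [hi] at this
  simp at this

/-- Two-sided Counting Lemma. -/
theorem lemmaA2 (m : ℕ) (H : SimpleGraph (Fin m)) (γ : ℝ) (hγ : 0 < γ) :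
    ∃ ε c : ℝ, 0 < ε ∧ 0 < c ∧
      ∀ (p β : ℝ), 0 < p → p ≤ 1 →
        β = c * p ^ (max (kReg H) (1 / 2 + (dTilde H : ℝ) / 2)) →
      ∀ (V : Type*) (G Γ : SimpleGraph V) (P : Fin m → Finset V), G ≤ Γ →
        (∀ i j : Fin m, H.Adj i j →
          Disjoint (P i) (P j) ∧
          IsSparseRegular G ε p (P i) (P j) ∧
          IsBijumbledPair Γ p (β * Real.sqrt (((P i).card : ℝ) * (P j).card)) (P i) (P j)) →
        |(numCopies H G P : ℝ) -
            densityProd H G p P * p ^ H.edgeFinset.card * ∏ i, ((P i).card : ℝ)| ≤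
          γ * p ^ H.edgeFinset.card * ∏ i, ((P i).card : ℝ) := by
  obtain ⟨η, hη, hcount⟩ := exists_abs_copyCount_sub_le m γ hγ
  -- The cut norm bound becomes `4 (3η/24 + η/8) = η`, and passing to functions turns the
  -- jumbledness constant into `4c ≤ η`.
  refine ⟨η / 24, min 1 (η / 8), by positivity, by positivity, ?_⟩
  set c : ℝ := min 1 (η / 8) with hcd
  have hc : 0 < c := by positivity
  have hc1 : c ≤ 1 := min_le_left _ _
  have hcη : c ≤ η / 8 := min_le_right _ _
  intro p β hp hp1 hβ V G Γ P hG hP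
  set K := max (kReg H) (1 / 2 + (dTilde H : ℝ) / 2) with hK
  have hβ0 : 0 ≤ β := by rw [hβ]; positivity
  have hβp : ∀ {i j}, H.Adj i j → β ≤ c * p := by
    intro i j hij
    have : p ^ K ≤ p ^ (1 : ℝ) :=
      Real.rpow_le_rpow_of_exponent_ge hp hp1 ((one_le_kReg hij).trans (le_max_left _ _))
    rw [Real.rpow_one] at this
    rw [hβ]; gcongr
  -- The scales are the sizes of the parts and must be positive; if a part is empty, both sides of
  -- the claim vanish.
  by_cases hne : ∀ i, (P i).Nonempty
  · have D : Host H (fun _ => 0) K p η Γ P (fun i => ((P i).card : ℝ)) := by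
      refine ⟨hp, hp1, fun i => by exact_mod_cast (hne i).card_pos, fun i => le_rfl,
        fun i j hij => ?_⟩
      refine ((hP i j hij).2.2.jumbled (by positivity)).mono ?_ subset_rfl subset_rfl
      have e : p ^ (2 * K - ((0 : ℕ) : ℝ) - ((0 : ℕ) : ℝ)) = (p ^ K) ^ 2 := by
        rw [Nat.cast_zero, sub_zero, sub_zero, mul_comm, Real.rpow_mul hp.le, Real.rpow_ofNat]
      rw [e, mul_pow, Real.sq_sqrt (by positivity), hβ]
      calc _ = (4 * c) ^ 2 * (p ^ K) ^ 2 * (P i).card * (P j).card := by ring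
        _ ≤ η ^ 2 * (p ^ K) ^ 2 * (P i).card * (P j).card := by gcongr; linarith
    have R : CutRegular H p η G P (fun i => ((P i).card : ℝ))
        (fun i j => if H.Adj i j then pDensity G p (P i) (P j) else 0) := by
      refine ⟨fun i j => ?_, fun i j => ?_, fun i j hij => ?_⟩
      · split_ifs
        exacts [pDensity_nonneg G hp _ _, le_rfl]
      · split_ifs with hij
        · exact pDensity_le_two hG hp hβ0 ((hβp hij).trans (mul_le_of_le_one_left hp.le hc1))
            (hP i j hij).2.2
        · norm_num
      · simp only [if_pos hij]
        refine ((hP i j hij).2.1.cutBdd hG hp (by positivity) hc1 hβ0 (hβp hij)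
          (hP i j hij).2.2).mono ?_ subset_rfl subset_rfl
        calc _ = (4 * (3 * (η / 24) + c)) * p * (P i).card * (P j).card := by ring
          _ ≤ η * p * (P i).card * (P j).card := by gcongr; linarith
    have := hcount H _ K (admissible_of_kReg_of_dTilde H) V p G Γ P _ _ hG D R
    rw [← densityProd_mul_pow, ← numCopies_eq_copyCount, edgeProd_eq_prod_edgePairs,
      Finset.prod_const, card_edgePairs, ← mul_assoc] at this
    exact this
  · simp only [not_forall, Finset.not_nonempty_iff_eq_empty] at hne
    obtain ⟨i, hi⟩ := hne
    have h0 : ∏ i, ((P i).card : ℝ) = 0 :=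
      Finset.prod_eq_zero (Finset.mem_univ i) (by simp [hi])
    simp [numCopies_eq_zero H G hi, h0]
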